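/- Let $L$ be a finite geometric lattice with least element $\hat 0$ and greatest element $\hat 1$, and let $L_+=L\setminus\{\hat 0\}$. A subset $\mathcal G\subseteq L_+$ is a building set if for every $x\in L_+$, with $\max \mathcal G_{\le x}=\{x_1,\dots,x_k\}$, there is a poset isomorphism $\prod_{j}[\hat 0,x_j]\to[\hat 0,x]$ sending $(\hat 0,\dots,x_j,\dots,\hat 0)$ to $x_j$ for each $j$. Fix a building set $\mathcal G$ with $\hat 1\in\mathcal G$. A subset $\mathcal H\subseteq\mathcal G$ is a partial building set (in $\mathcal G$) if it contains all atoms of $L$ and $\mathcal H^\circ=\mathcal H\setminus\{\text{atoms of }L\}$ is an upward-closed subset of $\mathcal G$. A set $S\subseteq\mathcal H$ is nested if no antichain in $S$ with at least two elements has its join (in $L$) in $\mathcal H$. Let $\mathcal L(L,\mathcal H)$ be the semilattice obtained from $L$ by successive combinatorial blowups at the elements of $\mathcal H^\circ$, larger elements first. Here the blowup of a semilattice $\mathcal L$ at $p>\hat 0$ is the poset with elements $x$ ($x\in\mathcal L$, $x\not\ge p$) and $(p,x)$ ($x\in \mathcal L$, $x\not\ge p$, $x\vee p$ exists), where $y\ge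 x$ as in $\mathcal L$, $(p,y)\ge(p,x)$ and $(p,y)\ge x$ whenever $y\ge x$ in $\mathcal L$, and there are no other relations. The atoms of $\mathcal L(L,\mathcal H)$ are identified with the elements of $\mathcal H$: an atom $g$ of $L$ with itself, and $g\in\mathcal H^\circ$ with $(g,\hat 0)$. A set $S\subseteq \mathcal H$ of atoms is independent if its join in $\mathcal L(L,\mathcal H)$ exists and has rank $|S|$, and it is a circuit if it is bounded above in $\mathcal L(L,\mathcal H)$ and minimally dependent. Let $R(\mathcal H)$ be the free graded-commutative $\mathbb Q$-algebra on generators $e_g$ of bidegree $(0,1)$ and $x_g$ of bidegree $(2,0)$, $g\in\mathcal H$, with the differential $d e_g=x_g$, $d x_g=0$, and let $\partial$ be the antiderivation with $\partial e_g=1$, $\partial x_g=0$. Let $\widehat B(L,\mathcal H)=R(\mathcal H)/I$, where $I$ is the ideal generated by 1. $e_Sx_T$ for $S,T\subseteq\mathcal H$ with $S\cup T$ not nested, 2. $\partial e_S$ for $S\subseteq\mathcal H$ nested and a circuit, 3. $\sum_{h\in\mathcal H,\ h\ge g}x_h$ for each atom $g$ of $L$. The bigrading and the differential of $R(\mathcal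 H)$ induce a bigrading and a differential on $\widehat B(L,\mathcal H)$. If $\hat 1\in\mathcal H$, let $B(L,\mathcal H)=\widehat B(L,\mathcal H)/(e_{\hat 1})$ with the induced bigrading and with the differential determined by $d e_g=x_g$ for $g\ne\hat 1$ and $d x_g=0$, that is, induced by $d$ on the subalgebra of $R(\mathcal H)$ generated by all $x_g$ and by the $e_g$ with $g\neq\hat 1$. **Theorem.** Let $\mathcal H$ and $\mathcal H'=\mathcal H\cup\{p\}$ with $p\notin\mathcal H$ be partial building sets in $\mathcal G$. Then the differentials above are well defined, and the assignment $$e_g\mapsto\begin{cases}e_g+e_p& g\le p\\ e_g& g\not\le p\end{cases}\qquad x_g\mapsto\begin{cases}x_g+x_p& g\le p\\ x_g& g\not\le p\end{cases}\qquad(g\in\mathcal H)$$ defines an injective homomorphism of $\mathbb Q$-algebras $\widehat B(L,\mathcal H)\to\widehat B(L,\mathcal H')$ that preserves the bigrading and commutes with the differentials. If moreover $\hat 1\in\mathcal H$, then the differentials on $B(L,\mathcal H)$ and $B(L,\mathcal H')$ are well defined, and the same formulas define an injective homomorphism of $\mathbb Q$-algebras $B(L,\mathcal H)\to B(L,\mathcal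 H')$ that preserves the bigrading and commutes with the differentials. -/

import Mathlib

/-! Combinatorial data: building sets, partial building sets, nested sets, and combinatorial
blowups of a finite geometric lattice `α`.  A (finite) geometric lattice is a finite lattice which
is atomistic and upper semimodular. -/

namespace Leray

universe u

section Combinatorics

variable {α : Type u} [Lattice α] [BoundedOrder α] [Fintype α] [DecidableEq α]

open Classical in
/-- The set `F(x) = max G_{≤ x}` of factors of `x`. -/
noncomputable def factors (G : Finset α) (x : α) : Finset α :=
  Finset.univ.filter fun y => Maximal (fun z => z ∈ G ∧ z ≤ x) y

/-- Combinatorial building sets: for each `x ≠ ⊥` there is an isomorphism of posets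
`∏_{y ∈ F(x)} [⊥, y] ≃ [⊥, x]` which sends the vector with `y` in position `y` and `⊥` in all
other positions to `y`. -/
def IsBuildingSet (G : Finset α) : Prop :=
  ⊥ ∉ G ∧ ∀ x : α, x ≠ ⊥ →
    ∃ φ : ((y : factors G x) → Set.Iic (y : α)) ≃o Set.Iic x,
      ∀ y : factors G x,
        ((φ (Function.update (fun _ => ⊥) y ⊤) : Set.Iic x) : α) = y

/-- `H` is a partial building set inside the building set `G`: it contains all atoms, and its
non-atoms form an upward closed subset of `G`. -/
structure IsPartialBuildingSet (G H : Finset α) : Prop where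
  isBuildingSet : IsBuildingSet G
  subset : H ⊆ G
  atom_mem : ∀ a : α, IsAtom a → a ∈ H
  upward_closed : ∀ h ∈ H, ¬ IsAtom h → ∀ g ∈ G, h ≤ g → g ∈ H ∧ ¬ IsAtom g

/-- `S ⊆ H` is `H`-nested: no antichain in `S` with at least two elements has its join
(taken in the geometric lattice) in `H`. -/
def IsNested (H : Finset α) (S : Finset H) : Prop :=
  ∀ T ⊆ S, 2 ≤ T.card → IsAntichain (· ≤ ·) (T : Set H) → T.sup (fun h => (h : α)) ∉ H

/-- The combinatorial blowup at `p`.  All the semilattices obtained from `α` by successive blowups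
at elements of `α` are realised as subsets of `Finset α × α` with the componentwise order:
`x : α` is `(∅, x)`, and the new element `(p, y)` of a blowup at `p`, for `y = (T, x)`, is
`(T ∪ {p}, x)`.  The join of `p` and `y` exists in a finite meet-semilattice if and only if
`p` and `y` have a common upper bound. -/
def blowup (p : α) (L : Set (Finset α × α)) : Set (Finset α × α) :=
  {y | y ∈ L ∧ ¬ (∅, p) ≤ y} ∪
    {z | ∃ y ∈ L, ¬ (∅, p) ≤ y ∧ (∃ w ∈ L, (∅, p) ≤ w ∧ y ≤ w) ∧ z = (insert p y.1, y.2)}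

open Classical in
/-- The non-atoms of `H`, listed along a fixed reverse linear extension of the order of `α`
(so larger elements come first). -/
noncomputable def blowupOrder (H : Finset α) : List α :=
  (((H.filter fun h => ¬ IsAtom h).map
    ⟨(toLinearExtension : α → LinearExtension α), fun _ _ h => h⟩).sort (· ≤ ·)).reverse

/-- The semilattice obtained from `α` by blowing up the non-atoms of `H`, larger ones first. -/
noncomputable def partialBlowup (H : Finset α) : Set (Finset α × α) :=
  (blowupOrder H).foldl (fun L p => blowup p L) {y | y.1 = ∅}

open Classical in
/-- The atom of `partialBlowup H` which corresponds to `g ∈ H`. -/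
noncomputable def blowupAtom (g : α) : Finset α × α :=
  if IsAtom g then (∅, g) else ({g}, ⊥)

/-- A set `S` of atoms of a locally geometric semilattice is independent if its join exists and has
rank `|S|`. -/
def IsIndep {P : Type*} [PartialOrder P] (S : Finset P) : Prop :=
  ∃ y : P, IsLUB (S : Set P) y ∧ Order.height y = S.card

/-- A set `S` of atoms of a locally geometric semilattice, bounded above, is a circuit if it is
minimally dependent. -/
def IsCircuit {P : Type*} [PartialOrder P] (S : Finset P) : Prop :=
  BddAbove (S : Set P) ∧ ¬ IsIndep S ∧ ∀ T ⊂ S, IsIndep T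

/-- `S ⊆ H`, regarded as a set of atoms of the partial blowup, is a circuit there. -/
def IsBlowupCircuit (H : Finset α) (S : Finset H) : Prop :=
  ∃ C : Finset (partialBlowup H),
    C.map (Function.Embedding.subtype _) = S.image (fun g : H => blowupAtom (g : α)) ∧
      IsCircuit C

end Combinatorics

section FreeAlgebra

variable {α : Type u}

/-- The free graded-commutative `ℚ`-algebra `R(H)` on odd generators `e_g` and even generators
`x_g`, `g ∈ H`: the exterior algebra of the free module on the `e_g` over `ℚ[x_g]`. -/
abbrev FreeAlg (H : Finset α) : Type u :=
  ExteriorAlgebra (MvPolynomial H ℚ) (H →₀ MvPolynomial H ℚ)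

/-- The generator `e_g`. -/
noncomputable def genE (H : Finset α) (g : H) : FreeAlg H :=
  ExteriorAlgebra.ι (MvPolynomial H ℚ) (Finsupp.single g 1)

/-- The generator `x_g`. -/
noncomputable def genX (H : Finset α) (g : H) : FreeAlg H :=
  algebraMap (MvPolynomial H ℚ) (FreeAlg H) (MvPolynomial.X g)

/-- The `ℚ[x_g]`-linear antiderivation of `R(H)` with `e_g ↦ c g`. -/
noncomputable def antiderivation (H : Finset α) (c : H → MvPolynomial H ℚ) :
    FreeAlg H →ₗ[MvPolynomial H ℚ] FreeAlg H :=
  CliffordAlgebra.contractLeft (Finsupp.linearCombination (MvPolynomial H ℚ) c)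

/-- The differential of `R(H)`: `d e_g = x_g`, `d x_g = 0`. -/
noncomputable def differential (H : Finset α) : FreeAlg H →ₗ[MvPolynomial H ℚ] FreeAlg H :=
  antiderivation H MvPolynomial.X

/-- The derivation `∂` with `∂ e_g = 1`, `∂ x_g = 0`. -/
noncomputable def boundary (H : Finset α) : FreeAlg H →ₗ[MvPolynomial H ℚ] FreeAlg H :=
  antiderivation H fun _ => 1

theorem antiderivation_genE_mul (H : Finset α) (c : H → MvPolynomial H ℚ) (g : H)
    (b : FreeAlg H) :
    antiderivation H c (genE H g * b) = c g • b - genE H g * antiderivation H c b := by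
  unfold antiderivation genE
  have h := CliffordAlgebra.contractLeft_ι_mul (Q := (0 : QuadraticForm (MvPolynomial H ℚ)
    (H →₀ MvPolynomial H ℚ))) (d := Finsupp.linearCombination (MvPolynomial H ℚ) c)
    (Finsupp.single g 1) b
  rw [Finsupp.linearCombination_single, one_smul] at h
  exact h

theorem differential_genE (H : Finset α) (g : H) : differential H (genE H g) = genX H g := by
  have h := antiderivation_genE_mul H MvPolynomial.X g 1
  have h1 : antiderivation H MvPolynomial.X (1 : FreeAlg H) = 0 :=
    CliffordAlgebra.contractLeft_one (Q := (0 : QuadraticForm (MvPolynomial H ℚ)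
      (H →₀ MvPolynomial H ℚ))) _
  rw [mul_one, h1, mul_zero, sub_zero, ← Algebra.algebraMap_eq_smul_one] at h
  exact h

theorem differential_genX (H : Finset α) (g : H) : differential H (genX H g) = 0 :=
  CliffordAlgebra.contractLeft_algebraMap _ _ _

theorem differential_differential (H : Finset α) (a : FreeAlg H) :
    differential H (differential H a) = 0 :=
  CliffordAlgebra.contractLeft_contractLeft (Q := (0 : QuadraticForm (MvPolynomial H ℚ)
    (H →₀ MvPolynomial H ℚ))) _ a

/-- The monomial `e_{g_1} ⋯ e_{g_s}`. -/
noncomputable def monE (H : Finset α) (l : List H) : FreeAlg H := (l.map (genE H)).prod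

/-- The squarefree monomial `x_T`. -/
noncomputable def monX (H : Finset α) (T : Finset H) : FreeAlg H :=
  algebraMap (MvPolynomial H ℚ) (FreeAlg H) (∏ h ∈ T, MvPolynomial.X h)

end FreeAlgebra

section Algebra

variable {α : Type u} [Lattice α] [BoundedOrder α] [Fintype α] [DecidableEq α]

open Classical in
/-- `c_g`, the sum of the `x_h` over all `h ∈ H` with `g ≤ h`. -/
noncomputable def sumAbove (H : Finset α) (g : α) : FreeAlg H :=
  ∑ h ∈ Finset.univ.filter (fun h : H => g ≤ (h : α)), genX H h

/-- The defining relations.  The monomial `e_S` is written for an enumeration `l` of `S`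
without repetitions; another enumeration changes `e_S` by a sign only. -/
inductive Relation (H : Finset α) : FreeAlg H → Prop
  | monomial (l : List H) (T : Finset H) (hl : l.Nodup) (h : ¬ IsNested H (l.toFinset ∪ T)) :
      Relation H (monE H l * monX H T)
  | circuit (l : List H) (hl : l.Nodup) (hn : IsNested H l.toFinset)
      (hc : IsBlowupCircuit H l.toFinset) : Relation H (boundary H (monE H l))
  | linear (g : α) (hg : IsAtom g) : Relation H (sumAbove H g)

/-- The two-sided ideal of `R(H)` generated by the relations. -/
noncomputable def relIdeal (H : Finset α) : Ideal (FreeAlg H) :=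
  (TwoSidedIdeal.span {r | Relation H r}).asIdeal

instance (H : Finset α) : (relIdeal H).IsTwoSided := by
  unfold relIdeal; infer_instance

/-- The algebra `B̂(α, H)`. -/
abbrev BHat (H : Finset α) : Type u := FreeAlg H ⧸ relIdeal H

/-- The quotient map `R(H) → B̂(α, H)`. -/
noncomputable def toBHat (H : Finset α) : FreeAlg H →ₐ[ℚ] BHat H :=
  Ideal.Quotient.mkₐ ℚ (relIdeal H)

/-- The ideal of `B̂(α, H)` generated by the class of `e_⊤`. -/
noncomputable def topIdeal (H : Finset α) (h : ⊤ ∈ H) : Ideal (BHat H) :=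
  (TwoSidedIdeal.span {toBHat H (genE H ⟨⊤, h⟩)}).asIdeal

instance (H : Finset α) (h : ⊤ ∈ H) : (topIdeal H h).IsTwoSided := by
  unfold topIdeal; infer_instance

/-- The algebra `B(α, H) = B̂(α, H) / (e_⊤)`, for `⊤ ∈ H`. -/
abbrev BAlg (H : Finset α) (h : ⊤ ∈ H) : Type u := BHat H ⧸ topIdeal H h

/-- The quotient map `R(H) → B(α, H)`. -/
noncomputable def toBAlg (H : Finset α) (h : ⊤ ∈ H) : FreeAlg H →ₐ[ℚ] BAlg H h :=
  (Ideal.Quotient.mkₐ ℚ (topIdeal H h)).comp (toBHat H)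

/-- The subalgebra of `R(H)` generated by all `x_g` and by the `e_g` with `g ≠ ⊤`. It is stable
under the differential, and it maps onto `B(α, H)`. -/
noncomputable def reducedSubalgebra (H : Finset α) : Subalgebra ℚ (FreeAlg H) :=
  Algebra.adjoin ℚ (Set.range (genX H) ∪ genE H '' {g | (g : α) ≠ ⊤})

/-- `d` is the differential of `B̂(α, H)`, that is, the map induced by the differential of `R(H)`.
There is at most one such `d`. -/
def IsDifferentialBHat (H : Finset α) (d : BHat H →ₗ[ℚ] BHat H) : Prop :=
  ∀ a : FreeAlg H, d (toBHat H a) = toBHat H (differential H a)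

/-- `d` is the differential of `B(α, H)`: the one with `d e_g = x_g` for `g ≠ ⊤` and `d x_g = 0`,
induced by the differential of `R(H)` on the subalgebra generated by the `x_g` and the `e_g` with
`g ≠ ⊤`.  There is at most one such `d`, since that subalgebra maps onto `B(α, H)`. -/
def IsDifferentialBAlg (H : Finset α) (h : ⊤ ∈ H) (d : BAlg H h →ₗ[ℚ] BAlg H h) : Prop :=
  ∀ a ∈ reducedSubalgebra H, d (toBAlg H h a) = toBAlg H h (differential H a)

/-- The part of bidegree `(i, j)` of `R(H)`, where `x_g` has bidegree `(2, 0)` and `e_g` has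
bidegree `(0, 1)`. -/
noncomputable def bidegree (H : Finset α) (i j : ℕ) : Submodule ℚ (FreeAlg H) :=
  Submodule.span ℚ {a | ∃ (f : MvPolynomial H ℚ) (l : List H),
    MvPolynomial.IsWeightedHomogeneous (fun _ => 2) f i ∧ l.length = j ∧
      a = algebraMap (MvPolynomial H ℚ) (FreeAlg H) f * monE H l}

end Algebra

end Leray

/-! The substitution defines a homomorphism `extend` of free algebras. It respects the relations and
`d`, and it has a linear retraction `retr` onto `BHat H` which kills the relations of `H ∪ {p}`;
this retraction gives injectivity.

Combinatorics. In the model of the blowup inside `Finset α × α`, circuits are the matroid circuits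
of atoms of the lattice whose join has no non-atom of `H` below it (`isBlowupCircuit_iff`). A set is
not nested when it contains a `Bad` set `W`, one whose join is an element of `H` outside `W`
(`not_isNested_iff`). Elements of `G` with nonzero meet have their join in `G`, and so do circuits.
Hence a non-atom `h ∈ H` that lies above some but not all elements of a circuit forms a bad set with
the elements not below `h`, even after one of these is dropped (`bad_circuit`). This removes the
cross terms both in `d ∂ e_C` and in the image of `∂ e_C`. Moreover the elements of `H` below `p`
are atoms, and every element of `G` strictly above `p` is in `H`.

The retraction. Let `K = ℚ[x_h : h ∈ H]`, `t = x_p`, `c = ∑ x_h` over the `h ∈ H` above `p`, and `r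
= rk p`. In the coordinates `x_g + [g ≤ p] t` and `t`, polynomials coming from `H` are constants in
`K[t]`. Consider a monomial `f(t) e_l` with `s` letters `e_g`, `g < p`, of join `u`. If `e_p` does
not occur and `s < r`, its coefficient becomes `f(0) + x_T Res f`, where the set `T` of `r - s`
atoms complements `u` in `p` and `Res ((-c - t)^(r - s) f) = -f(0)`. If `e_p` occurs once and `s + 1
= r`, then `e_p` becomes `e_b` for a fixed `b ≤ p` and `t` becomes `-c`. Every other monomial goes
to zero.

Why relations die. In the presence of factors spanning `p`, each `x_a` with `a ≤ p` acts as `-c`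
(`spanning_smul`), so the choice of `T` is immaterial (`complement_smul`). A bad set with join `p`
contributes factors `x_a - t`, which act as `(-c - t)^(r - s)` in the residue term, and the two
terms cancel (`wordFunctional_bad_new`). For the other bad sets each term vanishes by itself
(`wordFunctional_bad`). For `∂ e_C` the functionals of the words with one letter of `C` deleted
agree on the values of these words (`retr_mul_circuit`).

Why it retracts. The odd part `e_L e_V`, with `L` the letters below `p`, is sent by `extend` to
`(e_L + e_p ∂ e_L) e_V`. For `s = |L| < r` the first term gives back the monomial, since `Res` kills
constants. For `s = r` the second gives `e_b ∂ e_L = e_L`, because `∂ (e_b e_L) = 0`. For `s > r`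
everything is zero (`retr_extend`).

For `BAlg`, `retr` maps multiples of `e_⊤` into the ideal of `e_⊤`, and the substitution `e_⊤ ↦ 0`
respects the relations, which gives the differential (`toBHat_killTop`). -/

namespace Leray

universe u v

/-! ### Words in anticommuting elements and their signed derivations. -/

section SignedLists

variable {ι : Type*} {A : Type*} [Ring A]

/-- The value of the antiderivation `E g ↦ w g` on the monomial `∏ E g`. -/
def wdel (w E : ι → A) : List ι → A
  | [] => 0
  | g :: l => w g * (l.map E).prod - E g * wdel w E l

@[simp] theorem wdel_nil (w E : ι → A) : wdel w E [] = 0 := rfl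

@[simp] theorem wdel_cons (w E : ι → A) (g : ι) (l : List ι) :
    wdel w E (g :: l) = w g * (l.map E).prod - E g * wdel w E l := rfl

theorem map_wdel {B F : Type*} [Ring B] [FunLike F A B] [RingHomClass F A B] (f : F)
    (w E : ι → A) (l : List ι) : f (wdel w E l) = wdel (fun g => f (w g)) (fun g => f (E g)) l := by
  induction l with
  | nil => simp
  | cons g l ih => simp [ih, map_list_prod, Function.comp_def]

theorem wdel_map {κ : Type*} (w E : ι → A) (f : κ → ι) (l : List κ) :
    wdel w E (l.map f) = wdel (fun g => w (f g)) (fun g => E (f g)) l := by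
  induction l with
  | nil => simp
  | cons g l ih => simp [ih, Function.comp_def]

theorem wdel_congr {w E w' E' : ι → A} {l : List ι} (hw : ∀ g ∈ l, w g = w' g)
    (hE : ∀ g ∈ l, E g = E' g) : wdel w E l = wdel w' E' l := by
  induction l with
  | nil => simp
  | cons g l ih =>
    rw [wdel_cons, wdel_cons, hw g (by simp), hE g (by simp), List.map_congr_left
      (fun a ha => hE a (by simp [ha])), ih (fun a ha => hw a (by simp [ha]))
      (fun a ha => hE a (by simp [ha]))]

theorem wdel_eq_zero {w E : ι → A} {l : List ι} (hw : ∀ g ∈ l, w g = 0) : wdel w E l = 0 := by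
  induction l with
  | nil => simp
  | cons g l ih => simp [hw g (by simp), ih (fun a ha => hw a (by simp [ha]))]

/-- The elements `E g` anticommute. -/
def Anticomm (E : ι → A) : Prop := ∀ g h, E g * E h = -(E h * E g)

theorem Anticomm.map {B F : Type*} [Ring B] [FunLike F A B] [RingHomClass F A B] {E : ι → A}
    (hE : Anticomm E) (f : F) : Anticomm (fun g => f (E g)) := fun g h => by
  rw [← map_mul, hE g h, map_neg, map_mul]

theorem Anticomm.sq_eq_zero [Algebra ℚ A] {E : ι → A} (hE : Anticomm E) (g : ι) :
    E g * E g = 0 := by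
  have h2 : (2 : ℚ) • (E g * E g) = 0 := by
    rw [two_smul]; nth_rewrite 1 [hE g g]; exact neg_add_cancel _
  exact (smul_eq_zero.1 h2).resolve_left two_ne_zero

theorem Anticomm.prod_mul {E : ι → A} (hE : Anticomm E) (g : ι) (l : List ι) :
    (l.map E).prod * E g = (-1) ^ l.length * (E g * (l.map E).prod) := by
  induction l with
  | nil => simp
  | cons h l ih =>
    rw [List.map_cons, List.prod_cons, mul_assoc, ih, List.length_cons, pow_succ,
      ← mul_assoc (E g), hE g h]
    have : Commute (E h) ((-1 : A) ^ l.length) := (Commute.neg_one_right _).pow_right _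
    rw [← mul_assoc (E h), this.eq]; noncomm_ring

theorem Anticomm.prod_perm {E : ι → A} (hE : Anticomm E) {l l' : List ι} (h : l.Perm l') :
    (l.map E).prod = (l'.map E).prod ∨ (l.map E).prod = -(l'.map E).prod := by
  induction h with
  | nil => simp
  | cons g _ ih => rcases ih with h | h <;> simp [h]
  | swap g h l =>
    right
    simp only [List.map_cons, List.prod_cons, ← mul_assoc]
    rw [hE h g]; simp
  | trans _ _ ih ih' => rcases ih with h | h <;> rcases ih' with h' | h' <;> simp [h, h']

theorem Anticomm.prod_eq_zero_of_perm {E : ι → A} (hE : Anticomm E) {l l' : List ι}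
    (h : l.Perm l') (h0 : (l'.map E).prod = 0) : (l.map E).prod = 0 := by
  rcases hE.prod_perm h with h | h <;> simp [h, h0]

theorem Anticomm.prod_eq_zero_of_not_nodup [Algebra ℚ A] {E : ι → A} (hE : Anticomm E)
    {l : List ι} (h : ¬ l.Nodup) : (l.map E).prod = 0 := by
  obtain ⟨a, ha⟩ : ∃ a, [a, a].Sublist l := by simpa [List.nodup_iff_sublist] using h
  obtain ⟨l', hl'⟩ := ha.exists_perm_append
  refine hE.prod_eq_zero_of_perm hl' ?_
  simp [← mul_assoc, hE.sq_eq_zero]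

/-- A monomial and its derivative change by the same sign. The two claims are proved together
because the derivative of `g :: l` involves both the monomial and the derivative of `l`. -/
theorem Anticomm.wdel_perm {w E : ι → A} (hE : Anticomm E) (hw : ∀ g a, w g * a = a * w g)
    {l l' : List ι} (h : l.Perm l') :
    ((l.map E).prod = (l'.map E).prod ∧ wdel w E l = wdel w E l') ∨
      ((l.map E).prod = -(l'.map E).prod ∧ wdel w E l = -wdel w E l') := by
  induction h with
  | nil => simp
  | cons g _ ih => rcases ih with ⟨h, h'⟩ | ⟨h, h'⟩ <;> simp [h, h', sub_eq_add_neg, add_comm]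
  | swap g h l =>
    right
    simp only [List.map_cons, List.prod_cons, ← mul_assoc, wdel_cons, mul_sub]
    rw [hE h g, hw h (E g), hw g (E h)]
    constructor
    · simp
    · simp only [neg_mul]; abel
  | trans _ _ ih ih' =>
    rcases ih with ⟨h, k⟩ | ⟨h, k⟩ <;> rcases ih' with ⟨h', k'⟩ | ⟨h', k'⟩ <;> simp [h, h', k, k']

theorem Anticomm.wdel_eq_zero_of_perm {w E : ι → A} (hE : Anticomm E)
    (hw : ∀ g a, w g * a = a * w g) {l l' : List ι} (h : l.Perm l') (h0 : wdel w E l' = 0) :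
    wdel w E l = 0 := by
  rcases hE.wdel_perm hw h with h | h <;> simp [h.2, h0]

theorem wdel_append (w E : ι → A) (l l' : List ι) :
    wdel w E (l ++ l') = wdel w E l * (l'.map E).prod +
      (-1) ^ l.length * ((l.map E).prod * wdel w E l') := by
  induction l with
  | nil => simp
  | cons g l ih =>
    have : Commute (E g) ((-1 : A) ^ l.length) := (Commute.neg_one_right _).pow_right _
    rw [List.cons_append, wdel_cons, ih, wdel_cons, List.length_cons, pow_succ, List.map_append,
      List.prod_append, mul_add, ← mul_assoc (E g) ((-1) ^ l.length), this.eq, List.map_cons,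
      List.prod_cons]
    noncomm_ring

theorem Anticomm.wdel_mul {w E : ι → A} (hE : Anticomm E) (hw : ∀ g a, w g * a = a * w g) (g : ι)
    (l : List ι) : wdel w E l * E g = (-1) ^ (l.length + 1) * (E g * wdel w E l) := by
  induction l with
  | nil => simp
  | cons h l ih =>
    have : Commute (E h) ((-1 : A) ^ (l.length + 1)) := (Commute.neg_one_right _).pow_right _
    rw [wdel_cons, sub_mul, mul_assoc, hE.prod_mul, mul_assoc, ih, List.length_cons,
      pow_succ _ (l.length + 1), ← mul_assoc (E h), this.eq, mul_assoc _ (E h), ← mul_assoc (E h),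
      hE h g, hw h, hw h, pow_succ _ l.length]
    noncomm_ring

theorem Anticomm.wdel_eq_zero_of_not_nodup [Algebra ℚ A] {w E : ι → A} (hE : Anticomm E)
    (hw : ∀ g a, w g * a = a * w g) {l : List ι} (h : ¬ l.Nodup) : wdel w E l = 0 := by
  obtain ⟨a, ha⟩ : ∃ a, [a, a].Sublist l := by simpa [List.nodup_iff_sublist] using h
  obtain ⟨l', hl'⟩ := ha.exists_perm_append
  refine hE.wdel_eq_zero_of_perm hw hl' ?_
  simp only [List.cons_append, List.nil_append, wdel_cons, List.map_cons, List.prod_cons, mul_sub,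
    ← mul_assoc, hE.sq_eq_zero, hw a (E a)]
  simp

theorem Anticomm.mul_wdel_cons [Algebra ℚ A] {E : ι → A} (hE : Anticomm E) (g : ι) (l : List ι) :
    E g * wdel (fun _ => 1) E (g :: l) = ((g :: l).map E).prod := by
  simp [mul_sub, ← mul_assoc, hE.sq_eq_zero]

/-- The derivative is a signed sum of the terms with one letter deleted, so membership can be tested
term by term; typically `N` is the kernel of an additive map. The prefix `l₀` collects the letters
already passed in the induction. -/
theorem wdel_mem {B : Type*} [SetLike B A] [AddSubgroupClass B A] {w E : ι → A}
    (hw : ∀ g a, w g * a = a * w g) (N : B) (l₀ l : List ι)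
    (h : ∀ l₁ g l₂, l = l₁ ++ g :: l₂ → w g * ((l₀ ++ l₁ ++ l₂).map E).prod ∈ N) :
    (l₀.map E).prod * wdel w E l ∈ N := by
  induction l generalizing l₀ with
  | nil => simp [zero_mem N]
  | cons g l ih =>
    rw [wdel_cons, mul_sub, ← mul_assoc, ← hw, mul_assoc]
    refine sub_mem ?_ ?_
    · simpa using h [] g l rfl
    · have := ih (l₀ ++ [g]) fun l₁ k l₂ hl => by
        have := h (g :: l₁) k l₂ (by simp [hl])
        simpa using this
      simpa [mul_assoc] using this

/-- The substitution `e ↦ e + ε` is `exp (ε ∂)`. As `ε² = 0`, the Taylor expansion stops after the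
linear term, and `∂ e_l` is unchanged because `∂² = 0`. -/
theorem prod_wdel_add {E : ι → A} {ε : A} (hε : ε * ε = 0)
    (hεE : ∀ g, E g * ε = -(ε * E g)) (l : List ι) :
    (l.map fun g => E g + ε).prod = (l.map E).prod + ε * wdel (fun _ => 1) E l ∧
      wdel (fun _ => 1) (fun g => E g + ε) l = wdel (fun _ => 1) E l := by
  induction l with
  | nil => simp
  | cons g l ih =>
    obtain ⟨h1, h2⟩ := ih
    have h3 : ε * (ε * wdel (fun _ => 1) E l) = 0 := by rw [← mul_assoc, hε, zero_mul]
    have h4 : E g * (ε * wdel (fun _ => 1) E l) = -(ε * (E g * wdel (fun _ => 1) E l)) := by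
      rw [← mul_assoc, hεE, neg_mul, mul_assoc]
    constructor
    · rw [List.map_cons, List.prod_cons, h1, wdel_cons, List.map_cons, List.prod_cons, add_mul,
        mul_add, mul_add, h3, h4, mul_sub, one_mul]
      abel
    · rw [wdel_cons, wdel_cons, h1, h2, add_mul, one_mul, one_mul]
      abel

end SignedLists

/-! ### The free graded-commutative algebra and its universal property. -/

section Free

variable {α : Type u}

@[simp] theorem monE_nil (H : Finset α) : monE H [] = 1 := rfl

@[simp] theorem monE_cons (H : Finset α) (g : H) (l : List H) :
    monE H (g :: l) = genE H g * monE H l := by simp [monE]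

theorem monE_append (H : Finset α) (l l' : List H) :
    monE H (l ++ l') = monE H l * monE H l' := by simp [monE]

theorem FreeAlg.mem_span (H : Finset α) (a : FreeAlg H) :
    a ∈ Submodule.span (MvPolynomial H ℚ) (Set.range (monE H)) := by
  refine CliffordAlgebra.left_induction (Q := (0 : QuadraticForm (MvPolynomial H ℚ)
    (H →₀ MvPolynomial H ℚ))) ?_ ?_ ?_ a
  · intro r
    rw [Algebra.algebraMap_eq_smul_one]
    exact Submodule.smul_mem _ _ (Submodule.subset_span ⟨[], rfl⟩)
  · intro x y; exact add_mem
  · intro x m hx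
    induction m using Finsupp.induction_linear with
    | zero => simp
    | add f g hf hg => rw [map_add, add_mul]; exact add_mem hf hg
    | single g c =>
      have : (Finsupp.single g c : H →₀ MvPolynomial H ℚ) = c • Finsupp.single g 1 := by simp
      rw [this, map_smul, smul_mul_assoc]
      refine Submodule.smul_mem _ _ ?_
      induction hx using Submodule.span_induction with
      | mem x hx =>
        obtain ⟨l, rfl⟩ := hx
        exact Submodule.subset_span ⟨g :: l, monE_cons H g l⟩
      | zero => simp
      | add x y _ _ hx hy => rw [mul_add]; exact add_mem hx hy
      | smul c x _ hx => rw [mul_smul_comm]; exact Submodule.smul_mem _ _ hx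

theorem FreeAlg.linearMap_ext {H : Finset α} {N : Type*} [AddCommGroup N] [Module ℚ N]
    {F F' : FreeAlg H →ₗ[ℚ] N}
    (h : ∀ (f : MvPolynomial H ℚ) (l : List H), F (algebraMap _ _ f * monE H l) =
      F' (algebraMap _ _ f * monE H l)) : F = F' := by
  ext a
  induction FreeAlg.mem_span H a using Submodule.span_induction with
  | mem x hx => obtain ⟨l, rfl⟩ := hx; simpa using h 1 l
  | zero => simp
  | add x y _ _ hx hy => simp [hx, hy]
  | smul c x hx' hx =>
    clear hx
    induction hx' using Submodule.span_induction generalizing c with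
    | mem x hx => obtain ⟨l, rfl⟩ := hx; rw [Algebra.smul_def]; exact h c l
    | zero => simp
    | add x y _ _ hx hy => rw [smul_add, map_add, map_add, hx, hy]
    | smul d x _ hx => rw [smul_smul]; exact hx _

theorem genE_anticomm (H : Finset α) : Anticomm (genE H) := fun g h => by
  rw [eq_neg_iff_add_eq_zero]
  exact ExteriorAlgebra.ι_add_mul_swap _ _

theorem genX_comm (H : Finset α) (g : H) (a : FreeAlg H) : genX H g * a = a * genX H g :=
  Algebra.commutes _ _

theorem antiderivation_algebraMap_mul (H : Finset α) (c : H → MvPolynomial H ℚ)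
    (f : MvPolynomial H ℚ) (a : FreeAlg H) :
    antiderivation H c (algebraMap _ _ f * a) = algebraMap _ _ f * antiderivation H c a := by
  rw [← Algebra.smul_def, map_smul, Algebra.smul_def]

theorem antiderivation_monE (H : Finset α) (c : H → MvPolynomial H ℚ) (l : List H) :
    antiderivation H c (monE H l) = wdel (fun g => algebraMap _ _ (c g)) (genE H) l := by
  induction l with
  | nil =>
    exact CliffordAlgebra.contractLeft_one (Q := (0 : QuadraticForm (MvPolynomial H ℚ)
      (H →₀ MvPolynomial H ℚ))) _
  | cons g l ih =>
    rw [monE_cons, antiderivation_genE_mul, ih, wdel_cons, Algebra.smul_def]; rfl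

theorem boundary_monE (H : Finset α) (l : List H) :
    boundary H (monE H l) = wdel (fun _ => 1) (genE H) l := by
  simp [boundary, antiderivation_monE]

theorem differential_monE (H : Finset α) (l : List H) :
    differential H (monE H l) = wdel (genX H) (genE H) l :=
  antiderivation_monE H _ l

theorem antiderivation_comm (H : Finset α) (c c' : H → MvPolynomial H ℚ) (a : FreeAlg H) :
    antiderivation H c (antiderivation H c' a) = -antiderivation H c' (antiderivation H c a) :=
  CliffordAlgebra.contractLeft_comm (Q := (0 : QuadraticForm (MvPolynomial H ℚ)
    (H →₀ MvPolynomial H ℚ))) _ _ a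

variable {A : Type v} [Ring A] [Algebra ℚ A]

theorem sq_linearCombination_eq_zero {R : Type*} [CommRing R] [Algebra R A] {H : Type*} {E : H → A}
    (hE : Anticomm E) (m : H →₀ R) :
    Finsupp.linearCombination R E m * Finsupp.linearCombination R E m = 0 := by
  have key : ∀ m m' : H →₀ R, Finsupp.linearCombination R E m * Finsupp.linearCombination R E m' =
      -(Finsupp.linearCombination R E m' * Finsupp.linearCombination R E m) := by
    intro m m'
    induction m using Finsupp.induction_linear with
    | zero => simp
    | add f g hf hg => rw [map_add, add_mul, mul_add, hf, hg, neg_add]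
    | single g c =>
      induction m' using Finsupp.induction_linear with
      | zero => simp
      | add f g hf hg => rw [map_add, add_mul, mul_add, hf, hg, neg_add]
      | single h d => simp [smul_smul, hE g h, mul_comm c d]
  -- Anticommutation passes to linear combinations, so the whole module may serve as the index set.
  exact Anticomm.sq_eq_zero (ι := H →₀ R) (E := fun m => Finsupp.linearCombination R E m) key m

/-- The ring homomorphism `ℚ[x_g] → A` with `x_g ↦ X g` for central elements `X g`. -/
noncomputable def polyLift {H : Type*} (X : H → A) (hX : ∀ g a, X g * a = a * X g) :
    MvPolynomial H ℚ →ₐ[ℚ] A :=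
  (Subalgebra.center ℚ A).val.comp
    (MvPolynomial.aeval fun g => ⟨X g, Subalgebra.mem_center_iff.2 fun a => (hX g a).symm⟩)

theorem polyLift_comm {H : Type*} (X : H → A) (hX : ∀ g a, X g * a = a * X g)
    (f : MvPolynomial H ℚ) (a : A) : polyLift X hX f * a = a * polyLift X hX f :=
  (Subalgebra.mem_center_iff.1 (Subtype.prop (MvPolynomial.aeval (R := ℚ)
    (fun g => (⟨X g, Subalgebra.mem_center_iff.2 fun a => (hX g a).symm⟩ :
      Subalgebra.center ℚ A)) f)) a).symm

@[simp] theorem polyLift_X {H : Type*} (X : H → A) (hX : ∀ g a, X g * a = a * X g) (g : H) :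
    polyLift X hX (MvPolynomial.X g) = X g := by
  simp [polyLift]

/-- The universal property of the free graded-commutative algebra. -/
noncomputable def FreeAlg.lift (H : Finset α) (E X : H → A) (hE : Anticomm E)
    (hX : ∀ g a, X g * a = a * X g) : FreeAlg H →ₐ[ℚ] A :=
  letI : Algebra (MvPolynomial H ℚ) A :=
    (polyLift X hX : MvPolynomial H ℚ →+* A).toAlgebra' (polyLift_comm X hX)
  (RingHomClass.toRingHom (ExteriorAlgebra.lift (MvPolynomial H ℚ)
    ⟨Finsupp.linearCombination (MvPolynomial H ℚ) E, sq_linearCombination_eq_zero hE⟩)).toRatAlgHom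

@[simp] theorem FreeAlg.lift_algebraMap (H : Finset α) (E X : H → A) (hE : Anticomm E)
    (hX : ∀ g a, X g * a = a * X g) (f : MvPolynomial H ℚ) :
    FreeAlg.lift H E X hE hX (algebraMap _ _ f) = polyLift X hX f := by
  let _ : Algebra (MvPolynomial H ℚ) A :=
    (polyLift X hX : MvPolynomial H ℚ →+* A).toAlgebra' (polyLift_comm X hX)
  exact AlgHom.commutes (ExteriorAlgebra.lift (MvPolynomial H ℚ)
    ⟨Finsupp.linearCombination (MvPolynomial H ℚ) E, sq_linearCombination_eq_zero hE⟩) f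

@[simp] theorem FreeAlg.lift_genX (H : Finset α) (E X : H → A) (hE : Anticomm E)
    (hX : ∀ g a, X g * a = a * X g) (g : H) : FreeAlg.lift H E X hE hX (genX H g) = X g := by
  rw [genX, FreeAlg.lift_algebraMap, polyLift_X]

@[simp] theorem FreeAlg.lift_genE (H : Finset α) (E X : H → A) (hE : Anticomm E)
    (hX : ∀ g a, X g * a = a * X g) (g : H) : FreeAlg.lift H E X hE hX (genE H g) = E g := by
  let _ : Algebra (MvPolynomial H ℚ) A :=
    (polyLift X hX : MvPolynomial H ℚ →+* A).toAlgebra' (polyLift_comm X hX)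
  refine (ExteriorAlgebra.lift_ι_apply (MvPolynomial H ℚ)
    (Finsupp.linearCombination (MvPolynomial H ℚ) E) (sq_linearCombination_eq_zero hE) _).trans ?_
  simp

theorem map_monE {B F : Type*} [Ring B] (H : Finset α) [FunLike F (FreeAlg H) B]
    [RingHomClass F (FreeAlg H) B] (f : F)
    (l : List H) : f (monE H l) = (l.map fun g => f (genE H g)).prod := by
  simp [monE, map_list_prod, Function.comp_def]

theorem FreeAlg.algHom_ext {H : Finset α} {F F' : FreeAlg H →ₐ[ℚ] A}
    (hE : ∀ g, F (genE H g) = F' (genE H g)) (hX : ∀ g, F (genX H g) = F' (genX H g)) :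
    F = F' := by
  have hf : ∀ f : MvPolynomial H ℚ, F (algebraMap _ _ f) = F' (algebraMap _ _ f) := by
    intro f
    induction f using MvPolynomial.induction_on with
    | C a =>
      have : algebraMap (MvPolynomial H ℚ) (FreeAlg H) (MvPolynomial.C a) =
        algebraMap ℚ (FreeAlg H) a := (IsScalarTower.algebraMap_apply ℚ _ _ a).symm
      rw [this, F.commutes, F'.commutes]
    | add p q hp hq => simp [hp, hq]
    | mul_X p g hp => rw [map_mul, map_mul, map_mul, hp]; congr 1; exact hX g
  have : F.toLinearMap = F'.toLinearMap := FreeAlg.linearMap_ext fun f l => by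
    simp only [AlgHom.toLinearMap_apply, map_mul, hf, map_monE, hE]
  ext a; exact DFunLike.congr_fun this a

/-- An element that commutes or anticommutes with each generator can be moved across every product.
This is what makes left ideals two-sided; it is stated for a homomorphism `q` so as to serve both in
the free algebra and in `BHat`. -/
theorem FreeAlg.exists_mul_eq {H : Finset α} {F : Type*} [FunLike F (FreeAlg H) A]
    [RingHomClass F (FreeAlg H) A] (q : F) (hq : ∀ g a, q (genX H g) * a = a * q (genX H g))
    (r : A) (hr : ∀ g, r * q (genE H g) = q (genE H g) * r ∨ r * q (genE H g) = -(q (genE H g) * r))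
    (a : FreeAlg H) : ∃ b, r * q a = b * r := by
  have hf : ∀ (f : MvPolynomial H ℚ) a, q (algebraMap _ _ f) * a = a * q (algebraMap _ _ f) := by
    intro f a
    induction f using MvPolynomial.induction_on with
    | C c =>
      have : q (algebraMap (MvPolynomial H ℚ) (FreeAlg H) (MvPolynomial.C c)) = algebraMap ℚ A c := by
        have h1 : algebraMap (MvPolynomial H ℚ) (FreeAlg H) (MvPolynomial.C c) =
          algebraMap ℚ (FreeAlg H) c := (IsScalarTower.algebraMap_apply ℚ _ _ c).symm
        rw [h1]
        exact (RingHomClass.toRingHom q).toRatAlgHom.commutes c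
      rw [this, Algebra.commutes]
    | add p q hp hq => simp [hp, hq, add_mul, mul_add]
    | mul_X p g hp =>
      have hX : q (algebraMap (MvPolynomial H ℚ) (FreeAlg H) (MvPolynomial.X g)) = q (genX H g) :=
        rfl
      rw [map_mul, map_mul, hX, mul_assoc, hq, ← mul_assoc, hp, mul_assoc]
  have hl : ∀ l, ∃ b, r * q (monE H l) = b * r := by
    intro l
    induction l generalizing r with
    | nil => exact ⟨1, by simp⟩
    | cons g l ih =>
      obtain ⟨b, hb⟩ := ih r hr
      rw [monE_cons, map_mul, ← mul_assoc]
      rcases hr g with h | h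
      · exact ⟨q (genE H g) * b, by rw [h, mul_assoc, hb, mul_assoc]⟩
      · exact ⟨-(q (genE H g) * b), by rw [h, neg_mul, mul_assoc, hb, neg_mul, mul_assoc]⟩
  induction FreeAlg.mem_span H a using Submodule.span_induction with
  | mem x hx => obtain ⟨l, rfl⟩ := hx; exact hl l
  | zero => exact ⟨0, by simp⟩
  | add x y _ _ hx hy =>
    obtain ⟨b, hb⟩ := hx; obtain ⟨b', hb'⟩ := hy
    exact ⟨b + b', by rw [map_add, mul_add, hb, hb', add_mul]⟩
  | smul c x _ hx =>
    obtain ⟨b, hb⟩ := hx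
    exact ⟨q (algebraMap _ _ c) * b, by
      rw [Algebra.smul_def, map_mul, ← mul_assoc, ← hf, mul_assoc, hb, mul_assoc]⟩

theorem TwoSidedIdeal.span_asIdeal_le {R : Type*} [Ring R] {S : Set R} {I : Ideal R}
    [I.IsTwoSided] (h : S ⊆ I) : (TwoSidedIdeal.span S).asIdeal ≤ I := by
  intro x hx
  have : TwoSidedIdeal.span S ≤ I.toTwoSided := TwoSidedIdeal.span_le.2 fun s hs =>
    Ideal.mem_toTwoSided.2 (h hs)
  exact Ideal.mem_toTwoSided.1 (this (TwoSidedIdeal.mem_asIdeal.1 hx))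

theorem TwoSidedIdeal.span_asIdeal_eq {R : Type*} [Ring R] {S : Set R}
    (h : ∀ r ∈ S, ∀ a, ∃ b, r * a = b * r) :
    (TwoSidedIdeal.span S).asIdeal = Ideal.span S := by
  have : (Ideal.span S).IsTwoSided := ⟨fun {x} a hx => by
    induction hx using Submodule.span_induction with
    | mem x hx =>
      obtain ⟨b, hb⟩ := h x hx a
      rw [hb]; exact Ideal.mul_mem_left _ _ (Ideal.subset_span hx)
    | zero => simp
    | add x y _ _ hx hy => rw [add_mul]; exact add_mem hx hy
    | smul c x _ hx => rw [smul_eq_mul, mul_assoc]; exact Ideal.mul_mem_left _ _ hx⟩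
  refine le_antisymm (span_asIdeal_le Ideal.subset_span) (Ideal.span_le.2 fun x hx => ?_)
  exact TwoSidedIdeal.mem_asIdeal.2 (TwoSidedIdeal.subset_span hx)

end Free

/-! ### The ideal of relations. -/

section Relations

variable {α : Type u} [Lattice α] [BoundedOrder α] [Fintype α] [DecidableEq α] (H : Finset α)

/-- Each relation commutes up to sign with the odd generators and commutes with the even ones, so
left multiples suffice. -/
theorem relIdeal_eq : relIdeal H = Ideal.span {r | Relation H r} := by
  refine TwoSidedIdeal.span_asIdeal_eq fun r hr a => ?_
  refine FreeAlg.exists_mul_eq (AlgHom.id ℚ (FreeAlg H)) (fun g => genX_comm H g) r (fun g => ?_) a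
  rw [AlgHom.id_apply]
  have key : ∀ (n : ℕ) (b c : FreeAlg H), b = (-1) ^ n * c → b = c ∨ b = -c := by
    intro n b c hb
    rcases neg_one_pow_eq_or (FreeAlg H) n with h | h <;> simp [hb, h]
  cases hr with
  | monomial l T hl h =>
    refine key l.length _ _ ?_
    have h1 : monX H T * genE H g = genE H g * monX H T := Algebra.commutes _ _
    rw [mul_assoc, h1, ← mul_assoc, monE, (genE_anticomm H).prod_mul, mul_assoc, mul_assoc]
  | circuit l hl hn hc =>
    refine key (l.length + 1) _ _ ?_
    rw [boundary_monE]
    exact (genE_anticomm H).wdel_mul (by simp) g l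
  | linear g' hg =>
    left
    rw [sumAbove, Finset.sum_mul, Finset.mul_sum]
    exact Finset.sum_congr rfl fun h _ => genX_comm H h _

theorem Relation.toBHat_eq_zero {H : Finset α} {r : FreeAlg H} (hr : Relation H r) :
    toBHat H r = 0 :=
  Ideal.Quotient.eq_zero_iff_mem.2 (by rw [relIdeal_eq]; exact Ideal.subset_span hr)

theorem toBHat_eq_zero_iff {H : Finset α} {a : FreeAlg H} : toBHat H a = 0 ↔ a ∈ relIdeal H :=
  Ideal.Quotient.eq_zero_iff_mem

theorem toBHat_surjective : Function.Surjective (toBHat H) := Ideal.Quotient.mk_surjective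

/-- A homomorphism which kills the relations kills the ideal they generate. -/
theorem relIdeal_le_ker {A : Type*} [Ring A] [Algebra ℚ A] (F : FreeAlg H →ₐ[ℚ] A)
    (hF : ∀ r, Relation H r → F r = 0) (a : FreeAlg H) (ha : a ∈ relIdeal H) : F a = 0 :=
  TwoSidedIdeal.span_asIdeal_le (I := RingHom.ker F) (fun r hr => hF r hr) ha

end Relations

end Leray
namespace Leray

universe u v

/-! ### Rank, independence and circuits of atoms. -/

section Lattice

variable {α : Type u} [Lattice α] [BoundedOrder α] [Fintype α]

theorem height_lt_top {P : Type*} [PartialOrder P] [Finite P] (x : P) : Order.height x < ⊤ := by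
  have := Fintype.ofFinite P
  rw [lt_top_iff_ne_top, Ne, Order.height_eq_top_iff]
  push Not
  refine ⟨Fintype.card P, fun p _ h => ?_⟩
  have := p.length_lt_card
  omega

theorem height_lt_of_lt {P : Type*} [PartialOrder P] [Finite P] {x y : P} (h : x < y) :
    Order.height x < Order.height y := Order.height_strictMono h (height_lt_top x)

/-- The rank function of a finite lattice. -/
noncomputable def rk (x : α) : ℕ := (Order.height x).toNat

theorem coe_rk (x : α) : (rk x : ℕ∞) = Order.height x :=
  ENat.natCast_toNat (height_lt_top x).ne

theorem rk_lt {x y : α} (h : x < y) : rk x < rk y := by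
  have := height_lt_of_lt h
  rwa [← coe_rk, ← coe_rk, Nat.cast_lt] at this

theorem rk_mono {x y : α} (h : x ≤ y) : rk x ≤ rk y := by
  rcases h.eq_or_lt with rfl | h
  · rfl
  · exact (rk_lt h).le

theorem eq_of_le_of_rk_le {x y : α} (h : x ≤ y) (h' : rk y ≤ rk x) : x = y := by
  by_contra hne
  exact (rk_lt (lt_of_le_of_ne h hne)).not_ge h'

@[simp] theorem rk_bot : rk (⊥ : α) = 0 := by
  have := coe_rk (⊥ : α)
  rw [Order.height_bot] at this; exact_mod_cast this

theorem exists_rk_eq {x : α} {n : ℕ} (h : rk x = n + 1) : ∃ y < x, rk y = n := by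
  have h1 : Order.height x = ((n : ℕ∞) + 1) := by rw [← coe_rk, h]; simp
  obtain ⟨y, hy, hn⟩ := (Order.height_eq_coe_add_one_iff.1 h1).2.1
  exact ⟨y, hy, by rw [← coe_rk] at hn; exact_mod_cast hn⟩

/-- The corank function of a finite lattice. -/
noncomputable def crk (x : α) : ℕ := rk (OrderDual.toDual x)

theorem covBy_of_rk_eq {x y : α} (h : x < y) (hr : rk y ≤ rk x + 1) : x ⋖ y :=
  ⟨h, fun z hxz hzy => by have := rk_lt hxz; have := rk_lt hzy; omega⟩

theorem covBy_of_crk_eq {x y : α} (h : x < y) (hr : crk x ≤ crk y + 1) : x ⋖ y :=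
  (covBy_of_rk_eq (x := OrderDual.toDual y) (y := OrderDual.toDual x)
    (OrderDual.toDual_lt_toDual.2 h) hr).ofDual

variable [IsUpperModularLattice α]

/-- The Jordan–Dedekind chain condition, by induction on the corank. If the cover `z` of `x`
realising the corank differs from `y`, then `y ⊔ z` covers both. Corank is the convenient measure
because upper semimodularity produces joins. -/
theorem crk_covBy {x y : α} (h : x ⋖ y) : crk x = crk y + 1 := by
  induction hn : crk x using Nat.strong_induction_on generalizing x y with
  | _ n ih =>
    have hlt : crk y < crk x := rk_lt (OrderDual.toDual_lt_toDual.2 h.lt)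
    obtain ⟨m, rfl⟩ : ∃ m, n = m + 1 := ⟨n - 1, by omega⟩
    obtain ⟨z, hz, hzn⟩ := exists_rk_eq hn
    have hxz : x ⋖ z.ofDual := covBy_of_crk_eq (OrderDual.toDual_lt_toDual.1 hz) (by
      change crk z.ofDual = m at hzn; omega)
    by_cases hyz : y = z.ofDual
    · subst hyz; exact congrArg (· + 1) hzn.symm
    · have hinf : y ⊓ z.ofDual = x := by
        refine le_antisymm ?_ (le_inf h.le hxz.le)
        by_contra hle
        have h1 : x < y ⊓ z.ofDual := lt_of_le_not_ge (le_inf h.le hxz.le) hle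
        have h2 : y ≤ z.ofDual := by
          by_contra h2
          exact h.2 h1 (lt_of_le_of_ne inf_le_left fun e => h2 (e ▸ inf_le_right))
        rcases h2.eq_or_lt with h3 | h3
        · exact hyz h3
        · exact hxz.2 h.lt h3
      have hy : y ⋖ y ⊔ z.ofDual := covBy_sup_of_inf_covBy_right (by rwa [hinf])
      have hz' : z.ofDual ⋖ y ⊔ z.ofDual := covBy_sup_of_inf_covBy_left (by rwa [hinf])
      have e1 := ih _ (by omega) hy rfl
      have e2 := ih m (by omega) hz' hzn
      omega

/-- Along the covers of a longest chain from `⊥` to `x` the corank drops by one each time; hence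
rank is graded as well. -/
theorem rk_add_crk (x : α) : rk x + crk x = crk (⊥ : α) := by
  induction hn : rk x generalizing x with
  | zero =>
    have : (⊥ : α) = x := eq_of_le_of_rk_le bot_le (by omega)
    simp [this]
  | succ n ih =>
    obtain ⟨y, hy, hyn⟩ := exists_rk_eq hn
    have := crk_covBy (covBy_of_rk_eq hy (by omega))
    have := ih y hyn
    omega

theorem rk_covBy {x y : α} (h : x ⋖ y) : rk y = rk x + 1 := by
  have := crk_covBy h
  have := rk_add_crk x
  have := rk_add_crk y
  omega

theorem covBy_sup_atom {x a : α} (ha : IsAtom a) (h : ¬ a ≤ x) : x ⋖ x ⊔ a := by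
  refine covBy_sup_of_inf_covBy_right ?_
  have : x ⊓ a = ⊥ := (ha.le_iff.1 inf_le_right).resolve_right fun h' => h (h' ▸ inf_le_left)
  rw [this]; exact ha.bot_covBy

theorem rk_sup_atom {x a : α} (ha : IsAtom a) (h : ¬ a ≤ x) : rk (x ⊔ a) = rk x + 1 :=
  rk_covBy (covBy_sup_atom ha h)

theorem rk_sup_atom_le {x a : α} (ha : IsAtom a) : rk (x ⊔ a) ≤ rk x + 1 := by
  by_cases h : a ≤ x
  · rw [sup_eq_left.2 h]; omega
  · exact (rk_sup_atom ha h).le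

variable [DecidableEq α]

theorem rk_sup_finset_le (x : α) (A : Finset α) (hA : ∀ a ∈ A, IsAtom a) :
    rk (x ⊔ A.sup id) ≤ rk x + A.card := by
  induction A using Finset.induction_on with
  | empty => simp
  | insert a A ha ih =>
    rw [Finset.sup_insert, Finset.card_insert_of_notMem ha, id, sup_comm a, ← sup_assoc]
    have := rk_sup_atom_le (x := x ⊔ A.sup id) (hA a (by simp))
    have := ih fun b hb => hA b (by simp [hb])
    omega

theorem rk_finset_le (A : Finset α) (hA : ∀ a ∈ A, IsAtom a) : rk (A.sup id) ≤ A.card := by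
  simpa using rk_sup_finset_le ⊥ A hA

/-- A set of atoms is independent if its join has the largest possible rank. -/
def Indep (A : Finset α) : Prop := (∀ a ∈ A, IsAtom a) ∧ rk (A.sup id) = A.card

theorem Indep.subset {A B : Finset α} (hA : Indep A) (h : B ⊆ A) : Indep B := by
  refine ⟨fun a ha => hA.1 a (h ha), le_antisymm (rk_finset_le B fun a ha => hA.1 a (h ha)) ?_⟩
  have h1 := rk_sup_finset_le (B.sup id) (A \ B) fun a ha => hA.1 a (Finset.sdiff_subset ha)
  rw [← Finset.sup_union, Finset.union_sdiff_of_subset h, hA.2, Finset.card_sdiff_of_subset h] at h1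
  have := Finset.card_le_card h
  omega

theorem Indep.insert {A : Finset α} (hA : Indep A) {a : α} (ha : IsAtom a) (h : ¬ a ≤ A.sup id) :
    Indep (insert a A) := by
  have haA : a ∉ A := fun h' => h (Finset.le_sup (f := id) h')
  refine ⟨by simpa [ha] using hA.1, ?_⟩
  rw [Finset.sup_insert, Finset.card_insert_of_notMem haA, id, sup_comm, rk_sup_atom ha h, hA.2]

theorem Indep.notMem_sup {A : Finset α} (hA : Indep A) {a : α} (ha : a ∈ A) :
    ¬ a ≤ (A.erase a).sup id := fun h => by
  have h1 : A.sup id = (A.erase a).sup id := by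
    conv_lhs => rw [← Finset.insert_erase ha]
    rw [Finset.sup_insert, id, sup_eq_right.2 h]
  have h2 := hA.2
  have h3 := (hA.subset (Finset.erase_subset a A)).2
  rw [← h1, h2, Finset.card_erase_of_mem ha] at h3
  have := Finset.card_pos.2 ⟨a, ha⟩
  omega

/-- Circuits of the matroid of atoms. -/
structure Circuit (C : Finset α) : Prop where
  atom : ∀ a ∈ C, IsAtom a
  not_indep : ¬ Indep C
  indep : ∀ A ⊂ C, Indep A

theorem exists_circuit {A : Finset α} (hA : ∀ a ∈ A, IsAtom a) (h : ¬ Indep A) :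
    ∃ C ⊆ A, Circuit C := by
  obtain ⟨C, hC, hm⟩ := (Set.toFinite {C | ¬ Indep C ∧ C ⊆ A}).exists_le_minimal
    (show A ∈ {C | ¬ Indep C ∧ C ⊆ A} from ⟨h, subset_rfl⟩)
  refine ⟨C, hC, fun a ha => hA a (hC ha), hm.1.1, fun B hB => ?_⟩
  by_contra hBi
  exact hB.2 (hm.2 ⟨hBi, hB.1.trans hm.1.2⟩ hB.1)

theorem Circuit.le_sup_erase {C : Finset α} (hC : Circuit C) {c : α} (hc : c ∈ C) :
    c ≤ (C.erase c).sup id := by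
  by_contra h
  refine hC.not_indep ?_
  rw [← Finset.insert_erase hc]
  exact (hC.indep _ (Finset.erase_ssubset hc)).insert (hC.atom c hc) h

theorem Circuit.sup_erase {C : Finset α} (hC : Circuit C) (c : α) :
    (C.erase c).sup id = C.sup id := by
  by_cases hc : c ∈ C
  · conv_rhs => rw [← Finset.insert_erase hc]
    rw [Finset.sup_insert, id, sup_eq_right.2 (hC.le_sup_erase hc)]
  · rw [Finset.erase_eq_of_notMem hc]

theorem Circuit.nonempty {C : Finset α} (hC : Circuit C) : C.Nonempty := by
  rw [Finset.nonempty_iff_ne_empty]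
  rintro rfl
  exact hC.not_indep ⟨by simp, by simp⟩

/-- Every set of atoms spanning `p` together with `u` contains an independent complement. -/
theorem exists_complement {u p : α} (A : Finset α) (hA : ∀ a ∈ A, IsAtom a)
    (hp : u ⊔ A.sup id = p) : ∃ B ⊆ A, u ⊔ B.sup id = p ∧ rk u + B.card = rk p := by
  induction A using Finset.induction_on generalizing p with
  | empty => exact ⟨∅, by simp, hp, by simp at hp; simp [hp]⟩
  | insert a A ha ih =>
    obtain ⟨B, hBA, hB, hBc⟩ := ih (fun b hb => hA b (by simp [hb])) rfl
    rw [Finset.sup_insert, id, sup_comm a, ← sup_assoc] at hp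
    by_cases h : a ≤ u ⊔ A.sup id
    · rw [sup_eq_left.2 h] at hp; subst hp
      exact ⟨B, hBA.trans (Finset.subset_insert _ _), hB, hBc⟩
    · have haB : a ∉ B := fun h' => ha (hBA h')
      refine ⟨insert a B, Finset.insert_subset_insert a hBA, ?_, ?_⟩
      · rw [Finset.sup_insert, id, sup_comm a, ← sup_assoc, hB, hp]
      · rw [Finset.card_insert_of_notMem haB, ← hp, rk_sup_atom (hA a (by simp)) h, ← hBc]
        omega

end Lattice
end Leray
namespace Leray

universe u v

/-! ### Order, independence and circuits in the partial blowup. -/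

section Blowup

variable {α : Type u} [Lattice α] [BoundedOrder α] [Fintype α] [DecidableEq α]

/-- With lower sets of `Finset α × α`, joins, heights and boundedness in the blowup can be read off
componentwise. An element below a new one either still contains the label `p`, which may be erased
to find its origin, or is an old element. -/
theorem isLowerSet_blowup (p : α) {L : Set (Finset α × α)} (hL : IsLowerSet L) :
    IsLowerSet (blowup p L) := by
  rintro b a hab (⟨hb, hpb⟩ | ⟨y, hy, hpy, ⟨w, hw, hpw, hyw⟩, rfl⟩)
  · exact Or.inl ⟨hL hab hb, fun h => hpb (h.trans hab)⟩
  · obtain ⟨h1, h2⟩ := Prod.le_def.1 hab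
    by_cases hp : p ∈ a.1
    · have hle : (a.1.erase p, a.2) ≤ y := Prod.le_def.2 ⟨fun c hc => by
        have := h1 (Finset.mem_of_mem_erase hc)
        exact (Finset.mem_insert.1 this).resolve_left (Finset.ne_of_mem_erase hc), h2⟩
      refine Or.inr ⟨(a.1.erase p, a.2), hL hle hy, fun h => hpy (h.trans hle),
        ⟨w, hw, hpw, hle.trans hyw⟩, ?_⟩
      exact Prod.ext (Finset.insert_erase hp).symm rfl
    · have hle : a ≤ y := Prod.le_def.2 ⟨fun c hc => by
        refine (Finset.mem_insert.1 (h1 hc)).resolve_left fun h => hp (h ▸ hc), h2⟩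
      exact Or.inl ⟨hL hle hy, fun h => hpy (h.trans hle)⟩

theorem empty_mem_blowup (p x : α) (L : Set (Finset α × α)) :
    (∅, x) ∈ blowup p L ↔ (∅, x) ∈ L ∧ ¬ p ≤ x := by
  constructor
  · rintro (⟨h, h'⟩ | ⟨y, _, _, _, h⟩)
    · exact ⟨h, fun hpx => h' (Prod.le_def.2 ⟨le_rfl, hpx⟩)⟩
    · exact absurd (congrArg Prod.fst h).symm (Finset.insert_ne_empty _ _)
  · rintro ⟨h, h'⟩
    exact Or.inl ⟨h, fun hpx => h' (Prod.le_def.1 hpx).2⟩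

theorem isLowerSet_partialBlowup (H : Finset α) : IsLowerSet (partialBlowup H) := by
  have : ∀ (l : List α) (L : Set (Finset α × α)), IsLowerSet L →
      IsLowerSet (l.foldl (fun L p => blowup p L) L) := by
    intro l
    induction l with
    | nil => intro L h; exact h
    | cons p l ih => intro L h; exact ih _ (isLowerSet_blowup p h)
  refine this _ _ ?_
  rintro b a hab hb
  have h1 := (Prod.le_def.1 hab).1
  rw [Set.mem_setOf_eq] at hb ⊢
  rw [hb] at h1
  exact Finset.subset_empty.1 h1

theorem mem_blowupOrder (H : Finset α) (h : α) : h ∈ blowupOrder H ↔ h ∈ H ∧ ¬ IsAtom h := by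
  unfold blowupOrder
  erw [List.mem_reverse, Finset.mem_sort]
  erw [Finset.mem_map]
  simp only [Finset.mem_filter]
  constructor
  · rintro ⟨a, ha, rfl⟩; exact ha
  · intro hh; exact ⟨h, hh, rfl⟩

/-- No non-atom of `H` lies below `x`. -/
def Avoids (H : Finset α) (x : α) : Prop := ∀ h ∈ H, ¬ IsAtom h → ¬ h ≤ x

/-- An unlabelled element survives the blowup at `q` exactly when `q` is not below it, whatever the
order of the blowups. -/
theorem empty_mem_partialBlowup (H : Finset α) (x : α) :
    (∅, x) ∈ partialBlowup H ↔ Avoids H x := by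
  have : ∀ (l : List α) (L : Set (Finset α × α)),
      (∅, x) ∈ l.foldl (fun L p => blowup p L) L ↔ (∅, x) ∈ L ∧ ∀ p ∈ l, ¬ p ≤ x := by
    intro l
    induction l with
    | nil => simp
    | cons p l ih => intro L; simp [ih, empty_mem_blowup, and_assoc]
  rw [partialBlowup, this]
  simp [mem_blowupOrder, Avoids]

/-- The right side is strictly monotone, which bounds the height from above. Conversely the blowup
is a lower set, so erasing a label, or lowering the second component when no label is left, gives a
smaller element of value one less. -/
theorem height_partialBlowup (H : Finset α) (z : partialBlowup H) :
    Order.height z = ((z.1.1.card + rk z.1.2 : ℕ) : ℕ∞) := by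
  apply le_antisymm
  · have hf : StrictMono (fun z : partialBlowup H => z.1.1.card + rk z.1.2) := by
      intro a b hab
      have hab' : a.1 < b.1 := hab
      rcases Prod.lt_iff.1 hab' with ⟨h1, h2⟩ | ⟨h1, h2⟩
      · have := Finset.card_lt_card h1; have := rk_mono h2; dsimp only; omega
      · have := Finset.card_le_card h1; have := rk_lt h2; dsimp only; omega
    have := Order.height_le_height_apply_of_strictMono _ hf z
    simpa using this
  · induction hn : z.1.1.card + rk z.1.2 generalizing z with
    | zero => simp
    | succ n ih =>
      obtain ⟨y, hyz, hyn⟩ : ∃ y : Finset α × α, y < z.1 ∧ y.1.card + rk y.2 = n := by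
        rcases z.1.1.eq_empty_or_nonempty with h | ⟨g, hg⟩
        · rw [h, Finset.card_empty, zero_add] at hn
          obtain ⟨x, hx, hxn⟩ := exists_rk_eq hn
          exact ⟨(∅, x), Prod.lt_iff.2 (Or.inr ⟨by simp, hx⟩), by simp [hxn]⟩
        · refine ⟨(z.1.1.erase g, z.1.2), Prod.lt_iff.2 (Or.inl
            ⟨Finset.erase_ssubset hg, le_rfl⟩), ?_⟩
          have := Finset.card_pos.2 ⟨g, hg⟩
          rw [Finset.card_erase_of_mem hg]; dsimp only; omega
      have h1 := ih ⟨y, isLowerSet_partialBlowup H hyz.le z.2⟩ hyn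
      have h2 : (⟨y, isLowerSet_partialBlowup H hyz.le z.2⟩ : partialBlowup H) < z := hyz
      have h3 := Order.height_add_one_le h2
      push_cast
      exact (add_le_add_left h1 1).trans h3

/-- The join of a set of atoms of the partial blowup. -/
noncomputable def joinPair {H : Finset α} (C : Finset (partialBlowup H)) : Finset α × α :=
  (C.sup fun z => z.1.1, C.sup fun z => z.1.2)

theorem joinPair_le_iff {H : Finset α} (C : Finset (partialBlowup H)) (w : Finset α × α) :
    joinPair C ≤ w ↔ ∀ z ∈ C, z.1 ≤ w := by
  rw [Prod.le_def]
  change C.sup _ ≤ w.1 ∧ C.sup _ ≤ w.2 ↔ _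
  rw [Finset.sup_le_iff, Finset.sup_le_iff]
  exact ⟨fun h z hz => Prod.le_def.2 ⟨h.1 z hz, h.2 z hz⟩,
    fun h => ⟨fun z hz => (Prod.le_def.1 (h z hz)).1, fun z hz => (Prod.le_def.1 (h z hz)).2⟩⟩

theorem bddAbove_iff {H : Finset α} (C : Finset (partialBlowup H)) :
    BddAbove (C : Set (partialBlowup H)) ↔ joinPair C ∈ partialBlowup H := by
  constructor
  · rintro ⟨w, hw⟩
    exact isLowerSet_partialBlowup H ((joinPair_le_iff C w.1).2 fun z hz => hw hz) w.2
  · intro h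
    exact ⟨⟨_, h⟩, fun z hz => (joinPair_le_iff C _).1 le_rfl z hz⟩

theorem isIndep_iff {H : Finset α} (C : Finset (partialBlowup H)) :
    IsIndep C ↔ joinPair C ∈ partialBlowup H ∧
      (joinPair C).1.card + rk (joinPair C).2 = C.card := by
  constructor
  · rintro ⟨y, hy, hc⟩
    have hm := (bddAbove_iff C).1 ⟨y, hy.1⟩
    have : y = ⟨_, hm⟩ := by
      refine le_antisymm (hy.2 fun z hz => (joinPair_le_iff C _).1 le_rfl z hz) ?_
      exact (joinPair_le_iff C _).2 fun z hz => hy.1 hz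
    rw [height_partialBlowup, this] at hc
    exact ⟨hm, by exact_mod_cast hc⟩
  · rintro ⟨hm, hc⟩
    refine ⟨⟨_, hm⟩, ⟨fun z hz => (joinPair_le_iff C _).1 le_rfl z hz, fun w hw =>
      (joinPair_le_iff C w.1).2 fun z hz => hw hz⟩, ?_⟩
    rw [height_partialBlowup]
    exact_mod_cast hc

theorem Avoids.mono {H : Finset α} {x y : α} (h : Avoids H y) (hxy : x ≤ y) : Avoids H x :=
  fun g hg hga hgx => h g hg hga (hgx.trans hxy)

theorem isIndep_iff_of_fst {H : Finset α} (C : Finset (partialBlowup H))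
    (h : ∀ z ∈ C, z.1.1 = ∅) : IsIndep C ↔ Avoids H ((C.image fun z => z.1.2).sup id) ∧
      rk ((C.image fun z => z.1.2).sup id) = (C.image fun z => z.1.2).card := by
  have h1 : joinPair C = (∅, (C.image fun z => z.1.2).sup id) := by
    refine Prod.ext ?_ ?_
    · exact (Finset.sup_congr rfl h).trans (Finset.sup_bot C)
    · rw [Finset.sup_image]; rfl
  have h2 : (C.image fun z => z.1.2).card = C.card := by
    refine Finset.card_image_of_injOn fun z hz w hw hzw => Subtype.ext (Prod.ext ?_ hzw)
    rw [h z hz, h w hw]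
  rw [isIndep_iff, h1, h2, empty_mem_partialBlowup]
  simp

theorem isCircuit_iff_of_fst {H : Finset α} (C : Finset (partialBlowup H))
    (h : ∀ z ∈ C, z.1.1 = ∅) (ha : ∀ z ∈ C, IsAtom z.1.2) :
    IsCircuit C ↔ Avoids H ((C.image fun z => z.1.2).sup id) ∧
      Circuit (C.image fun z => z.1.2) := by
  have h1 : joinPair C = (∅, (C.image fun z => z.1.2).sup id) := by
    refine Prod.ext ?_ ?_
    · exact (Finset.sup_congr rfl h).trans (Finset.sup_bot C)
    · rw [Finset.sup_image]; rfl
  have hA : ∀ a ∈ C.image (fun z => z.1.2), IsAtom a := by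
    intro a hh
    obtain ⟨z, hz, rfl⟩ := Finset.mem_image.1 hh
    exact ha z hz
  rw [IsCircuit, bddAbove_iff, isIndep_iff_of_fst C h, h1, empty_mem_partialBlowup]
  constructor
  · rintro ⟨h2, h3, h4⟩
    refine ⟨h2, hA, fun hi => h3 ⟨h2, hi.2⟩, fun B hB => ⟨fun a ha => hA a (hB.1 ha), ?_⟩⟩
    have hBi : (C.filter fun z => z.1.2 ∈ B).image (fun z => z.1.2) = B := by
      ext a
      simp only [Finset.mem_image, Finset.mem_filter]
      constructor
      · rintro ⟨z, hz, rfl⟩; exact hz.2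
      · intro hab
        obtain ⟨z, hz, rfl⟩ := Finset.mem_image.1 (hB.1 hab)
        exact ⟨z, ⟨hz, hab⟩, rfl⟩
    have h5 := h4 (C.filter fun z => z.1.2 ∈ B) (lt_of_le_of_ne (Finset.filter_subset _ _) (by
      intro he
      rw [he] at hBi
      exact hB.ne hBi.symm))
    rw [isIndep_iff_of_fst _ fun z hz => h z (Finset.mem_of_mem_filter z hz), hBi] at h5
    exact h5.2
  · rintro ⟨h2, h3⟩
    refine ⟨h2, fun h4 => h3.not_indep ⟨h3.atom, h4.2⟩, fun T hT => ?_⟩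
    rw [isIndep_iff_of_fst _ fun z hz => h z (hT.1 hz)]
    have hsub : T.image (fun z => z.1.2) ⊆ C.image (fun z => z.1.2) :=
      Finset.image_subset_image hT.1
    have hss : T.image (fun z => z.1.2) ⊂ C.image (fun z => z.1.2) := by
      refine lt_of_le_of_ne hsub fun he => ?_
      obtain ⟨z, hz, hzT⟩ := Finset.exists_of_ssubset hT
      have := Finset.mem_image_of_mem (fun z : partialBlowup H => z.1.2) hz
      rw [← he, Finset.mem_image] at this
      obtain ⟨w, hw, hwz⟩ := this
      have : w = z := Subtype.ext (Prod.ext (by rw [h w (hT.1 hw), h z hz]) hwz)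
      exact hzT (this ▸ hw)
    exact ⟨h2.mono (Finset.sup_mono hsub), (h3.indep _ hss).2⟩

theorem blowupAtom_of_isAtom {g : α} (h : IsAtom g) : blowupAtom g = (∅, g) := if_pos h

theorem blowupAtom_of_not_isAtom {g : α} (h : ¬ IsAtom g) : blowupAtom g = ({g}, ⊥) := if_neg h

/-- A blown-up non-atom `({g}, ⊥)` is the only atom carrying the label `g`, so it is independent of
the others and lies in no circuit. The rest is the matroid of atoms of `α`, with boundedness turned
into `Avoids`. -/
theorem isBlowupCircuit_iff {H : Finset α} (S : Finset H) :
    IsBlowupCircuit H S ↔ Circuit (S.map (Function.Embedding.subtype _)) ∧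
      Avoids H ((S.map (Function.Embedding.subtype _)).sup id) := by
  classical
  have key : ∀ C : Finset (partialBlowup H), (∀ g ∈ S, IsAtom (g : α)) →
      C.map (Function.Embedding.subtype _) = S.image (fun g : H => blowupAtom (g : α)) →
      (IsCircuit C ↔ Circuit (S.map (Function.Embedding.subtype _)) ∧
      Avoids H ((S.map (Function.Embedding.subtype _)).sup id)) := by
    intro C hS hC
    have hmem : ∀ z ∈ C, ∃ g ∈ S, z.1 = (∅, (g : α)) := by
      intro z hz
      have : z.1 ∈ C.map (Function.Embedding.subtype _) := Finset.mem_map_of_mem _ hz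
      rw [hC, Finset.mem_image] at this
      obtain ⟨g, hg, hgz⟩ := this
      exact ⟨g, hg, by rw [← hgz, blowupAtom_of_isAtom (hS g hg)]⟩
    have himg : C.image (fun z => z.1.2) = S.map (Function.Embedding.subtype _) := by
      have : C.image (fun z => z.1.2) = (C.map (Function.Embedding.subtype _)).image Prod.snd := by
        ext; simp
      rw [this, hC]
      ext a
      simp only [Finset.mem_image, Finset.mem_map, Function.Embedding.subtype_apply]
      constructor
      · rintro ⟨_, ⟨g, hg, rfl⟩, rfl⟩
        exact ⟨g, hg, by rw [blowupAtom_of_isAtom (hS g hg)]⟩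
      · rintro ⟨g, hg, rfl⟩
        exact ⟨_, ⟨g, hg, rfl⟩, by rw [blowupAtom_of_isAtom (hS g hg)]⟩
    rw [isCircuit_iff_of_fst C, himg, and_comm]
    · intro z hz; obtain ⟨g, _, h⟩ := hmem z hz; rw [h]
    · intro z hz; obtain ⟨g, hg, h⟩ := hmem z hz; rw [h]; exact hS g hg
  constructor
  · rintro ⟨C, hC, hCc⟩
    refine (key C (fun g hg => ?_) hC).1 hCc
    by_contra hga
    have hmem : blowupAtom (g : α) ∈ C.map (Function.Embedding.subtype _) := by
      rw [hC]; exact Finset.mem_image_of_mem _ hg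
    obtain ⟨z, hz, hzg⟩ := Finset.mem_map.1 hmem
    rw [Function.Embedding.subtype_apply, blowupAtom_of_not_isAtom hga] at hzg
    -- The set without `g` is independent; putting `g` back raises both rank and cardinality by one.
    have h1 := (isIndep_iff _).1 (hCc.2.2 _ (Finset.erase_ssubset hz))
    refine hCc.2.1 ((isIndep_iff C).2 ⟨(bddAbove_iff C).1 hCc.1, ?_⟩)
    have h2 : joinPair C = (insert (g : α) (joinPair (C.erase z)).1, (joinPair (C.erase z)).2) := by
      conv_lhs => rw [← Finset.insert_erase hz]
      refine Prod.ext ?_ ?_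
      · change (insert z (C.erase z)).sup _ = _
        rw [Finset.sup_insert, hzg]; rfl
      · change (insert z (C.erase z)).sup _ = _
        rw [Finset.sup_insert, hzg]; exact bot_sup_eq _
    have h3 : (g : α) ∉ (joinPair (C.erase z)).1 := by
      intro hh
      obtain ⟨w, hw, hgw⟩ := Finset.mem_sup.1 hh
      have hw' : w.1 ∈ C.map (Function.Embedding.subtype _) :=
        Finset.mem_map_of_mem _ (Finset.mem_of_mem_erase hw)
      rw [hC, Finset.mem_image] at hw'
      obtain ⟨k, hk, hkw⟩ := hw'
      by_cases hka : IsAtom (k : α)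
      · rw [blowupAtom_of_isAtom hka] at hkw
        rw [← hkw] at hgw; simp at hgw
      · rw [blowupAtom_of_not_isAtom hka] at hkw
        rw [← hkw] at hgw
        rw [Finset.mem_singleton] at hgw
        refine Finset.ne_of_mem_erase hw (Subtype.ext ?_)
        rw [hzg, ← hkw, hgw]
    rw [h2, Finset.card_insert_of_notMem h3]
    have := Finset.card_pos.2 ⟨z, hz⟩
    have h4 := h1.2
    rw [Finset.card_erase_of_mem hz] at h4
    dsimp only
    omega
  · rintro ⟨h1, h2⟩
    have hS : ∀ g ∈ S, IsAtom (g : α) := fun g hg =>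
      h1.atom _ (Finset.mem_map_of_mem (Function.Embedding.subtype _) hg)
    have hC : ((S.image (fun g : H => blowupAtom (g : α))).subtype (· ∈ partialBlowup H)).map
        (Function.Embedding.subtype _) = S.image (fun g : H => blowupAtom (g : α)) := by
      refine Finset.subtype_map_of_mem fun z hz => ?_
      obtain ⟨g, hg, rfl⟩ := Finset.mem_image.1 hz
      rw [blowupAtom_of_isAtom (hS g hg), empty_mem_partialBlowup]
      exact h2.mono (Finset.le_sup (f := id)
        (Finset.mem_map_of_mem (Function.Embedding.subtype _) hg))
    exact ⟨_, hC, (key _ hS hC).2 ⟨h1, h2⟩⟩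

/-- A set is not nested if and only if it contains a subset whose join is a new element of `H`. -/
theorem not_isNested_iff {H : Finset α} (hbot : ⊥ ∉ H) (S : Finset H) : ¬ IsNested H S ↔
    ∃ W : Finset α, (∀ w ∈ W, ∃ h : w ∈ H, (⟨w, h⟩ : H) ∈ S) ∧ W.sup id ∈ H ∧ W.sup id ∉ W := by
  classical
  rw [IsNested]
  push Not
  constructor
  · rintro ⟨T, hT, hc, ha, hs⟩
    have hsup : (T.map (Function.Embedding.subtype _)).sup id = T.sup (fun h => (h : α)) := by
      rw [Finset.sup_map]; rfl
    refine ⟨T.map (Function.Embedding.subtype _), fun w hw => ?_, by rwa [hsup], ?_⟩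
    · obtain ⟨t, ht, rfl⟩ := Finset.mem_map.1 hw
      exact ⟨t.2, hT ht⟩
    · intro hmem
      obtain ⟨t, ht, hts⟩ := Finset.mem_map.1 hmem
      obtain ⟨t', ht', hne⟩ := Finset.exists_mem_ne hc t
      refine ha ht' ht hne ?_
      have : (t' : α) ≤ (T.map (Function.Embedding.subtype _)).sup id :=
        Finset.le_sup (f := id) (Finset.mem_map_of_mem (Function.Embedding.subtype _) ht')
      rw [← hts] at this; exact this
  · rintro ⟨W, hW, hs, hn⟩
    -- The maximal elements of `W` are an antichain with the same join. A single maximal element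
    -- would be the join itself, and an empty `W` has join `⊥`, which is not in `H`.
    let T : Finset H := Finset.univ.filter fun h => Maximal (fun x => x ∈ W) (h : α)
    have hmax : ∀ w ∈ W, ∃ t ∈ T, w ≤ (t : α) := by
      intro w hw
      obtain ⟨m, hm, hmm⟩ := (Set.toFinite {x | x ∈ W}).exists_le_maximal
        (show w ∈ {x | x ∈ W} from hw)
      obtain ⟨h, _⟩ := hW m hmm.1
      exact ⟨⟨m, h⟩, by simpa [T] using hmm, hm⟩
    have hsup : T.sup (fun h => (h : α)) = W.sup id := by
      refine le_antisymm (Finset.sup_le fun t ht => ?_) (Finset.sup_le fun w hw => ?_)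
      · have ht' : Maximal (fun x => x ∈ W) (t : α) := by simpa [T] using ht
        exact Finset.le_sup (f := id) ht'.1
      · obtain ⟨t, ht, hwt⟩ := hmax w hw
        exact hwt.trans (Finset.le_sup (f := fun h : H => (h : α)) ht)
    refine ⟨T, fun t ht => ?_, ?_, ?_, by rwa [hsup]⟩
    · have ht' : Maximal (fun x => x ∈ W) (t : α) := by simpa [T] using ht
      obtain ⟨_, h⟩ := hW _ ht'.1
      exact h
    · by_contra hlt
      have h1 : T.card ≤ 1 := by omega
      rcases T.eq_empty_or_nonempty with he | ⟨t, ht⟩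
      · rw [he, Finset.sup_empty] at hsup
        rw [← hsup] at hs; exact hbot hs
      · have : T = {t} := Finset.eq_singleton_iff_unique_mem.2
          ⟨ht, fun y hy => Finset.card_le_one.1 h1 y hy t ht⟩
        rw [this, Finset.sup_singleton] at hsup
        have ht' : Maximal (fun x => x ∈ W) (t : α) := by simpa [T] using ht
        exact hn (hsup ▸ ht'.1)
    · intro a ha b hb hne hab
      have ha' : Maximal (fun x => x ∈ W) (a : α) := by simpa [T] using ha
      have hb' : Maximal (fun x => x ∈ W) (b : α) := by simpa [T] using hb
      exact hne (Subtype.ext (le_antisymm hab (ha'.2 hb'.1 hab)))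

end Blowup

end Leray
namespace Leray

universe u v

/-! ### Building sets, partial building sets and bad sets. -/

section Building

variable {α : Type u} [Lattice α] [BoundedOrder α] [Fintype α]

theorem mem_factors {G : Finset α} {x y : α} :
    y ∈ factors G x ↔ Maximal (fun z => z ∈ G ∧ z ≤ x) y := by
  simp [factors]

theorem exists_factor {G : Finset α} {x g : α} (hg : g ∈ G) (hgx : g ≤ x) :
    ∃ y ∈ factors G x, g ≤ y := by
  obtain ⟨y, hy, hm⟩ := (Set.toFinite {z | z ∈ G ∧ z ≤ x}).exists_le_maximal
    (show g ∈ {z | z ∈ G ∧ z ≤ x} from ⟨hg, hgx⟩)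
  exact ⟨y, mem_factors.2 hm, hy⟩

variable [DecidableEq α] {G H : Finset α}

theorem IsBuildingSet.factor_coord {x : α}
    (φ : ((y : factors G x) → Set.Iic (y : α)) ≃o Set.Iic x)
    (hφ : ∀ y : factors G x, ((φ (Function.update (fun _ => ⊥) y ⊤) : Set.Iic x) : α) = y)
    (y y' : factors G x) (hne : y' ≠ y) (w : Set.Iic x) (hw : (w : α) ≤ y) :
    φ.symm w y' = ⊥ := by
  have h1 : w ≤ φ (Function.update (fun _ => ⊥) y ⊤) := Subtype.coe_le_coe.1 (by rw [hφ]; exact hw)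
  have h2 := φ.symm.monotone h1 y'
  rw [OrderIso.symm_apply_apply, Function.update_of_ne hne] at h2
  exact le_bot_iff.1 h2

/-- In the product decomposition an element below one factor has only that coordinate; below two
factors, none is left. -/
theorem IsBuildingSet.disjoint (hG : IsBuildingSet G) {x y y' w : α} (hy : y ∈ factors G x)
    (hy' : y' ∈ factors G x) (hne : y ≠ y') (hw : w ≤ y) (hw' : w ≤ y') : w = ⊥ := by
  have hyx := (mem_factors.1 hy).1
  have hx : x ≠ ⊥ := by
    rintro rfl
    exact hG.1 (le_bot_iff.1 hyx.2 ▸ hyx.1)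
  obtain ⟨φ, hφ⟩ := hG.2 x hx
  let w' : Set.Iic x := ⟨w, hw.trans hyx.2⟩
  have h0 : φ.symm w' = ⊥ := by
    funext z
    by_cases hz : z = ⟨y, hy⟩
    · exact IsBuildingSet.factor_coord φ hφ ⟨y', hy'⟩ z
        (fun h => hne (congrArg Subtype.val (hz.symm.trans h))) w' hw'
    · exact IsBuildingSet.factor_coord φ hφ ⟨y, hy⟩ z hz w' hw
  have : w' = ⊥ := by
    have := congrArg φ h0
    rwa [φ.apply_symm_apply, map_bot] at this
  exact congrArg Subtype.val this

-- Only the members of `C` below `y` contribute to the `y`-coordinate of the join, and the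
-- coordinates of `c` other than `y` are `⊥`.
open Classical in
theorem IsBuildingSet.le_sup_filter (hG : IsBuildingSet G) {x y c : α} (hy : y ∈ factors G x)
    (hc : c ≤ y) {C : Finset α} (hC : ∀ c' ∈ C, ∃ y' ∈ factors G x, c' ≤ y')
    (h : c ≤ C.sup id) : c ≤ (C.filter (· ≤ y)).sup id := by
  have hyx := (mem_factors.1 hy).1
  have hx : x ≠ ⊥ := by
    rintro rfl
    exact hG.1 (le_bot_iff.1 hyx.2 ▸ hyx.1)
  obtain ⟨φ, hφ⟩ := hG.2 x hx
  have hu : (C.filter (· ≤ y)).sup id ≤ x := Finset.sup_le fun d hd =>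
    (Finset.mem_filter.1 hd).2.trans hyx.2
  let u : Set.Iic x := ⟨_, hu⟩
  -- An upper bound for all of `C`: exact in the coordinate `y`, without restriction elsewhere.
  let m : (y : factors G x) → Set.Iic (y : α) := fun z => if z = ⟨y, hy⟩ then φ.symm u z else ⊤
  have hle : C.sup id ≤ φ m := by
    refine Finset.sup_le fun d hd => ?_
    obtain ⟨y', hy', hdy⟩ := hC d hd
    let d' : Set.Iic x := ⟨d, hdy.trans (mem_factors.1 hy').1.2⟩
    suffices d' ≤ φ m from this
    rw [← φ.symm_apply_le]
    intro z
    by_cases hz : z = ⟨y, hy⟩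
    · simp only [m, if_pos hz]
      by_cases hyy : d ≤ y
      · refine φ.symm.monotone (show d' ≤ u from ?_) z
        exact Finset.le_sup (f := id) (Finset.mem_filter.2 ⟨hd, hyy⟩)
      · rw [IsBuildingSet.factor_coord φ hφ ⟨y', hy'⟩ z ?_ d' hdy]
        · exact bot_le
        · rintro h'; rw [hz] at h'
          have := congrArg Subtype.val h'
          exact hyy (hdy.trans this.ge)
    · simp only [m, if_neg hz]; exact le_top
  let c' : Set.Iic x := ⟨c, hc.trans hyx.2⟩
  suffices c' ≤ u from this
  have h1 : φ.symm c' ≤ m := by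
    rw [φ.symm_apply_le]; exact h.trans hle
  rw [← φ.symm.le_iff_le]
  intro z
  by_cases hz : z = ⟨y, hy⟩
  · have := h1 z
    simpa only [m, if_pos hz] using this
  · rw [IsBuildingSet.factor_coord φ hφ ⟨y, hy⟩ z hz c' hc]
    exact bot_le

/-- Different factors of `p ⊔ q` meet in `⊥`, so `p` and `q` lie below a common factor, which must
then be `p ⊔ q`. -/
theorem IsBuildingSet.sup_mem (hG : IsBuildingSet G) {p q : α} (hp : p ∈ G) (hq : q ∈ G)
    (h : p ⊓ q ≠ ⊥) : p ⊔ q ∈ G := by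
  obtain ⟨y, hy, hpy⟩ := exists_factor hp (le_sup_left (b := q))
  obtain ⟨y', hy', hqy⟩ := exists_factor hq (le_sup_right (a := p))
  by_cases hne : y = y'
  · subst hne
    have := le_antisymm (mem_factors.1 hy).1.2 (sup_le hpy hqy)
    exact this ▸ (mem_factors.1 hy).1.1
  · exact absurd (hG.disjoint hy hy' hne (inf_le_left.trans hpy) (inf_le_right.trans hqy)) h

/-- Circuits are connected. If `C` were spread over several factors, the part below the factor of
`c` would be a proper, hence independent, subset in which `c` is still spanned by the others. -/
theorem IsBuildingSet.circuit_sup_mem [IsUpperModularLattice α] (hG : IsBuildingSet G)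
    (hat : ∀ a : α, IsAtom a → a ∈ G) {C : Finset α} (hC : Circuit C) : C.sup id ∈ G := by
  classical
  obtain ⟨c, hc⟩ := hC.nonempty
  have hf : ∀ d ∈ C, ∃ y ∈ factors G (C.sup id), d ≤ y := fun d hd =>
    exists_factor (hat d (hC.atom d hd)) (Finset.le_sup (f := id) hd)
  obtain ⟨y, hy, hcy⟩ := hf c hc
  by_cases hall : ∀ d ∈ C, d ≤ y
  · have := le_antisymm (mem_factors.1 hy).1.2 (Finset.sup_le hall)
    exact this ▸ (mem_factors.1 hy).1.1
  · exfalso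
    push Not at hall
    obtain ⟨d, hd, hdy⟩ := hall
    have h1 := hG.le_sup_filter hy hcy (C := C.erase c)
      (fun d hd => hf d (Finset.mem_of_mem_erase hd)) (hC.le_sup_erase hc)
    have h2 : (C.erase c).filter (· ≤ y) = (C.filter (· ≤ y)).erase c := by
      ext; simp [and_assoc]
    rw [h2] at h1
    have h3 : Indep (C.filter (· ≤ y)) := hC.indep _ (Finset.filter_ssubset.2 ⟨d, hd, hdy⟩)
    exact h3.notMem_sup (Finset.mem_filter.2 ⟨hc, hcy⟩) h1

/-- A set of elements of `H` whose join is a new element of `H`. -/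
structure Bad (H W : Finset α) : Prop where
  sup_mem : W.sup id ∈ H
  sup_notMem : W.sup id ∉ W

namespace IsPartialBuildingSet

variable (hH : IsPartialBuildingSet G H)
include hH

theorem bot_notMem : ⊥ ∉ H := fun h => hH.isBuildingSet.1 (hH.subset h)

theorem mem_of_le {h g : α} (hh : h ∈ H) (hha : ¬ IsAtom h) (hg : g ∈ G) (hle : h ≤ g) : g ∈ H :=
  (hH.upward_closed h hh hha g hg hle).1

theorem ne_bot {h : α} (hh : h ∈ H) : h ≠ ⊥ := fun e => hH.bot_notMem (e ▸ hh)

theorem sup_mem {h x : α} (hh : h ∈ H) (hha : ¬ IsAtom h) (hx : x ∈ G) (hhx : h ⊓ x ≠ ⊥) :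
    h ⊔ x ∈ H :=
  hH.mem_of_le hh hha (hH.isBuildingSet.sup_mem (hH.subset hh) hx hhx) le_sup_left

omit [BoundedOrder α] [Fintype α] [DecidableEq α] hH in
open Classical in
theorem _root_.Leray.sup_filter_not_le [OrderBot α] (h : α) (S : Finset α) :
    h ⊔ (S.filter fun c => ¬ c ≤ h).sup id = h ⊔ S.sup id := by
  refine le_antisymm (sup_le_sup_left (Finset.sup_mono (Finset.filter_subset _ _)) _)
    (sup_le le_sup_left (Finset.sup_le fun c hc => ?_))
  by_cases hch : c ≤ h
  · exact le_sup_of_le_left hch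
  · exact le_sup_of_le_right (Finset.le_sup (f := id) (Finset.mem_filter.2 ⟨hc, hch⟩))

theorem circuit_sup_mem [IsUpperModularLattice α] {C : Finset α} (hC : Circuit C) :
    C.sup id ∈ G :=
  hH.isBuildingSet.circuit_sup_mem (fun a ha => hH.subset (hH.atom_mem a ha)) hC

/-- If a circuit meets a non-atom `h` of `H` without lying below it, then removing any element
of the circuit leaves, together with `h`, a set with a join in `H`. -/
theorem bad_circuit [IsUpperModularLattice α] {C A : Finset α} (hC : Circuit C)
    {h c v : α} (hh : h ∈ H) (hha : ¬ IsAtom h) (hc : c ∈ C) (hch : c ≤ h) (hv : v ∈ C)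
    (hvh : ¬ v ≤ h) (hA : h ⊔ A.sup id = h ⊔ C.sup id) (hAa : ∀ a ∈ A, IsAtom a) :
    Bad H (insert h A) := by
  have hsup : (insert h A).sup id = h ⊔ C.sup id := by rw [Finset.sup_insert, id, hA]
  have hcC : c ≤ C.sup id := Finset.le_sup (f := id) hc
  refine ⟨?_, ?_⟩
  · rw [hsup]
    -- The atom `c` lies below both `h` and the join of the circuit, so their meet is not `⊥`.
    refine hH.sup_mem hh hha (hH.circuit_sup_mem hC) fun e => (hC.atom c hc).1 ?_
    exact le_bot_iff.1 (e ▸ le_inf hch hcC)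
  · rw [hsup, Finset.mem_insert]
    rintro (e | e)
    · exact hvh ((Finset.le_sup (f := id) hv).trans (le_sup_right.trans e.le))
    · rcases (hAa _ e).le_iff.1 (le_sup_left : h ≤ h ⊔ C.sup id) with h1 | h1
      · exact hH.ne_bot hh h1
      · exact hha (h1 ▸ hAa _ e)

/-- The join of a bad subset would have to be an atom, and would then belong to the subset. Thus
nestedness is automatic for blowup circuits. -/
theorem nested_of_avoids (S : Finset H)
    (h : Avoids H ((S.map (Function.Embedding.subtype _)).sup id)) : IsNested H S := by
  by_contra hn
  obtain ⟨W, hW, hs, hnot⟩ := (not_isNested_iff hH.bot_notMem S).1 hn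
  have hle : W.sup id ≤ (S.map (Function.Embedding.subtype _)).sup id := by
    refine Finset.sup_mono fun w hw => ?_
    obtain ⟨_, hh⟩ := hW w hw
    exact Finset.mem_map_of_mem (Function.Embedding.subtype _) hh
  have ha : IsAtom (W.sup id) := by
    by_contra ha
    exact h _ hs ha hle
  rcases W.eq_empty_or_nonempty with rfl | ⟨w, hw⟩
  · exact ha.1 Finset.sup_empty
  · obtain ⟨hh, hw'⟩ := hW w hw
    rcases ha.le_iff.1 (Finset.le_sup (f := id) hw : w ≤ _) with e | e
    · exact hH.ne_bot hh e
    · exact hnot (e ▸ hw)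

end IsPartialBuildingSet

end Building

end Leray
namespace Leray

universe u v

/-! ### Linearity in the weights, the Leibniz rule and supports of words. -/

section Linear

variable {ι : Type*} {A : Type*} [Ring A]

theorem wdel_sub (w w' E : ι → A) (l : List ι) :
    wdel (fun g => w g - w' g) E l = wdel w E l - wdel w' E l := by
  induction l with
  | nil => simp
  | cons g l ih => rw [wdel_cons, ih, wdel_cons, wdel_cons]; noncomm_ring

theorem wdel_sum {κ : Type*} (s : Finset κ) (w : κ → ι → A) (E : ι → A) (l : List ι) :
    wdel (fun g => ∑ h ∈ s, w h g) E l = ∑ h ∈ s, wdel (w h) E l := by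
  induction l with
  | nil => simp
  | cons g l ih => simp [ih, Finset.sum_mul, Finset.mul_sum, Finset.sum_sub_distrib]

theorem wdel_mul_left (z : A) (hz : ∀ a, z * a = a * z) (w E : ι → A) (l : List ι) :
    wdel (fun g => z * w g) E l = z * wdel w E l := by
  induction l with
  | nil => simp
  | cons g l ih => rw [wdel_cons, wdel_cons, ih, mul_sub, mul_assoc, ← mul_assoc (E g), ← hz,
      mul_assoc]

/-- The weighted derivation only sees the letters of weight one. -/
theorem wdel_indicator_append (P : ι → Prop) [DecidablePred P] (E : ι → A) (l l' : List ι)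
    (hl : ∀ g ∈ l, P g) (hl' : ∀ g ∈ l', ¬ P g) :
    wdel (fun g => if P g then 1 else 0) E (l ++ l') =
      wdel (fun _ => 1) E l * (l'.map E).prod := by
  rw [wdel_append, wdel_eq_zero (l := l') fun g hg => if_neg (hl' g hg), mul_zero, mul_zero,
    add_zero, wdel_congr (fun g hg => if_pos (hl g hg)) fun _ _ => rfl]

end Linear

section Leibniz

variable {α : Type u} (H : Finset α)

theorem antiderivation_monE_mul (c : H → MvPolynomial H ℚ) (l : List H) (b : FreeAlg H) :
    antiderivation H c (monE H l * b) = wdel (fun g => algebraMap _ _ (c g)) (genE H) l * b +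
      (-1) ^ l.length * (monE H l * antiderivation H c b) := by
  induction l with
  | nil => simp
  | cons g l ih =>
    have : Commute (genE H g) ((-1 : FreeAlg H) ^ l.length) :=
      (Commute.neg_one_right _).pow_right _
    rw [monE_cons, mul_assoc, antiderivation_genE_mul, ih, wdel_cons, mul_add,
      ← mul_assoc (genE H g) ((-1) ^ _), this.eq, List.length_cons, pow_succ, Algebra.smul_def,
      ← monE]
    noncomm_ring

/-- The Leibniz rule with `∂² = 0`: only the term with `∂ b` survives, with the sign of the degree
of `∂ e_l`. -/
theorem boundary_wdel_mul (l : List H) (b : FreeAlg H) :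
    boundary H (wdel (fun _ => 1) (genE H) l * b) =
      (-1) ^ (l.length + 1) * (wdel (fun _ => 1) (genE H) l * boundary H b) := by
  induction l with
  | nil => simp
  | cons g l ih =>
    have : Commute (genE H g) ((-1 : FreeAlg H) ^ (l.length + 1)) :=
      (Commute.neg_one_right _).pow_right _
    have h1 := antiderivation_monE_mul H (fun _ => 1) l b
    have h2 := antiderivation_genE_mul H (fun _ => 1) g (wdel (fun _ => 1) (genE H) l * b)
    simp only [map_one, one_smul] at h1 h2
    rw [wdel_cons, one_mul, ← monE, sub_mul, map_sub, mul_assoc]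
    unfold boundary at ih ⊢
    rw [h1, h2, ih, ← mul_assoc (genE H g) ((-1) ^ _), this.eq, List.length_cons,
      pow_succ _ (l.length + 1), pow_succ _ l.length]
    noncomm_ring

end Leibniz

section Support

variable {α : Type u} [DecidableEq α] {H : Finset α}

/-- The set of letters of a word. -/
def supp (l : List H) : Finset α := l.toFinset.map (Function.Embedding.subtype _)

theorem mem_supp {l : List H} {w : α} : w ∈ supp l ↔ ∃ h : w ∈ H, (⟨w, h⟩ : H) ∈ l := by
  simp [supp]

theorem coe_mem_supp {l : List H} {g : H} : (g : α) ∈ supp l ↔ g ∈ l := by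
  simp [mem_supp]

theorem supp_append (l l' : List H) : supp (l ++ l') = supp l ∪ supp l' := by
  ext; simp [mem_supp, exists_or]

theorem supp_cons (g : H) (l : List H) : supp (g :: l) = insert (g : α) (supp l) := by
  ext w
  rw [Finset.mem_insert, mem_supp, mem_supp]
  constructor
  · rintro ⟨h, hw⟩
    rcases List.mem_cons.1 hw with e | e
    · exact Or.inl (congrArg Subtype.val e)
    · exact Or.inr ⟨h, e⟩
  · rintro (rfl | ⟨h, hw⟩)
    · exact ⟨g.2, List.mem_cons_self⟩
    · exact ⟨h, List.mem_cons_of_mem _ hw⟩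

theorem supp_perm {l l' : List H} (h : l.Perm l') : supp l = supp l' := by
  ext w; simp [mem_supp, h.mem_iff]

theorem card_supp {l : List H} (h : l.Nodup) : (supp l).card = l.length := by
  rw [supp, Finset.card_map, List.toFinset_card_of_nodup h]

theorem supp_erase_of_nodup {l₁ l₂ : List H} {g : H} (h : (l₁ ++ g :: l₂).Nodup) :
    supp (l₁ ++ l₂) = (supp (l₁ ++ g :: l₂)).erase g := by
  have hp : (l₁ ++ g :: l₂).Perm (g :: (l₁ ++ l₂)) := List.perm_middle
  rw [supp_perm hp, supp_cons, Finset.erase_insert]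
  rw [coe_mem_supp]
  exact (List.nodup_cons.1 (hp.nodup_iff.1 h)).1

theorem supp_filter (P : α → Prop) [DecidablePred P] (l : List H) :
    supp (l.filter fun g => P g) = (supp l).filter P := by
  ext w; simp [mem_supp]

end Support

/-! ### Vanishing of monomials and boundaries in `BHat`. -/

section Vanishing

variable {α : Type u} [Lattice α] [BoundedOrder α] [Fintype α] [DecidableEq α] {G H : Finset α}

/-- Letters below `h` do not affect the join with `h`, and a circuit keeps its join when one element
is removed. -/
theorem circuit_list_sup [IsUpperModularLattice α] {l : List H} (hl : l.Nodup)
    (hC : Circuit (supp l)) (h : α) [DecidablePred (· ≤ h)] {l₁ l₂ : List H} {g : H}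
    (hs : l.filter (fun c : H => ¬ (c : α) ≤ h) = l₁ ++ g :: l₂) :
    h ⊔ (supp (l₁ ++ l₂)).sup id = h ⊔ (supp l).sup id := by
  rw [supp_erase_of_nodup (hs ▸ hl.filter _), ← hs, supp_filter (fun c => ¬ c ≤ h) l,
    ← Finset.filter_erase, ← hC.sup_erase g]
  convert sup_filter_not_le h ((supp l).erase g)

/-- The class of `e_g`. -/
noncomputable abbrev bE (H : Finset α) (g : H) : BHat H := toBHat H (genE H g)

theorem bE_anticomm (H : Finset α) : Anticomm (bE H) := (genE_anticomm H).map (toBHat H)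

theorem toBHat_monE (l : List H) : toBHat H (monE H l) = (l.map (bE H)).prod := map_monE H _ l

theorem toBHat_boundary (l : List H) :
    toBHat H (boundary H (monE H l)) = wdel (fun _ => 1) (bE H) l := by
  rw [boundary_monE, map_wdel]; simp

theorem toBHat_algebraMap_mul (f : MvPolynomial H ℚ) (a : FreeAlg H) :
    toBHat H (algebraMap _ _ f * a) = f • toBHat H a := by
  rw [← Algebra.smul_def]; rfl

open Classical in
/-- The polynomial `∑ x_h` over all `h ∈ H` with `g ≤ h`. -/
noncomputable def abovePoly (H : Finset α) (g : α) : MvPolynomial H ℚ :=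
  ∑ h ∈ Finset.univ.filter (fun h : H => g ≤ (h : α)), MvPolynomial.X h

theorem algebraMap_abovePoly (H : Finset α) (g : α) :
    algebraMap (MvPolynomial H ℚ) (FreeAlg H) (abovePoly H g) = sumAbove H g := by
  rw [abovePoly, map_sum]; rfl

namespace IsPartialBuildingSet

variable (hH : IsPartialBuildingSet G H)
include hH

/-- A monomial whose support is not nested vanishes. -/
theorem monomial_eq_zero {W : Finset α} (hW : Bad H W) (l : List H) (T : Finset H)
    {f : MvPolynomial H ℚ} (hf : ∏ h ∈ T, MvPolynomial.X h ∣ f)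
    (hs : ∀ w ∈ W, w ∈ supp l ∨ ∃ h : w ∈ H, (⟨w, h⟩ : H) ∈ T) :
    f • (l.map (bE H)).prod = 0 := by
  obtain ⟨k, rfl⟩ := hf
  by_cases hl : l.Nodup
  · have h1 : ¬ IsNested H (l.toFinset ∪ T) := by
      refine (not_isNested_iff hH.bot_notMem _).2 ⟨W, fun w hw => ?_, hW.1, hW.2⟩
      rcases hs w hw with h | ⟨h, h'⟩
      · obtain ⟨h, h'⟩ := mem_supp.1 h
        exact ⟨h, by simp [h']⟩
      · exact ⟨h, by simp [h']⟩
    have h2 := (Relation.monomial l T hl h1).toBHat_eq_zero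
    rw [← toBHat_monE, mul_comm, mul_smul, ← toBHat_algebraMap_mul (∏ h ∈ T, _),
      Algebra.commutes]
    erw [h2]
    exact smul_zero _
  · rw [(bE_anticomm H).prod_eq_zero_of_not_nodup hl, smul_zero]

theorem monomial_eq_zero' {W : Finset α} (hW : Bad H W) (l : List H) (hs : W ⊆ supp l) :
    (l.map (bE H)).prod = 0 := by
  have := hH.monomial_eq_zero hW l ∅ (f := 1) (by simp) fun w hw => Or.inl (hs hw)
  rwa [one_smul] at this

theorem circuit_eq_zero {l : List H} (hl : l.Nodup) (hC : Circuit (supp l))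
    (ha : Avoids H ((supp l).sup id)) : wdel (fun _ => 1) (bE H) l = 0 := by
  rw [← toBHat_boundary]
  exact (Relation.circuit l hl (hH.nested_of_avoids _ ha)
    ((isBlowupCircuit_iff _).2 ⟨hC, ha⟩)).toBHat_eq_zero

theorem linear_eq_zero {g : α} (hg : IsAtom g) (a : BHat H) : abovePoly H g • a = 0 := by
  obtain ⟨a, rfl⟩ := toBHat_surjective H a
  rw [← toBHat_algebraMap_mul, algebraMap_abovePoly, map_mul,
    (Relation.linear g hg).toBHat_eq_zero, zero_mul]

/-- Dependent sets of atoms satisfy `∂ e_S = 0` and `e_S = 0`. -/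
theorem dependent_eq_zero [IsUpperModularLattice α] {l : List H} (hla : ∀ g ∈ l, IsAtom (g : α))
    (ha : Avoids H ((supp l).sup id)) (hd : ¬ (l.Nodup ∧ Indep (supp l))) :
    wdel (fun _ => 1) (bE H) l = 0 ∧ (l.map (bE H)).prod = 0 := by
  classical
  have hE := bE_anticomm H
  by_cases hl : l.Nodup
  · have hi : ¬ Indep (supp l) := fun h => hd ⟨hl, h⟩
    obtain ⟨C, hCl, hC⟩ := exists_circuit (fun a haa => by
      obtain ⟨_, h⟩ := mem_supp.1 haa; exact hla _ h) hi
    -- A circuit is moved to the front of the word; there `∂ e_C = 0`, hence also `e_C = e_c ∂ e_C =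
    -- 0`, and the Leibniz rule finishes.
    let l₁ := l.filter fun g : H => (g : α) ∈ C
    let l₂ := l.filter fun g : H => ¬ (g : α) ∈ C
    have hp : l.Perm (l₁ ++ l₂) := by
      have := (List.filter_append_perm (fun g : H => decide ((g : α) ∈ C)) l).symm
      simpa [l₁, l₂] using this
    have hs : supp l₁ = C := by
      rw [supp_filter (· ∈ C) l]
      exact Finset.filter_mem_eq_inter.trans (Finset.inter_eq_right.2 hCl)
    have h1 : wdel (fun _ => 1) (bE H) l₁ = 0 :=
      hH.circuit_eq_zero (hl.filter _) (hs ▸ hC) (ha.mono (Finset.sup_mono (hs.trans_subset hCl)))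
    have h2 : (l₁.map (bE H)).prod = 0 := by
      cases hl₁ : l₁ with
      | nil =>
        rw [hl₁] at hs
        obtain ⟨c, hc⟩ := hC.nonempty
        rw [← hs] at hc; simp [supp] at hc
      | cons g k => rw [← hE.mul_wdel_cons, ← hl₁, h1, mul_zero]
    constructor
    · refine hE.wdel_eq_zero_of_perm (by simp) hp ?_
      rw [wdel_append, h1, h2]; simp
    · refine hE.prod_eq_zero_of_perm hp ?_
      rw [List.map_append, List.prod_append, h2, zero_mul]
  · exact ⟨hE.wdel_eq_zero_of_not_nodup (by simp) hl, hE.prod_eq_zero_of_not_nodup hl⟩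

end IsPartialBuildingSet

end Vanishing

end Leray
namespace Leray

universe u v

variable {α : Type u} [Lattice α] [BoundedOrder α] [Fintype α] [DecidableEq α] {G H : Finset α}

/-! ### The differential descends to `BHat`. -/

section Differential

variable (hH : IsPartialBuildingSet G H)
include hH

-- The list form of `bad_circuit`. The letters come from a separate set `H₂`, because the bad set
-- may live in `H ∪ {p}` while the word is over `H`.
open Classical in
theorem IsPartialBuildingSet.bad_of_circuit_list [IsUpperModularLattice α] {H₂ : Finset α} {l : List H₂}
    (hl : l.Nodup) (hC : Circuit (supp l)) {h : α} (hh : h ∈ H) (hha : ¬ IsAtom h)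
    {c : H₂} (hc : c ∈ l) (hch : (c : α) ≤ h) {l₁ l₂ : List H₂} {g : H₂}
    (hs : l.filter (fun c : H₂ => ¬ (c : α) ≤ h) = l₁ ++ g :: l₂) :
    Bad H (insert h (supp (l₁ ++ l₂))) := by
  have hg : g ∈ l.filter (fun c : H₂ => ¬ (c : α) ≤ h) := by rw [hs]; simp
  refine hH.bad_circuit hC hh hha (coe_mem_supp.2 hc) hch
    (coe_mem_supp.2 (List.mem_of_mem_filter hg)) (by simpa using (List.mem_filter.1 hg).2)
    (circuit_list_sup hl hC h hs) fun a ha => ?_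
  obtain ⟨haH, ha'⟩ := mem_supp.1 ha
  have : (⟨a, haH⟩ : H₂) ∈ l.filter (fun c : H₂ => ¬ (c : α) ≤ h) := by
    rw [hs]; simp only [List.mem_append, List.mem_cons] at ha' ⊢; tauto
  exact hC.atom a (coe_mem_supp.2 (List.mem_of_mem_filter this))

/-- Split the circuit into the part `A` below `h` and the rest `D`. The weighted derivative is `∂
e_A · e_D`, and its boundary is `± ∂ e_A · ∂ e_D`. If `A` is empty then `∂ e_A = 0`; otherwise every
term of `x_h ∂ e_D` has a non-nested support. -/
theorem IsPartialBuildingSet.genX_smul_wdel [IsUpperModularLattice α] {l : List H}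
    (hl : l.Nodup) (hC : Circuit (supp l)) {h : H} (hha : ¬ IsAtom (h : α)) :
    toBHat H (boundary H (wdel (fun g : H => genX H h *
      (open Classical in if (g : α) ≤ h then 1 else 0)) (genE H) l)) = 0 := by
  classical
  let P : H → Prop := fun g => (g : α) ≤ h
  rw [wdel_mul_left _ (genX_comm H h)]
  have hb : ∀ a, toBHat H (boundary H (genX H h * a)) =
      (MvPolynomial.X h : MvPolynomial H ℚ) • toBHat H (boundary H a) := by
    intro a
    rw [← toBHat_algebraMap_mul]
    exact congrArg _ (antiderivation_algebraMap_mul H _ _ a)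
  rw [hb]
  have hp : l.Perm (l.filter P ++ l.filter fun g => ¬ P g) := by
    have := (List.filter_append_perm (fun g : H => decide (P g)) l).symm
    simpa using this
  have key : (MvPolynomial.X h : MvPolynomial H ℚ) • toBHat H (boundary H
      (wdel (fun g : H => if P g then 1 else 0) (genE H)
        (l.filter P ++ l.filter fun g => ¬ P g))) = 0 := by
    rw [wdel_indicator_append P _ _ _ (fun g hg => by simpa using (List.mem_filter.1 hg).2)
      (fun g hg => by simpa using (List.mem_filter.1 hg).2), boundary_wdel_mul, ← monE]
    rcases hlp : l.filter P with _ | ⟨c, lp⟩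
    · rw [hlp]; simp
    · have hc : c ∈ l.filter P := by rw [hlp]; simp
      have h0 : wdel (fun _ => 1) (bE H) (l.filter fun g => ¬ P g) ∈
          LinearMap.ker (LinearMap.lsmul (MvPolynomial H ℚ) (BHat H) (MvPolynomial.X h)) := by
        have := wdel_mem (w := fun _ => (1 : BHat H)) (E := bE H) (by simp) (LinearMap.ker
          (LinearMap.lsmul (MvPolynomial H ℚ) (BHat H) (MvPolynomial.X h))) []
          (l.filter fun g => ¬ P g) fun l₁ g l₂ hs => ?_
        · simpa using this
        · rw [LinearMap.mem_ker, LinearMap.lsmul_apply, one_mul]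
          refine hH.monomial_eq_zero (hH.bad_of_circuit_list hl hC h.2 hha
            (List.mem_of_mem_filter hc) (by simpa [P] using (List.mem_filter.1 hc).2) hs) _ {h}
            (by simp) fun w hw => ?_
          rcases Finset.mem_insert.1 hw with rfl | hw
          · exact Or.inr ⟨h.2, by simp⟩
          · exact Or.inl hw
      rw [LinearMap.mem_ker, LinearMap.lsmul_apply] at h0
      rw [map_mul, map_mul, toBHat_boundary, ← mul_smul_comm, ← mul_smul_comm, h0]
      simp
  rcases (genE_anticomm H).wdel_perm (w := fun g : H => if P g then (1 : FreeAlg H) else 0)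
    (fun g a => by split_ifs <;> simp) hp with h1 | h1
  · rw [h1.2]; exact key
  · rw [h1.2, map_neg, map_neg, smul_neg, key, neg_zero]

/-- For monomials `d` trades a letter `e_g` for `x_g`, so the bad set stays in the support. For
circuits `d ∂ = -∂ d`, and modulo the linear relations `d e_C` only involves the `x_h` of non-atoms
`h`. -/
theorem IsPartialBuildingSet.toBHat_differential_relation [IsUpperModularLattice α]
    {r : FreeAlg H} (hr : Relation H r) : toBHat H (differential H r) = 0 := by
  classical
  cases hr with
  | monomial l T hl h =>
    obtain ⟨W, hW, hs, hn⟩ := (not_isNested_iff hH.bot_notMem _).1 h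
    have h1 : differential H (monE H l * monX H T) =
        algebraMap (MvPolynomial H ℚ) (FreeAlg H) (∏ h ∈ T, MvPolynomial.X h) * wdel (genX H) (genE H) l := by
      have : monE H l * monX H T =
          algebraMap (MvPolynomial H ℚ) (FreeAlg H) (∏ h ∈ T, MvPolynomial.X h) * monE H l :=
        (Algebra.commutes _ _).symm
      rw [this, ← differential_monE]
      exact antiderivation_algebraMap_mul H _ _ _
    rw [h1, toBHat_algebraMap_mul, map_wdel]
    have := wdel_mem (w := fun g => toBHat H (genX H g)) (E := bE H) (fun g a => by
      obtain ⟨a, rfl⟩ := toBHat_surjective H a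
      rw [← map_mul, genX_comm, map_mul]) (LinearMap.ker
        (LinearMap.lsmul (MvPolynomial H ℚ) (BHat H) (∏ h ∈ T, MvPolynomial.X h))) [] l
        fun l₁ g l₂ hl' => ?_
    · simpa using this
    · rw [LinearMap.mem_ker, LinearMap.lsmul_apply]
      have : ∀ a : BHat H, toBHat H (genX H g) * a =
          (MvPolynomial.X g : MvPolynomial H ℚ) • a := fun a => by
        obtain ⟨a, rfl⟩ := toBHat_surjective H a
        rw [← map_mul]; exact toBHat_algebraMap_mul _ _
      rw [this, smul_smul]
      refine hH.monomial_eq_zero ⟨hs, hn⟩ _ (insert g T) ?_ fun w hw => ?_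
      · by_cases hg : g ∈ T
        · rw [Finset.insert_eq_of_mem hg]; exact dvd_mul_right _ _
        · rw [Finset.prod_insert hg, mul_comm]
      · obtain ⟨hwH, hw'⟩ := hW w hw
        simp only [Finset.mem_union, List.mem_toFinset, hl', List.mem_append, List.mem_cons] at hw'
        simp only [mem_supp, List.nil_append, List.mem_append, Finset.mem_insert]
        rcases hw' with (h | h | h) | h
        · exact Or.inl ⟨hwH, Or.inl h⟩
        · exact Or.inr ⟨hwH, Or.inl h⟩
        · exact Or.inl ⟨hwH, Or.inr h⟩
        · exact Or.inr ⟨hwH, Or.inr h⟩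
  | circuit l hl hn hc =>
    obtain ⟨hC, ha⟩ := (isBlowupCircuit_iff _).1 hc
    have hC' : Circuit (supp l) := hC
    have hla : ∀ g ∈ l, IsAtom (g : α) := fun g hg => hC'.atom _ (coe_mem_supp.2 hg)
    have h1 : differential H (boundary H (monE H l)) =
        -boundary H (wdel (genX H) (genE H) l) := by
      rw [← differential_monE]; exact antiderivation_comm H _ _ _
    -- The only atom above the atom `g` is `g`, so `x_g` is the linear relation of `g` minus the
    -- `x_h` over the non-atoms `h` above `g`.
    have h2 : wdel (genX H) (genE H) l = wdel (fun g : H => sumAbove H (g : α) -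
        ∑ h ∈ Finset.univ.filter (fun h : H => ¬ IsAtom (h : α)),
          genX H h * (if (g : α) ≤ h then 1 else 0)) (genE H) l := by
      refine wdel_congr (fun g hg => ?_) fun _ _ => rfl
      rw [eq_sub_iff_add_eq, sumAbove]
      simp only [mul_ite, mul_one, mul_zero]
      rw [← Finset.sum_filter, Finset.filter_filter]
      have : Finset.univ.filter (fun h : H => (g : α) ≤ h) = insert g
          (Finset.univ.filter (fun h : H => ¬ IsAtom (h : α) ∧ (g : α) ≤ h)) := by
        ext h
        simp only [Finset.mem_filter, Finset.mem_univ, true_and, Finset.mem_insert]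
        constructor
        · intro hgh
          by_cases hha : IsAtom (h : α)
          · exact Or.inl (Subtype.ext (((hha.le_iff.1 hgh).resolve_left
              (hla g hg).1).symm))
          · exact Or.inr ⟨hha, hgh⟩
        · rintro (rfl | h)
          · exact le_rfl
          · exact h.2
      rw [this, Finset.sum_insert]
      simp [hla g hg]
    rw [h1, h2, wdel_sub, wdel_sum, map_neg, map_sub, map_sub, map_sum, map_sum,
      Finset.sum_eq_zero fun h hh => ?_, sub_zero, neg_eq_zero]
    · have hcent : ∀ (g : H) a, sumAbove H (g : α) * a = a * sumAbove H (g : α) := by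
        intro g a; rw [← algebraMap_abovePoly]; exact Algebra.commutes _ _
      have := wdel_mem (w := fun g : H => sumAbove H (g : α)) (E := genE H) hcent
        (AddMonoidHom.ker ((toBHat H : FreeAlg H →+ BHat H).comp
          (boundary H : FreeAlg H →+ FreeAlg H))) [] l fun l₁ g l₂ hl' => ?_
      · simpa [AddMonoidHom.mem_ker] using this
      · rw [AddMonoidHom.mem_ker]
        have hb := antiderivation_algebraMap_mul H (fun _ => 1) (abovePoly H (g : α))
          ((([] ++ l₁ ++ l₂).map (genE H)).prod)
        rw [algebraMap_abovePoly] at hb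
        refine (congrArg (toBHat H) hb).trans ?_
        rw [map_mul, (Relation.linear (g : α) (hla g (by simp [hl']))).toBHat_eq_zero, zero_mul]
    · convert hH.genX_smul_wdel hl hC' (h := h) (by simpa using hh)
  | linear g hg =>
    rw [← algebraMap_abovePoly]
    have : differential H (algebraMap _ _ (abovePoly H g)) = 0 :=
      CliffordAlgebra.contractLeft_algebraMap _ _ _
    rw [this, map_zero]

theorem IsPartialBuildingSet.toBHat_differential [IsUpperModularLattice α]
    {a : FreeAlg H} (ha : a ∈ relIdeal H) : toBHat H (differential H a) = 0 := by
  rw [relIdeal_eq] at ha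
  induction ha using Submodule.span_induction with
  | mem r hr => exact hH.toBHat_differential_relation hr
  | zero => simp
  | add x y _ _ hx hy => rw [map_add, map_add, hx, hy, add_zero]
  | smul u x hx' hx =>
    have hx0 : toBHat H x = 0 := toBHat_eq_zero_iff.2 (by rw [relIdeal_eq]; exact hx')
    rw [smul_eq_mul]
    induction FreeAlg.mem_span H u using Submodule.span_induction with
    | mem u hu =>
      obtain ⟨l, rfl⟩ := hu
      have := antiderivation_monE_mul H MvPolynomial.X l x
      rw [differential, this, map_add, map_mul, map_mul, map_mul, hx0]
      rw [← differential, hx]; simp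
    | zero => simp
    | add u v _ _ hu hv => rw [add_mul, map_add, map_add, hu, hv, add_zero]
    | smul c u _ hu =>
      rw [smul_mul_assoc, map_smul, Algebra.smul_def, toBHat_algebraMap_mul, hu, smul_zero]

end Differential

end Leray
namespace Leray

universe u v

variable {α : Type u} [Lattice α] [BoundedOrder α] [Fintype α] [DecidableEq α] {G H : Finset α}

/-! ### Words in even and odd letters. -/

section Words

/-- The generator named by a letter. -/
noncomputable def letterGen (H : Finset α) : H ⊕ H → FreeAlg H := Sum.elim (genE H) (genX H)

/-- The element of `H` named by a letter. -/
def letterVal (s : H ⊕ H) : α := Sum.elim Subtype.val Subtype.val s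

/-- Even letters may repeat after the substitution, so of the polynomial coefficient only its
divisibility by the squarefree monomial of its letters is retained. -/
theorem exists_word_eq (w : List (H ⊕ H)) : ∃ (l : List H) (T : Finset H) (f : MvPolynomial H ℚ),
    (w.map (letterGen H)).prod = algebraMap _ _ f * monE H l ∧
    ∏ h ∈ T, MvPolynomial.X h ∣ f ∧
    ∀ s ∈ w, letterVal s ∈ supp l ∨ ∃ h : letterVal s ∈ H, (⟨letterVal s, h⟩ : H) ∈ T := by
  induction w with
  | nil => exact ⟨[], ∅, 1, by simp, by simp, by simp⟩
  | cons s w ih =>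
    obtain ⟨l, T, f, h1, h2, h3⟩ := ih
    rcases s with g | g
    · refine ⟨g :: l, T, f, ?_, h2, fun s hs => ?_⟩
      · rw [List.map_cons, List.prod_cons, h1, monE_cons, ← mul_assoc, ← mul_assoc]
        congr 1
        exact (Algebra.commutes f (genE H g)).symm
      · rcases List.mem_cons.1 hs with rfl | hs
        · exact Or.inl (by rw [supp_cons]; exact Finset.mem_insert_self _ _)
        · refine (h3 s hs).imp_left fun h => ?_
          rw [supp_cons]; exact Finset.mem_insert_of_mem h
    · refine ⟨l, insert g T, MvPolynomial.X g * f, ?_, ?_, fun s hs => ?_⟩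
      · rw [List.map_cons, List.prod_cons, h1, map_mul, mul_assoc]; rfl
      · by_cases hg : g ∈ T
        · rw [Finset.insert_eq_of_mem hg]; exact h2.mul_left _
        · rw [Finset.prod_insert hg]; exact mul_dvd_mul_left _ h2
      · rcases List.mem_cons.1 hs with rfl | hs
        · exact Or.inr ⟨g.2, Finset.mem_insert_self _ _⟩
        · exact (h3 s hs).imp_right fun ⟨h, h'⟩ => ⟨h, Finset.mem_insert_of_mem h'⟩

theorem IsPartialBuildingSet.word_eq_zero (hH : IsPartialBuildingSet G H) {W : Finset α}
    (hW : Bad H W) (w : List (H ⊕ H)) (hw : ∀ v ∈ W, ∃ s ∈ w, letterVal s = v) :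
    toBHat H (w.map (letterGen H)).prod = 0 := by
  obtain ⟨l, T, f, h1, h2, h3⟩ := exists_word_eq w
  rw [h1, toBHat_algebraMap_mul, toBHat_monE]
  refine hH.monomial_eq_zero hW l T h2 fun v hv => ?_
  obtain ⟨s, hs, rfl⟩ := hw v hv
  exact h3 s hs

end Words

/-! ### The homomorphism on the free algebras. -/

section Extend

variable (p : α)

/-- The inclusion `H → H ∪ {p}`. -/
def inc (H : Finset α) (g : H) : ↥(insert p H) := ⟨g, Finset.mem_insert_of_mem g.2⟩

/-- The new element of `H ∪ {p}`. -/
def pt (H : Finset α) : ↥(insert p H) := ⟨p, Finset.mem_insert_self p H⟩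

theorem supp_map_inc (l : List H) : supp (l.map (inc p H)) = supp l := by
  ext w
  simp only [mem_supp, List.mem_map]
  constructor
  · rintro ⟨_, g, hg, e⟩
    have : (g : α) = w := congrArg Subtype.val e
    subst this
    exact ⟨g.2, hg⟩
  · rintro ⟨h, hw⟩
    exact ⟨Finset.mem_insert_of_mem h, _, hw, rfl⟩

theorem inc_injective : Function.Injective (inc p H) := fun g h e =>
  Subtype.ext (congrArg (fun x : ↥(insert p H) => (x : α)) e)

theorem eq_pt_or_inc (g : ↥(insert p H)) : g = pt p H ∨ ∃ h : H, g = inc p H h := by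
  rcases Finset.mem_insert.1 g.2 with h | h
  · exact Or.inl (Subtype.ext h)
  · exact Or.inr ⟨⟨g, h⟩, rfl⟩

theorem sum_insert_coe {N : Type*} [AddCommMonoid N] {p : α} (hp : p ∉ H)
    (F : ↥(insert p H) → N) : ∑ h, F h = F (pt p H) + ∑ h, F (inc p H h) := by
  have : (Finset.univ : Finset ↥(insert p H)) =
      insert (pt p H) (Finset.univ.map ⟨inc p H, inc_injective p⟩) := by
    ext g
    simp only [Finset.mem_univ, Finset.mem_insert, Finset.mem_map, true_and,
      Function.Embedding.coeFn_mk, true_iff]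
    exact (eq_pt_or_inc p g).imp_right fun ⟨h, e⟩ => ⟨h, e.symm⟩
  rw [this, Finset.sum_insert, Finset.sum_map]
  · rfl
  · simp only [Finset.mem_map, Finset.mem_univ, true_and, not_exists]
    intro g e
    have : (g : α) = p := congrArg (fun x : ↥(insert p H) => (x : α)) e
    exact hp (this ▸ g.2)

open Classical in
/-- The homomorphism `R(H) → R(H ∪ {p})` with `e_g ↦ e_g + e_p`, `x_g ↦ x_g + x_p` for `g ≤ p`. -/
noncomputable def extend (H : Finset α) : FreeAlg H →ₐ[ℚ] FreeAlg (insert p H) :=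
  FreeAlg.lift H
    (fun g => genE _ (inc p H g) + if (g : α) ≤ p then genE _ (pt p H) else 0)
    (fun g => genX _ (inc p H g) + if (g : α) ≤ p then genX _ (pt p H) else 0)
    (fun g h => by
      have := genE_anticomm (insert p H)
      dsimp only
      split_ifs <;>
      simp only [mul_add, add_mul, add_zero, neg_add, this (inc p H g) (inc p H h),
        this (inc p H g) (pt p H), this (pt p H) (inc p H h), (this.sq_eq_zero (pt p H))] <;> abel)
    (fun g a => by split_ifs <;> simp [mul_add, add_mul, genX_comm _ _ a])

open Classical in
theorem extend_genE (g : H) : extend p H (genE H g) =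
    genE _ (inc p H g) + if (g : α) ≤ p then genE _ (pt p H) else 0 :=
  FreeAlg.lift_genE ..

open Classical in
theorem extend_genX (g : H) : extend p H (genX H g) =
    genX _ (inc p H g) + if (g : α) ≤ p then genX _ (pt p H) else 0 :=
  FreeAlg.lift_genX ..

/-- The relation between the letters of a monomial of `R(H)` and the letters of a term of its
image in `R(H ∪ {p})`. -/
inductive LetterStep (H : Finset α) : H ⊕ H → (↥(insert p H)) ⊕ (↥(insert p H)) → Prop
  | same (s : H ⊕ H) : LetterStep H s (s.map (inc p H) (inc p H))
  | change (s : H ⊕ H) (h : letterVal s ≤ p) :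
      LetterStep H s (s.map (fun _ => pt p H) (fun _ => pt p H))

/-- Multiplying out the image of a word gives the words in which each letter below `p` is kept or
replaced by `p`; `u` is the prefix already multiplied out. -/
theorem extend_word_mem (I : AddSubgroup (FreeAlg (insert p H))) (w : List (H ⊕ H))
    (u : List (↥(insert p H) ⊕ ↥(insert p H)))
    (h : ∀ w', List.Forall₂ (LetterStep p H) w w' →
      ((u ++ w').map (letterGen (insert p H))).prod ∈ I) :
    (u.map (letterGen (insert p H))).prod * extend p H (w.map (letterGen H)).prod ∈ I := by
  classical
  induction w generalizing u with
  | nil => simpa using h [] List.Forall₂.nil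
  | cons s w ih =>
    have h1 := ih (u ++ [s.map (inc p H) (inc p H)]) fun w' hw' => by
      simpa using h (_ :: w') (List.Forall₂.cons (LetterStep.same s) hw')
    have hs : extend p H (letterGen H s) = letterGen _ (s.map (inc p H) (inc p H)) +
        if letterVal s ≤ p then letterGen _ (s.map (fun _ => pt p H) (fun _ => pt p H)) else 0 := by
      rcases s with g | g
      · exact extend_genE p g
      · exact extend_genX p g
    rw [List.map_cons, List.prod_cons, map_mul, hs, add_mul, mul_add]
    refine add_mem ?_ ?_
    · simpa [mul_assoc] using h1
    · split_ifs with hsp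
      · have h2 := ih (u ++ [s.map (fun _ => pt p H) (fun _ => pt p H)]) fun w' hw' => by
          simpa using h (_ :: w') (List.Forall₂.cons (LetterStep.change s hsp) hw')
        simpa [mul_assoc] using h2
      · simp

end Extend

/-! ### The homomorphism respects the relations. -/

section Step

variable {p : α} (hp : p ∉ H) (hH : IsPartialBuildingSet G H)
  (hH' : IsPartialBuildingSet G (insert p H))
include hp hH hH'

theorem not_isAtom_new : ¬ IsAtom p := fun h => hp (hH.atom_mem p h)

/-- A non-atom of `H` below `p` would force `p ∈ H` by upward closure. -/
theorem isAtom_of_le_new {h : α} (hh : h ∈ H) (hle : h ≤ p) : IsAtom h := by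
  by_contra ha
  exact hp (hH.mem_of_le hh ha (hH'.subset (Finset.mem_insert_self p H)) hle)

theorem mem_of_gt_new {g : α} (hg : g ∈ G) (hle : p ≤ g) (hne : g ≠ p) : g ∈ H :=
  (Finset.mem_insert.1 (hH'.mem_of_le (Finset.mem_insert_self p H)
    (not_isAtom_new hp hH hH') hg hle)).resolve_left hne

theorem sup_new_mem {g : α} (hg : g ∈ G) (h : p ⊓ g ≠ ⊥) (hne : ¬ g ≤ p) : p ⊔ g ∈ H :=
  mem_of_gt_new hp hH hH' (hH.isBuildingSet.sup_mem (hH'.subset (Finset.mem_insert_self p H)) hg h)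
    le_sup_left fun e => hne (sup_eq_left.1 e)

/-- Write `q` for the join. If `q ≤ p`, then `q` is an atom, hence equal to `w ∈ W`, against
badness. So `q` meets `p` in at least `w` without lying below it, and `p ⊔ q` is an element of `G`
strictly above `p`. -/
theorem bad_meets_new {W : Finset α} (hW : Bad (insert p H) W) (hWH : W ⊆ insert p H)
    (hne : W.sup id ≠ p) {w : α} (hw : w ∈ W) (hwp : w ≤ p) :
    ¬ W.sup id ≤ p ∧ p ⊔ W.sup id ∈ H ∧ p ⊔ W.sup id ∉ W := by
  have hq : W.sup id ∈ H := (Finset.mem_insert.1 hW.1).resolve_left hne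
  have hwq : w ≤ W.sup id := Finset.le_sup (f := id) hw
  have hw0 : w ≠ ⊥ := hH'.ne_bot (hWH hw)
  have h1 : ¬ W.sup id ≤ p := fun hle => by
    rcases (isAtom_of_le_new hp hH hH' hq hle).le_iff.1 hwq with h | h
    · exact hw0 h
    · exact hW.2 (h ▸ hw)
  refine ⟨h1, sup_new_mem hp hH hH' (hH.subset hq) (fun e => hw0 ?_) h1, fun h2 => ?_⟩
  · exact le_bot_iff.1 (e ▸ le_inf hwp hwq)
  · have h3 : p ⊔ W.sup id = W.sup id :=
      le_antisymm (Finset.le_sup (f := id) h2) le_sup_right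
    exact hW.2 (h3 ▸ h2)

open Classical in
theorem bad_change {W : Finset α} (hW : Bad H W) (hWH : W ⊆ H) {w : α} (hw : w ∈ W)
    (hwp : w ≤ p) : Bad (insert p H) (insert p (W.filter fun v => ¬ v ≤ p)) := by
  obtain ⟨h1, h2, h3⟩ := bad_meets_new hp hH hH' (W := W) ⟨Finset.mem_insert_of_mem hW.1, hW.2⟩
    (hWH.trans (Finset.subset_insert p H)) (fun e => hp (e ▸ hW.1)) hw hwp
  have hs : (insert p (W.filter fun v => ¬ v ≤ p)).sup id = p ⊔ W.sup id := by
    rw [Finset.sup_insert, id, sup_filter_not_le]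
  refine ⟨hs ▸ Finset.mem_insert_of_mem h2, ?_⟩
  rw [hs, Finset.mem_insert]
  rintro (e | e)
  · exact h1 (sup_eq_left.1 e)
  · exact h3 (Finset.mem_of_mem_filter _ e)

theorem extend_monomial (l : List H) (T : Finset H) (h : ¬ IsNested H (l.toFinset ∪ T)) :
    toBHat (insert p H) (extend p H (monE H l * monX H T)) = 0 := by
  classical
  obtain ⟨W, hW, hs, hn⟩ := (not_isNested_iff hH.bot_notMem _).1 h
  let w : List (H ⊕ H) := l.map Sum.inl ++ T.toList.map Sum.inr
  have hw : (w.map (letterGen H)).prod = monE H l * monX H T := by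
    simp only [w, List.map_append, List.prod_append, List.map_map]
    congr 1
    rw [monX, ← Finset.prod_map_toList, map_list_prod, List.map_map]
    rfl
  have hmem := extend_word_mem p (AddMonoidHom.ker (toBHat (insert p H) :
    FreeAlg (insert p H) →+ BHat (insert p H))) w []
    fun w' hw' => ?_
  · rw [hw] at hmem
    simpa [AddMonoidHom.mem_ker] using hmem
  · rw [AddMonoidHom.mem_ker]
    have hWw : ∀ v ∈ W, ∃ s ∈ w, letterVal s = v := by
      intro v hv
      obtain ⟨hvH, h'⟩ := hW v hv
      rcases Finset.mem_union.1 h' with h' | h'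
      · exact ⟨Sum.inl ⟨v, hvH⟩, by simpa [w] using h', rfl⟩
      · exact ⟨Sum.inr ⟨v, hvH⟩, by simpa [w] using h', rfl⟩
    have hstep : ∀ s ∈ w, ∃ s' ∈ w', LetterStep p H s s' := by
      intro s hs'
      obtain ⟨i, hi, rfl⟩ := List.mem_iff_getElem.1 hs'
      exact ⟨w'[i]'(hw'.length_eq ▸ hi), List.getElem_mem _, hw'.get _ _⟩
    have hstep' : ∀ v ∈ W, (∃ s' ∈ w', letterVal s' = v) ∨ (v ≤ p ∧ ∃ s' ∈ w', letterVal s' = p) := by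
      intro v hv
      obtain ⟨s, hs', rfl⟩ := hWw v hv
      obtain ⟨s', hs'', h'⟩ := hstep s hs'
      cases h' with
      | same => exact Or.inl ⟨_, hs'', by rcases s with g | g <;> rfl⟩
      | change hle => exact Or.inr ⟨hle, _, hs'', by rcases s with g | g <;> rfl⟩
    have hWH : W ⊆ H := fun v hv => (hW v hv).1
    rw [List.nil_append]
    by_cases hall : ∀ v ∈ W, ∃ s' ∈ w', letterVal s' = v
    · exact hH'.word_eq_zero ⟨Finset.mem_insert_of_mem hs, hn⟩ w' hall
    -- Some element of `W` has lost its letters, so a letter below `p` became `p`; now `p` and the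
    -- part of `W` not below `p` form a bad set.
    · push Not at hall
      obtain ⟨v, hv, hv'⟩ := hall
      obtain ⟨hvp, hpw⟩ := (hstep' v hv).resolve_left fun ⟨s', h1, h2⟩ => hv' s' h1 h2
      refine hH'.word_eq_zero (bad_change hp hH hH' ⟨hs, hn⟩ hWH hv hvp) w' fun x hx => ?_
      rcases Finset.mem_insert.1 hx with rfl | hx
      · exact hpw
      · obtain ⟨hx1, hx2⟩ := Finset.mem_filter.1 hx
        exact (hstep' x hx1).resolve_right fun h => hx2 h.1

/-- Among the elements of `H` above `g` only `g` itself can lie below `p`, so `x_p` is added exactly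
once if `g ≤ p` and never otherwise. -/
theorem extend_linear (g : α) (hg : IsAtom g) :
    extend p H (sumAbove H g) = sumAbove (insert p H) g := by
  classical
  unfold sumAbove
  rw [Finset.sum_filter, Finset.sum_filter, sum_insert_coe hp, map_sum]
  have h1 : ∀ h : H, extend p H (if g ≤ (h : α) then genX H h else 0) =
      (if g ≤ ((inc p H h : ↥(insert p H)) : α) then genX _ (inc p H h) else 0) +
      if h = ⟨g, hH.atom_mem g hg⟩ then (if g ≤ p then genX _ (pt p H) else 0) else 0 := by
    intro h
    have hinc : ((inc p H h : ↥(insert p H)) : α) = h := rfl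
    rw [hinc]
    by_cases hgh : g ≤ h
    · rw [if_pos hgh, if_pos hgh, extend_genX]
      congr 1
      by_cases hgp : h = ⟨g, hH.atom_mem g hg⟩
      · rw [if_pos hgp, hgp]
      · rw [if_neg hgp, if_neg]
        intro hhp
        have := (isAtom_of_le_new hp hH hH' h.2 hhp).le_iff.1 hgh
        exact hgp (Subtype.ext (this.resolve_left hg.1).symm)
    · rw [if_neg hgh, if_neg hgh, map_zero, if_neg, add_zero]
      rintro rfl; exact hgh le_rfl
  rw [Finset.sum_congr rfl fun h _ => h1 h, Finset.sum_add_distrib, Finset.sum_ite_eq',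
    if_pos (Finset.mem_univ _), add_comm]
  rfl

/-- Otherwise the join would be an element of `G` strictly above `p`, thus a non-atom of `H`,
contrary to `Avoids`. -/
theorem eq_new_of_le_sup_circuit [IsUpperModularLattice α] {C : Finset α} (hC : Circuit C)
    (ha : Avoids H (C.sup id)) (hle : p ≤ C.sup id) : C.sup id = p := by
  by_contra hne
  refine ha _ (mem_of_gt_new hp hH hH' (hH.circuit_sup_mem hC) hle hne) (fun hat => ?_) le_rfl
  rcases hat.le_iff.1 hle with h | h
  · exact hH'.ne_bot (Finset.mem_insert_self p H) h
  · exact hne h.symm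

/-- With `A` the part of the circuit below `p` and `D` the rest, the image of `∂ e_C` is, up to
sign, `∂ e_C ± e_p ∂ e_A ∂ e_D`; each summand vanishes. -/
theorem extend_circuit [IsUpperModularLattice α] {l : List H} (hl : l.Nodup)
    (hC : Circuit (supp l)) (ha : Avoids H ((supp l).sup id)) :
    toBHat (insert p H) (extend p H (boundary H (monE H l))) = 0 := by
  classical
  have hpa := not_isAtom_new hp hH hH'
  have hpH' := Finset.mem_insert_self p H
  have hE := bE_anticomm (insert p H)
  let e : H → BHat (insert p H) := fun g => bE _ (inc p H g)
  let ε : BHat (insert p H) := bE _ (pt p H)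
  let F : H → BHat (insert p H) := fun g => toBHat (insert p H) (extend p H (genE H g))
  have hF : Anticomm F := ((genE_anticomm H).map (extend p H)).map (toBHat (insert p H))
  have hF1 : ∀ g : H, (g : α) ≤ p → F g = e g + ε := fun g hg => by
    simp only [F, extend_genE, if_pos hg, map_add]; rfl
  have hF2 : ∀ g : H, ¬ (g : α) ≤ p → F g = e g := fun g hg => by
    simp only [F, extend_genE, if_neg hg, add_zero]; rfl
  have hgoal : toBHat (insert p H) (extend p H (boundary H (monE H l))) =
      wdel (fun _ => 1) F l := by
    rw [boundary_monE, map_wdel, map_wdel]; simp [F]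
  rw [hgoal]
  let P : H → Prop := fun g => (g : α) ≤ p
  have hperm : l.Perm (l.filter P ++ l.filter fun g => ¬ P g) := by
    have := (List.filter_append_perm (fun g : H => decide (P g)) l).symm
    simpa using this
  refine hF.wdel_eq_zero_of_perm (by simp) hperm ?_
  set lp := l.filter P with hlp
  set lv := l.filter (fun g => ¬ P g) with hlv
  have hP : ∀ g ∈ lp, (g : α) ≤ p := fun g hg => by simpa [P] using (List.mem_filter.1 hg).2
  have hV : ∀ g ∈ lv, ¬ (g : α) ≤ p := fun g hg => by simpa [P] using (List.mem_filter.1 hg).2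
  have hadd := prod_wdel_add (E := e) (ε := ε) (hE.sq_eq_zero _) (fun g => hE _ _) lp
  have hFp : (lp.map F).prod = (lp.map e).prod + ε * wdel (fun _ => 1) e lp := by
    rw [← hadd.1]; exact congrArg List.prod (List.map_congr_left fun g hg => hF1 g (hP g hg))
  have hFw : wdel (fun _ => 1) F lp = wdel (fun _ => 1) e lp := by
    rw [← hadd.2]; exact wdel_congr (fun _ _ => rfl) fun g hg => hF1 g (hP g hg)
  have hFv : (lv.map F).prod = (lv.map e).prod :=
    congrArg List.prod (List.map_congr_left fun g hg => hF2 g (hV g hg))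
  have hFvw : wdel (fun _ => 1) F lv = wdel (fun _ => 1) e lv :=
    wdel_congr (fun _ _ => rfl) fun g hg => hF2 g (hV g hg)
  have h1 : wdel (fun _ => 1) e (lp ++ lv) = 0 := by
    rw [← wdel_map (fun _ => 1) (bE (insert p H)) (inc p H)]
    have hs : supp ((lp ++ lv).map (inc p H)) = supp l := by
      rw [supp_map_inc, ← supp_perm hperm]
    have hnd : ((lp ++ lv).map (inc p H)).Nodup :=
      (hperm.nodup_iff.1 hl).map (inc_injective p)
    -- Either the circuit is still bounded in the new blowup, or its join is `p`; in that case every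
    -- term of `∂ e_C` is a monomial with join `p`, not nested in `H ∪ {p}`.
    by_cases hle : p ≤ (supp l).sup id
    · have hsup := eq_new_of_le_sup_circuit hp hH hH' hC ha hle
      have := wdel_mem (w := fun _ => (1 : BHat (insert p H))) (E := bE (insert p H)) (by simp)
        (⊥ : AddSubgroup (BHat (insert p H))) [] ((lp ++ lv).map (inc p H)) fun l₁ g l₂ hs' => ?_
      · simpa [AddSubgroup.mem_bot] using this
      · rw [AddSubgroup.mem_bot, one_mul]
        have hsupp : supp (l₁ ++ l₂) = (supp l).erase g := by
          rw [supp_erase_of_nodup (hs' ▸ hnd), ← hs', hs]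
        have hsup' : (supp (l₁ ++ l₂)).sup id = p := by rw [hsupp, hC.sup_erase, hsup]
        refine hH'.monomial_eq_zero' (W := supp (l₁ ++ l₂)) ⟨?_, ?_⟩ _ subset_rfl
        · rw [hsup']; exact hpH'
        · rw [hsup', hsupp]
          exact fun h => hpa (hC.atom _ (Finset.mem_of_mem_erase h))
    · refine hH'.circuit_eq_zero hnd (hs ▸ hC) fun h hh hha hhle => ?_
      rw [hs] at hhle
      rcases Finset.mem_insert.1 hh with rfl | hh
      · exact hle hhle
      · exact ha h hh hha hhle
  -- If `A` is nonempty, every term of `e_p ∂ e_D` has a non-nested support by `bad_circuit` applied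
  -- to `p`.
  have h2 : ε * (wdel (fun _ => 1) e lp * wdel (fun _ => 1) e lv) = 0 := by
    rcases hlp' : lp with _ | ⟨c, lp'⟩
    · simp
    · have hc : c ∈ lp := by rw [hlp']; simp
      rw [← hlp']
      have h3 : ε * wdel (fun _ => 1) e lv = 0 := by
        have := wdel_mem (w := fun _ => (1 : BHat (insert p H))) (E := e) (by simp)
          (AddMonoidHom.ker (AddMonoidHom.mulLeft ε)) [] lv fun l₁ g l₂ hs' => ?_
        · simpa [AddMonoidHom.mem_ker] using this
        · rw [AddMonoidHom.mem_ker, AddMonoidHom.coe_mulLeft, one_mul, List.nil_append]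
          have hb := hH'.bad_of_circuit_list hl hC hpH' hpa (List.mem_of_mem_filter hc)
            (hP c hc) (l₁ := l₁) (l₂ := l₂) (g := g) (by rw [← hs', hlv])
          have := hH'.monomial_eq_zero' hb (pt p H :: (l₁ ++ l₂).map (inc p H)) (by
            rw [supp_cons, supp_map_inc]; rfl)
          rw [← this, List.map_cons, List.prod_cons, List.map_map]
          rfl
      have h4 := hE.wdel_mul (w := fun _ => 1) (by simp) (pt p H) (lp.map (inc p H))
      rw [wdel_map] at h4
      have h5 : ε * wdel (fun _ => 1) e lp = (-1) ^ ((lp.map (inc p H)).length + 1) *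
          (wdel (fun _ => 1) e lp * ε) := by
        rw [h4, ← mul_assoc, ← pow_add, Even.neg_one_pow ⟨_, rfl⟩, one_mul]
      rw [← mul_assoc, h5, mul_assoc, mul_assoc, h3, mul_zero, mul_zero]
  rw [wdel_append, hFw, hFv, hFvw, hFp, add_mul, mul_add, ← add_assoc, ← wdel_append, h1, mul_assoc,
    h2, mul_zero, add_zero]

theorem extend_relIdeal [IsUpperModularLattice α] (a : FreeAlg H) (ha : a ∈ relIdeal H) :
    toBHat (insert p H) (extend p H a) = 0 := by
  refine relIdeal_le_ker H ((toBHat (insert p H)).comp (extend p H)) (fun r hr => ?_) a ha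
  cases hr with
  | monomial l T hl h => exact extend_monomial hp hH hH' l T h
  | circuit l hl hn hc =>
    obtain ⟨hC, ha⟩ := (isBlowupCircuit_iff _).1 hc
    exact extend_circuit hp hH hH' hl hC ha
  | linear g hg =>
    rw [AlgHom.comp_apply, extend_linear hp hH hH' g hg]
    exact (Relation.linear g hg).toBHat_eq_zero

end Step

end Leray
namespace Leray

universe u v

/-! ### An algebraic residue on `K[t]`. -/

section Residue

variable {K : Type*} [CommRing K]

open Polynomial in
/-- The `K`-linear functional on `K[t]` which vanishes on the multiples of `t (t + c) ^ m`, and which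
takes the value `(-1) ^ (m + 1)` at `t ^ m` and `0` at smaller powers of `t`. -/
noncomputable def residue (c : K) (m : ℕ) : K[X] →ₗ[K] K :=
  (-1 : K) ^ (m + 1) • (lcoeff K m ∘ₗ modByMonicHom (X * (X + C c) ^ m))

open Polynomial in
theorem residue_monic (c : K) (m : ℕ) : (X * (X + C c) ^ m : K[X]).Monic :=
  monic_X.mul ((monic_X_add_C c).pow m)

open Polynomial in
theorem residue_of_degree_lt [Nontrivial K] (c : K) (m : ℕ) (f : K[X]) (hf : f.natDegree < m + 1) :
    residue c m f = (-1) ^ (m + 1) * f.coeff m := by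
  have hd : (X * (X + C c) ^ m : K[X]).natDegree = m + 1 := by
    rw [monic_X.natDegree_mul ((monic_X_add_C c).pow m), natDegree_X,
      (monic_X_add_C c).natDegree_pow, natDegree_X_add_C]
    ring
  have : f %ₘ (X * (X + C c) ^ m) = f := by
    rw [modByMonic_eq_self_iff (residue_monic c m)]
    exact degree_lt_degree (hd.symm ▸ hf)
  simp [residue, modByMonicHom, this]

open Polynomial in
-- Splitting `f = f(0) + t g`, the second part gives a multiple of `t (t + c)^m`, which is killed.
-- The first is `(-1)^m f(0) (t + c)^m`, of leading coefficient `(-1)^m f(0)`; the sign `(-1)^(m +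
-- 1)` in `residue` turns this into `-f(0)`.
theorem residue_pow_mul [Nontrivial K] (c : K) (m : ℕ) (f : K[X]) :
    residue c m ((-C c - X) ^ m * f) = -f.coeff 0 := by
  have h1 : (-C c - X) ^ m * f = (X * (X + C c) ^ m) * (C ((-1) ^ m) * f.divX) +
      ((-1) ^ m * f.coeff 0) • (X + C c) ^ m := by
    have : (-C c - X : K[X]) = C (-1) * (X + C c) := by simp; ring
    conv_lhs => rw [← f.divX_mul_X_add, this, mul_pow, ← C_pow]
    rw [smul_eq_C_mul, C_mul]
    ring
  have h2 : residue c m ((X * (X + C c) ^ m) * (C ((-1) ^ m) * f.divX)) = 0 := by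
    simp only [residue, LinearMap.smul_apply, LinearMap.comp_apply, modByMonicHom_apply]
    rw [(modByMonic_eq_zero_iff_dvd (residue_monic c m)).2 (dvd_mul_right _ _), map_zero, smul_zero]
  have hd : ((X + C c) ^ m : K[X]).natDegree = m := by
    rw [(monic_X_add_C c).natDegree_pow, natDegree_X_add_C, mul_one]
  have h3 : ((X + C c) ^ m : K[X]).coeff m = 1 := by
    have := ((monic_X_add_C c).pow m).coeff_natDegree
    rwa [hd] at this
  rw [h1, map_add, h2, map_smul, residue_of_degree_lt _ _ _ (by omega), h3, zero_add, smul_eq_mul,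
    mul_one, mul_right_comm, ← pow_add]
  have : (-1 : K) ^ (m + (m + 1)) = -1 := Odd.neg_one_pow ⟨m, by ring⟩
  rw [this]; ring

open Polynomial in
-- For `m = 0` the value would be `-a`; this is why the residue term is only used for fewer than `rk
-- p` letters.
theorem residue_C [Nontrivial K] (c : K) {m : ℕ} (hm : m ≠ 0) (a : K) : residue c m (C a) = 0 := by
  rw [residue_of_degree_lt _ _ _ (by simp), coeff_C, if_neg hm, mul_zero]

end Residue

variable {α : Type u} [Lattice α] [BoundedOrder α] [Fintype α] [DecidableEq α] {G H : Finset α}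

/-! ### Recording the letters and the power of `t` of a monomial. -/

section Retraction

variable (p : α)

/-- The retraction `H ∪ {p} → H` which sends `p` to `b`. -/
noncomputable def toH (b : H) (g : ↥(insert p H)) : H :=
  if h : (g : α) ∈ H then ⟨g, h⟩ else b

theorem toH_inc (b g : H) : toH p b (inc p H g) = g := by
  rw [toH, dif_pos (show ((inc p H g : ↥(insert p H)) : α) ∈ H from g.2)]; rfl

variable {p}

theorem toH_pt (hp : p ∉ H) (b : H) : toH p b (pt p H) = b := dif_neg hp

theorem coe_toH (b : H) {g : ↥(insert p H)} (hg : (g : α) ≠ p) : (toH p b g : α) = g := by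
  have : (g : α) ∈ H := (Finset.mem_insert.1 g.2).resolve_left hg
  rw [toH, dif_pos this]

variable (p)

/-- The image in `BHat H` of a monomial in the `e_g`, `g ∈ H ∪ {p}`. -/
noncomputable def val (b : H) (l : List ↥(insert p H)) : BHat H :=
  ((l.map (toH p b)).map (bE H)).prod

open Classical in
/-- The image of `x_g` in the polynomial ring in `t = x_p` over `ℚ[x_h : h ∈ H]`. -/
noncomputable def xval (g : ↥(insert p H)) : Polynomial (MvPolynomial H ℚ) :=
  if h : (g : α) ∈ H then
    Polynomial.C (MvPolynomial.X ⟨g, h⟩) - if (g : α) ≤ p then Polynomial.X else 0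
  else Polynomial.X

/-- The isomorphism which writes a polynomial in `x_g`, `g ∈ H ∪ {p}`, in the coordinates
`x_g + [g ≤ p] x_p`, `g ∈ H`, and `t = x_p`. -/
noncomputable def coordPoly (H : Finset α) :
    MvPolynomial ↥(insert p H) ℚ →ₐ[ℚ] Polynomial (MvPolynomial H ℚ) :=
  MvPolynomial.aeval (xval p)

/-- The algebra which records the letters `e_g` and the power of `t` of a monomial. -/
abbrev Rec (H : Finset α) : Type u := AddMonoidAlgebra (BHat H) (Multiset ↥(insert p H) × ℕ)

/-- The embedding of `K[t]`, `K = ℚ[x_h : h ∈ H]`. -/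
noncomputable def polyRec (H : Finset α) : Polynomial (MvPolynomial H ℚ) →ₐ[MvPolynomial H ℚ] Rec p H :=
  Polynomial.aeval (AddMonoidAlgebra.single (0, 1) 1)

theorem polyRec_comm (f : Polynomial (MvPolynomial H ℚ)) (a : Rec p H) :
    polyRec p H f * a = a * polyRec p H f := by
  induction f using Polynomial.induction_on' with
  | add f g hf hg => rw [map_add, add_mul, mul_add, hf, hg]
  | monomial n c =>
    have h1 : ∀ a : Rec p H, (AddMonoidAlgebra.single (0, 1) 1 : Rec p H) * a =
        a * AddMonoidAlgebra.single (0, 1) 1 := fun a =>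
      AddMonoidAlgebra.single_commute (fun _ => AddCommute.all _ _) (fun _ => Commute.one_left _) a
    rw [polyRec, Polynomial.aeval_monomial, mul_assoc, ← (Commute.pow_right (h1 a).symm n).eq,
      Algebra.left_comm, ← mul_assoc, Algebra.commutes, mul_assoc]

theorem recE_anticomm (b : H) : Anticomm (fun g : ↥(insert p H) =>
    (AddMonoidAlgebra.single ({g}, 0) (bE H (toH p b g)) : Rec p H)) := fun g h => by
  simp only [AddMonoidAlgebra.single_mul_single, bE_anticomm H (toH p b g) (toH p b h),
    add_comm (({g}, 0) : Multiset ↥(insert p H) × ℕ)]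
  exact AddMonoidAlgebra.single_neg _ _

/-- The homomorphism which records the letters `e_g` and the power of `t` of a monomial, together
with its value for `e_p = e_b`. -/
noncomputable def recHom (b : H) : FreeAlg (insert p H) →ₐ[ℚ] Rec p H :=
  FreeAlg.lift (insert p H) _ (fun g => polyRec p H (xval p g)) (recE_anticomm p b)
    (fun _ a => polyRec_comm p _ a)

theorem recHom_genE (b : H) (g : ↥(insert p H)) : recHom p b (genE _ g) =
    AddMonoidAlgebra.single ({g}, 0) (bE H (toH p b g)) :=
  FreeAlg.lift_genE ..

theorem recHom_monE (b : H) (l : List ↥(insert p H)) :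
    recHom p b (monE _ l) = AddMonoidAlgebra.single ((l : Multiset ↥(insert p H)), 0) (val p b l) := by
  induction l with
  | nil => rw [monE_nil, map_one]; rfl
  | cons g l ih =>
    rw [monE_cons, map_mul, ih, recHom_genE, AddMonoidAlgebra.single_mul_single]
    rfl

theorem recHom_algebraMap (b : H) (F : MvPolynomial ↥(insert p H) ℚ) :
    recHom p b (algebraMap _ _ F) = polyRec p H (coordPoly p H F) := by
  refine (FreeAlg.lift_algebraMap ..).trans ?_
  induction F using MvPolynomial.induction_on with
  | C c =>
    rw [← MvPolynomial.algebraMap_eq, AlgHom.commutes, AlgHom.commutes]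
    exact ((polyRec p H).restrictScalars ℚ).commutes c |>.symm
  | add f g hf hg => rw [map_add, map_add, map_add, hf, hg]
  | mul_X f g hf =>
    rw [map_mul, map_mul, map_mul, hf, polyLift_X, coordPoly, MvPolynomial.aeval_X]

/-- The linear functional on `Rec` given by a family of functionals on `K[t]`. -/
noncomputable def recFunctional (Φ : Multiset ↥(insert p H) →
    Polynomial (MvPolynomial H ℚ) →ₗ[MvPolynomial H ℚ] MvPolynomial H ℚ) :
    Rec p H →ₗ[MvPolynomial H ℚ] BHat H where
  toFun a := a.coeff.sum fun γ m => Φ γ.1 (Polynomial.X ^ γ.2) • m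
  map_add' a b := by
    rw [AddMonoidAlgebra.coeff_add]
    exact Finsupp.sum_add_index' (fun _ => smul_zero _) fun _ _ _ => smul_add _ _ _
  map_smul' c a := by
    rw [AddMonoidAlgebra.coeff_smul, Finsupp.sum_smul_index' fun _ => smul_zero _, Finsupp.smul_sum]
    exact Finsupp.sum_congr fun γ _ => smul_comm _ _ _

theorem recFunctional_mul_single (Φ : Multiset ↥(insert p H) →
    Polynomial (MvPolynomial H ℚ) →ₗ[MvPolynomial H ℚ] MvPolynomial H ℚ)
    (f : Polynomial (MvPolynomial H ℚ)) (γ : Multiset ↥(insert p H)) (m : BHat H) :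
    recFunctional p Φ (polyRec p H f * AddMonoidAlgebra.single (γ, 0) m) = Φ γ f • m := by
  induction f using Polynomial.induction_on' with
  | add f g hf hg => rw [map_add, add_mul, map_add, map_add, add_smul, hf, hg]
  | monomial n c =>
    rw [← Polynomial.C_mul_X_pow_eq_monomial, ← Polynomial.smul_eq_C_mul, map_smul, map_smul,
      smul_mul_assoc, map_smul, smul_assoc]
    congr 1
    have : polyRec p H (Polynomial.X ^ n) = AddMonoidAlgebra.single (0, n) 1 := by
      rw [map_pow, polyRec, Polynomial.aeval_X, AddMonoidAlgebra.single_pow]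
      simp
    rw [this, AddMonoidAlgebra.single_mul_single, one_mul, Prod.mk_add_mk, zero_add, add_zero]
    exact Finsupp.sum_single_index (smul_zero _)

end Retraction

end Leray
namespace Leray

universe u v

variable {α : Type u} [Lattice α] [BoundedOrder α] [Fintype α] [DecidableEq α] {G H : Finset α}

/-! ### Complements, the functionals and the linear retraction. -/

section Functional

variable (p : α)

/-- `T` is a set of elements below `p` which complements `u` to `p`. -/
structure IsComplement (u : α) (T : Finset H) : Prop where
  le : ∀ t ∈ T, (t : α) ≤ p
  sup_eq : u ⊔ T.sup (fun t => (t : α)) = p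
  card_eq : rk u + T.card = rk p

open Classical in
/-- A complement of `u` in `p`. -/
noncomputable def complement (H : Finset α) (u : α) : Finset H :=
  if h : ∃ T : Finset H, IsComplement p u T then h.choose else ∅

/-- The functionals on `K[t]` from which the retraction is built: `s` is the number of letters
`e_g` with `g < p`, `u` is their join, and `j` is the number of letters `e_p`. -/
noncomputable def functional (H : Finset α) (s : ℕ) (u : α) (j : ℕ) :
    Polynomial (MvPolynomial H ℚ) →ₗ[MvPolynomial H ℚ] MvPolynomial H ℚ :=
  if j = 0 then
    if s < rk p then
      Polynomial.lcoeff _ 0 + (∏ h ∈ complement p H u, MvPolynomial.X h : MvPolynomial H ℚ) •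
        residue (abovePoly H p) (rk p - s)
    else 0
  else if j = 1 ∧ s + 1 = rk p then Polynomial.leval (-abovePoly H p) else 0

open Classical in
/-- The letters of a word which lie below `p`. -/
noncomputable def lowPart (l : List ↥(insert p H)) : List ↥(insert p H) :=
  l.filter fun g => (g : α) < p

/-- The functional which belongs to a word. -/
noncomputable def wordFunctional (l : List ↥(insert p H)) :
    Polynomial (MvPolynomial H ℚ) →ₗ[MvPolynomial H ℚ] MvPolynomial H ℚ :=
  functional p H (lowPart p l).length ((supp (lowPart p l)).sup id) (l.count (pt p H))

open Classical in
/-- The linear retraction of `extend`. -/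
noncomputable def retr (b : H) : FreeAlg (insert p H) →ₗ[ℚ] BHat H :=
  ((recFunctional p fun γ => functional p H (Multiset.card (γ.filter fun g : ↥(insert p H) => (g : α) < p))
    ((γ.filter fun g : ↥(insert p H) => (g : α) < p).toFinset.sup fun g => (g : α))
    (γ.count (pt p H))).restrictScalars ℚ) ∘ₗ (recHom p b).toLinearMap

/-- The recipe on words has to be well defined modulo reordering. The monoid algebra over multisets
of letters provides this: the sign sits in the coefficient `val`, and the functional sees only the
multiset. -/
theorem retr_apply (b : H) (F : MvPolynomial ↥(insert p H) ℚ) (l : List ↥(insert p H)) :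
    retr p b (algebraMap _ _ F * monE _ l) = wordFunctional p l (coordPoly p H F) • val p b l := by
  classical
  simp only [retr, LinearMap.comp_apply, AlgHom.toLinearMap_apply, LinearMap.restrictScalars_apply]
  rw [map_mul, recHom_algebraMap, recHom_monE, recFunctional_mul_single]
  congr 2
  simp only [wordFunctional, lowPart, supp, Multiset.filter_coe, Multiset.coe_card,
    Multiset.coe_count, List.toFinset_coe, Finset.sup_map]
  congr!

theorem xval_inc (h : H) [Decidable ((h : α) ≤ p)] : xval p (inc p H h) =
    Polynomial.C (MvPolynomial.X h) - if (h : α) ≤ p then Polynomial.X else 0 := by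
  rw [xval, dif_pos (show ((inc p H h : ↥(insert p H)) : α) ∈ H from h.2)]
  by_cases hle : (h : α) ≤ p
  · rw [if_pos hle, if_pos (show ((inc p H h : ↥(insert p H)) : α) ≤ p from hle)]; rfl
  · rw [if_neg hle, if_neg (show ¬ ((inc p H h : ↥(insert p H)) : α) ≤ p from hle)]; rfl

theorem prod_xval_dvd (T : Finset ↥(insert p H)) (Q : Finset H) (hQ : ∀ h ∈ Q, inc p H h ∈ T) :
    ∏ h ∈ Q, xval p (inc p H h) ∣ coordPoly p H (∏ g ∈ T, MvPolynomial.X g) := by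
  have h1 : coordPoly p H (∏ g ∈ T, MvPolynomial.X g) = ∏ g ∈ T, xval p g := by
    rw [map_prod]
    exact Finset.prod_congr rfl fun g _ => MvPolynomial.aeval_X _ _
  have h2 : ∏ h ∈ Q, xval p (inc p H h) =
      ∏ g ∈ Q.map ⟨inc p H, inc_injective p⟩, xval p g := by rw [Finset.prod_map]; rfl
  rw [h1, h2]
  refine Finset.prod_dvd_prod_of_subset _ _ _ fun g hg => ?_
  obtain ⟨h, hh, rfl⟩ := Finset.mem_map.1 hg
  exact hQ h hh

theorem coeff_zero_xval_inc (h : H) : (xval p (inc p H h)).coeff 0 = MvPolynomial.X h := by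
  classical
  rw [xval_inc]; split_ifs <;> simp

theorem supp_lowPart_le (l : List ↥(insert p H)) : (supp (lowPart p l)).sup id ≤ p :=
  Finset.sup_le fun a ha => by
    obtain ⟨_, h⟩ := mem_supp.1 ha
    have := (List.mem_filter.1 h).2
    exact (by simpa using this : a < p).le

end Functional

/-! ### Spanning sets below `p` and exchange of complements. -/

section Core

variable {p : α} (hp : p ∉ H) (hH : IsPartialBuildingSet G H)
  (hH' : IsPartialBuildingSet G (insert p H))

theorem mem_supp_map_toH (b : H) {l : List ↥(insert p H)} {w : α} (hw : w ∈ supp l)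
    (hwp : w ≠ p) : w ∈ supp (l.map (toH p b)) := by
  obtain ⟨h, hw⟩ := mem_supp.1 hw
  have := coe_toH b (g := ⟨w, h⟩) hwp
  rw [← show ((toH p b ⟨w, h⟩ : H) : α) = w from this, coe_mem_supp]
  exact List.mem_map_of_mem hw

theorem supp_map_toH_lowPart (b : H) (l : List ↥(insert p H)) :
    supp ((lowPart p l).map (toH p b)) = supp (lowPart p l) := by
  have hlt : ∀ g ∈ lowPart p l, (g : α) ≠ p := fun g hg => by
    have := (List.mem_filter.1 hg).2
    exact (by simpa using this : (g : α) < p).ne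
  ext w
  constructor
  · intro hw
    obtain ⟨h, hw⟩ := mem_supp.1 hw
    obtain ⟨g, hg, e⟩ := List.mem_map.1 hw
    have := coe_toH b (hlt g hg)
    rw [e] at this
    rw [show w = g from this, coe_mem_supp]; exact hg
  · intro hw
    obtain ⟨h, hw'⟩ := mem_supp.1 hw
    exact mem_supp_map_toH b hw (hlt _ hw')

theorem supp_lowPart_subset (b : H) (l : List ↥(insert p H)) :
    supp (lowPart p l) ⊆ supp (l.map (toH p b)) := by
  rw [← supp_map_toH_lowPart b]
  intro w hw
  obtain ⟨h, hw⟩ := mem_supp.1 hw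
  obtain ⟨g, hg, e⟩ := List.mem_map.1 hw
  exact mem_supp.2 ⟨h, List.mem_map.2 ⟨g, List.mem_of_mem_filter hg, e⟩⟩

theorem mem_supp_map_toH_pt (hp : p ∉ H) (b : H) {l : List ↥(insert p H)} (hl : pt p H ∈ l) :
    (b : α) ∈ supp (l.map (toH p b)) := by
  rw [coe_mem_supp]
  exact List.mem_map.2 ⟨_, hl, toH_pt hp b⟩

include hp hH hH'

theorem avoids_of_le_new {x : α} (hx : x ≤ p) : Avoids H x := fun _ hh hha hhx =>
  hha (isAtom_of_le_new hp hH hH' hh (hhx.trans hx))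

theorem bad_join {W : Finset α} (hW : W ⊆ H) {y : α} (hy : p ⊔ y ∈ H) (hs : W.sup id = p ⊔ y)
    (hn : ∀ w ∈ W, ¬ w ≤ p → w ≠ p ⊔ y) : Bad H W := by
  refine ⟨hs ▸ hy, fun hmem => ?_⟩
  rw [hs] at hmem
  by_cases hle : p ⊔ y ≤ p
  · have : p ⊔ y = p := le_antisymm hle le_sup_left
    exact hp (this ▸ hW hmem)
  · exact hn _ hmem hle rfl

-- The elements of `H` above `a` are `a` itself, those above `p`, and the remaining ones. For an
-- atom `a` the sum over all of them is a relation, so `x_a + c` reduces to the remaining ones.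
open Classical in
theorem X_add_abovePoly {a : H} (ha : (a : α) ≤ p) :
    MvPolynomial.X a + abovePoly H p = abovePoly H (a : α) -
      ∑ h ∈ Finset.univ.filter (fun h : H => (a : α) ≤ h ∧ h ≠ a ∧ ¬ p ≤ h),
        (MvPolynomial.X h : MvPolynomial H ℚ) := by
  rw [eq_sub_iff_add_eq, abovePoly, abovePoly]
  have h1 : Finset.univ.filter (fun h : H => (a : α) ≤ h) =
      insert a (Finset.univ.filter (fun h : H => p ≤ (h : α)) ∪
        Finset.univ.filter (fun h : H => (a : α) ≤ h ∧ h ≠ a ∧ ¬ p ≤ h)) := by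
    ext h
    simp only [Finset.mem_filter, Finset.mem_univ, true_and, Finset.mem_insert, Finset.mem_union]
    constructor
    · tauto
    · rintro (rfl | h | h)
      · exact le_rfl
      · exact ha.trans h
      · exact h.1
  have hap : ¬ p ≤ (a : α) := fun h => hp (le_antisymm h ha ▸ a.2)
  rw [h1, Finset.sum_insert (by simp [hap]), Finset.sum_union, add_assoc]
  rw [Finset.disjoint_left]
  intro h h1 h2
  exact (Finset.mem_filter.1 h2).2.2.2 (Finset.mem_filter.1 h1).2

/-- If letters below `p` span `p` together with the atom `a`, then `x_a` acts as `-∑ x_h` over all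
`h > p`. -/
theorem spanning_smul {k : List H} {S : Finset α} (hSk : S ⊆ supp k) (hS : ∀ s ∈ S, s ≤ p)
    {Q : Finset H} (hQ : ∀ q ∈ Q, (q : α) ≤ p) {a : H} (ha : (a : α) ≤ p)
    (hsp : p ≤ S.sup id ⊔ Q.sup (fun q => (q : α)) ⊔ a) :
    ((∏ q ∈ Q, MvPolynomial.X q) * (MvPolynomial.X a + abovePoly H p) : MvPolynomial H ℚ) •
      (k.map (bE H)).prod = 0 := by
  classical
  have haa := isAtom_of_le_new hp hH hH' a.2 ha
  rw [X_add_abovePoly hp hH hH' ha, mul_sub, sub_smul, mul_smul, hH.linear_eq_zero haa, smul_zero,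
    zero_sub, Finset.mul_sum, Finset.sum_smul, Finset.sum_eq_zero, neg_zero]
  -- Each remaining `h` is above `a`, but neither below nor above `p`. Since `S`, `Q` and `a` span
  -- `p`, the set `S ∪ Q ∪ {h}` has join `p ⊔ h ∈ H` and is bad.
  intro h hh
  obtain ⟨hah, hne, hph⟩ := (Finset.mem_filter.1 hh).2
  have hhp : ¬ (h : α) ≤ p := fun hle => by
    rcases (isAtom_of_le_new hp hH hH' h.2 hle).le_iff.1 hah with e | e
    · exact haa.1 e
    · exact hne (Subtype.ext e.symm)
  have hy : p ⊔ h ∈ H := sup_new_mem hp hH hH' (hH.subset h.2)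
    (fun e => haa.1 (le_bot_iff.1 (e ▸ le_inf ha hah))) hhp
  have hSH : S ⊆ H := fun s hs => (mem_supp.1 (hSk hs)).1
  refine hH.monomial_eq_zero (W := S ∪ Q.map (Function.Embedding.subtype _) ∪ {(h : α)})
    (bad_join hp hH hH' (y := h) ?_ hy ?_ ?_) k (insert h Q) ?_ ?_
  · intro w hw
    simp only [Finset.mem_union, Finset.mem_map, Finset.mem_singleton] at hw
    rcases hw with (hw | ⟨q, _, rfl⟩) | rfl
    · exact hSH hw
    · exact q.2
    · exact h.2
  · rw [Finset.sup_union, Finset.sup_union, Finset.sup_singleton, Finset.sup_map]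
    refine le_antisymm (sup_le_sup_right (sup_le (Finset.sup_le hS) (Finset.sup_le hQ)) _)
      (sup_le (hsp.trans (sup_le_sup_left hah _)) le_sup_right)
  · intro w hw hwp
    simp only [Finset.mem_union, Finset.mem_map, Finset.mem_singleton] at hw
    rcases hw with (hw | ⟨q, hq, rfl⟩) | rfl
    · exact absurd (hS w hw) hwp
    · exact absurd (hQ q hq) hwp
    · exact fun e => hph (e ▸ le_sup_left)
  · by_cases hhQ : h ∈ Q
    · rw [Finset.insert_eq_of_mem hhQ]; exact dvd_mul_right _ _
    · rw [Finset.prod_insert hhQ, mul_comm]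
  · intro w hw
    simp only [Finset.mem_union, Finset.mem_map, Finset.mem_singleton] at hw
    rcases hw with (hw | ⟨q, hq, rfl⟩) | rfl
    · exact Or.inl (hSk hw)
    · exact Or.inr ⟨q.2, Finset.mem_insert_of_mem hq⟩
    · exact Or.inr ⟨h.2, Finset.mem_insert_self _ _⟩

theorem exists_isComplement [IsAtomistic α] [IsUpperModularLattice α] {u : α} (hu : u ≤ p) :
    ∃ T : Finset H, IsComplement p u T := by
  classical
  have hspan : u ⊔ (Finset.univ.filter fun a : α => IsAtom a ∧ a ≤ p).sup id = p := by
    refine le_antisymm (sup_le hu (Finset.sup_le fun a ha => (Finset.mem_filter.1 ha).2.2)) ?_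
    obtain ⟨s, hs, hsa⟩ := IsAtomistic.isLUB_atoms p
    refine le_sup_of_le_right (hs.2 fun a ha => Finset.le_sup (f := id) ?_)
    exact Finset.mem_filter.2 ⟨Finset.mem_univ _, hsa a ha, hs.1 ha⟩
  obtain ⟨B, hB, h1, h2⟩ := exists_complement _ (fun a ha => (Finset.mem_filter.1 ha).2.1) hspan
  have hBH : ∀ a ∈ B, a ∈ H := fun a ha => hH.atom_mem a (Finset.mem_filter.1 (hB ha)).2.1
  have hmap : (B.subtype (· ∈ H)).map (Function.Embedding.subtype _) = B :=
    Finset.subtype_map_of_mem hBH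
  refine ⟨B.subtype (· ∈ H), fun t ht => ?_, ?_, ?_⟩
  · exact (Finset.mem_filter.1 (hB (Finset.mem_subtype.1 ht))).2.2
  · rw [← h1]; conv_rhs => rw [← hmap, Finset.sup_map]
    rfl
  · rw [← h2]; conv_rhs => rw [← hmap, Finset.card_map]

theorem isComplement_complement [IsAtomistic α] [IsUpperModularLattice α] {u : α} (hu : u ≤ p) :
    IsComplement p u (complement p H u) := by
  have h := exists_isComplement hp hH hH' hu
  rw [complement, dif_pos h]
  exact h.choose_spec

/-- The monomials `x_T` of two complements of a set of letters have the same action. -/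
theorem complement_smul [IsUpperModularLattice α] {k : List H} {S : Finset α} (hSk : S ⊆ supp k)
    (hS : ∀ s ∈ S, s ≤ p) {T T₀ : Finset H} (hT : IsComplement p (S.sup id) T)
    (hT₀ : IsComplement p (S.sup id) T₀) :
    (∏ q ∈ T, MvPolynomial.X q : MvPolynomial H ℚ) • (k.map (bE H)).prod =
      (∏ q ∈ T₀, MvPolynomial.X q : MvPolynomial H ℚ) • (k.map (bE H)).prod := by
  classical
  induction hn : (T \ T₀).card generalizing T with
  | zero =>
    have h1 : T ⊆ T₀ := Finset.sdiff_eq_empty_iff_subset.1 (Finset.card_eq_zero.1 hn)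
    rw [Finset.eq_of_subset_of_card_le h1 (by have := hT.card_eq; have := hT₀.card_eq; omega)]
  | succ n ih =>
    obtain ⟨a, ha⟩ : (T \ T₀).Nonempty := Finset.card_pos.1 (by omega)
    obtain ⟨haT, haT₀⟩ := Finset.mem_sdiff.1 ha
    set U := T.erase a with hU
    have hTU : T = insert a U := (Finset.insert_erase haT).symm
    have haU : a ∉ U := Finset.notMem_erase a T
    have hUle : ∀ q ∈ U, (q : α) ≤ p := fun q hq => hT.le q (Finset.mem_of_mem_erase hq)
    set x := S.sup id ⊔ U.sup (fun q => (q : α)) with hx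
    have hxp : x ≤ p := sup_le (Finset.sup_le hS) (Finset.sup_le hUle)
    have hxa : x ⊔ a = p := by
      rw [← hT.sup_eq, hTU, Finset.sup_insert, hx, sup_assoc, sup_comm (a : α)]
    have hrx : rk x + 1 ≤ rk p := by
      have h1 := rk_sup_finset_le (S.sup id) (U.map (Function.Embedding.subtype _)) (fun c hc => by
        obtain ⟨q, hq, rfl⟩ := Finset.mem_map.1 hc
        exact isAtom_of_le_new hp hH hH' q.2 (hUle q hq))
      rw [Finset.sup_map, Finset.card_map] at h1
      have h2 := hT.card_eq
      rw [hTU, Finset.card_insert_of_notMem haU] at h2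
      have h3 : rk x ≤ rk (S.sup id) + U.card := h1
      omega
    -- Basis exchange: `T₀` spans `p` together with the join of `S`, so some `a' ∈ T₀` is not below
    -- `x` and can replace `a`. Both `x_U x_a` and `x_U x_{a'}` act as `-c x_U`.
    obtain ⟨a', ha'T, ha'x⟩ : ∃ a' ∈ T₀, ¬ (a' : α) ≤ x := by
      by_contra hall
      push Not at hall
      have : p ≤ x := by
        rw [← hT₀.sup_eq]; exact sup_le le_sup_left (Finset.sup_le hall)
      have := rk_mono this
      omega
    have ha'at := isAtom_of_le_new hp hH hH' a'.2 (hT₀.le a' ha'T)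
    have ha'U : a' ∉ U := fun h => ha'x
      (le_sup_of_le_right (Finset.le_sup (f := fun q : H => (q : α)) h))
    have hxa' : x ⊔ a' = p := eq_of_le_of_rk_le (sup_le hxp (hT₀.le a' ha'T)) (by
      have h1 := rk_sup_atom ha'at ha'x
      have h2 := rk_sup_atom_le (x := x) (isAtom_of_le_new hp hH hH' a.2 (hT.le a haT))
      rw [hxa] at h2
      omega)
    have hT' : IsComplement p (S.sup id) (insert a' U) := by
      refine ⟨fun t ht => ?_, ?_, ?_⟩
      · rcases Finset.mem_insert.1 ht with rfl | ht
        · exact hT₀.le _ ha'T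
        · exact hUle t ht
      · rw [Finset.sup_insert, sup_comm (a' : α), ← sup_assoc, ← hx, hxa']
      · rw [Finset.card_insert_of_notMem ha'U, ← hT.card_eq, hTU,
          Finset.card_insert_of_notMem haU]
    have hcard : (insert a' U \ T₀).card = n := by
      have h1 : insert a' U \ T₀ = (T \ T₀).erase a := by
        rw [Finset.insert_sdiff_of_mem _ ha'T, hU, Finset.erase_sdiff_comm]
      rw [h1, Finset.card_erase_of_mem ha, hn]; rfl
    rw [← ih hT' hcard, hTU, Finset.prod_insert haU, Finset.prod_insert ha'U]
    have e1 := spanning_smul hp hH hH' hSk hS hUle (hT.le a haT) (hxa.ge.trans (by rw [hx]))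
    have e2 := spanning_smul hp hH hH' hSk hS hUle (hT₀.le a' ha'T) (hxa'.ge.trans (by rw [hx]))
    rw [mul_add, add_smul] at e1 e2
    rw [mul_comm, mul_comm (MvPolynomial.X a')]
    exact (eq_neg_of_add_eq_zero_left e1).trans (eq_neg_of_add_eq_zero_left e2).symm

/-- The letters below `p` of a nonvanishing monomial are independent. -/
theorem indep_of_val_ne_zero [IsUpperModularLattice α] {b : H} {l l₁ : List ↥(insert p H)}
    (hl₁ : l₁.Subperm l) (hle : ∀ g ∈ l₁, (toH p b g : α) ≤ p) (hv : val p b l ≠ 0) :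
    (l₁.map (toH p b)).Nodup ∧ Indep (supp (l₁.map (toH p b))) := by
  by_contra hd
  obtain ⟨l₀, hl₀, hsub⟩ := hl₁
  obtain ⟨l₂, hl₂⟩ := hsub.exists_perm_append
  have hperm : l.Perm (l₁ ++ l₂) := hl₂.trans (hl₀.append_right l₂)
  have hle' : ∀ g ∈ l₁.map (toH p b), (g : α) ≤ p := fun g hg => by
    obtain ⟨g', hg', rfl⟩ := List.mem_map.1 hg
    exact hle g' hg'
  have h0 := (hH.dependent_eq_zero (l := l₁.map (toH p b))
    (fun g hg => isAtom_of_le_new hp hH hH' g.2 (hle' g hg))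
    (avoids_of_le_new hp hH hH' (Finset.sup_le fun a ha => by
      obtain ⟨_, h⟩ := mem_supp.1 ha
      exact hle' _ h)) hd).2
  refine hv ((bE_anticomm H).prod_eq_zero_of_perm (hperm.map _) ?_)
  rw [List.map_append, List.map_append, List.prod_append, h0, zero_mul]

theorem lowPart_indep [IsUpperModularLattice α] {b : H} {l : List ↥(insert p H)}
    (hv : val p b l ≠ 0) :
    Indep (supp (lowPart p l)) ∧ rk ((supp (lowPart p l)).sup id) = (lowPart p l).length := by
  have hlt : ∀ g ∈ lowPart p l, (g : α) < p := fun g hg => by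
    have := (List.mem_filter.1 hg).2
    exact (by simpa using this : (g : α) < p)
  obtain ⟨h1, h2⟩ := indep_of_val_ne_zero hp hH hH' (l₁ := lowPart p l)
    (List.filter_sublist.subperm) (fun g hg => by rw [coe_toH b (hlt g hg).ne]; exact (hlt g hg).le) hv
  rw [supp_map_toH_lowPart] at h2
  refine ⟨h2, h2.2.trans ?_⟩
  rw [← supp_map_toH_lowPart b, card_supp h1, List.length_map]

/-- The letter `e_p` is evaluated as `e_b`, so a nonzero value forces `b` to be independent of the
letters strictly below `p`. -/
theorem lowPart_indep_pt [IsUpperModularLattice α] {b : H} (hb : (b : α) ≤ p)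
    {l : List ↥(insert p H)} (hpl : pt p H ∈ l) (hv : val p b l ≠ 0) :
    rk ((insert (b : α) (supp (lowPart p l))).sup id) = (lowPart p l).length + 1 := by
  have hlt : ∀ g ∈ lowPart p l, (g : α) < p := fun g hg => by
    have := (List.mem_filter.1 hg).2
    exact (by simpa using this : (g : α) < p)
  obtain ⟨h1, h2⟩ := indep_of_val_ne_zero hp hH hH' (l₁ := pt p H :: lowPart p l)
    (List.cons_subperm_of_not_mem_of_mem (fun h => (hlt _ h).ne rfl) hpl List.filter_sublist.subperm)
    (fun g hg => by
      rcases List.mem_cons.1 hg with rfl | hg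
      · rw [toH_pt hp]; exact hb
      · rw [coe_toH b (hlt g hg).ne]; exact (hlt g hg).le) hv
  have h3 : supp ((pt p H :: lowPart p l).map (toH p b)) = insert (b : α) (supp (lowPart p l)) := by
    rw [List.map_cons, supp_cons, toH_pt hp, supp_map_toH_lowPart]
  rw [← h3, h2.2, card_supp h1, List.length_map, List.length_cons]

end Core

end Leray
namespace Leray

universe u v

variable {α : Type u} [Lattice α] [BoundedOrder α] [Fintype α] [DecidableEq α] {G H : Finset α}

/-! ### The retraction kills monomials with non-nested support. -/

section Monomials

variable {p : α}

theorem wordFunctional_C_mul (l : List ↥(insert p H)) (c : MvPolynomial H ℚ)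
    (f : Polynomial (MvPolynomial H ℚ)) :
    wordFunctional p l (Polynomial.C c * f) = c * wordFunctional p l f := by
  rw [← Polynomial.smul_eq_C_mul, map_smul, smul_eq_mul]

theorem prod_xval_of_not_le (Q : Finset H) (hQ : ∀ q ∈ Q, ¬ (q : α) ≤ p) :
    ∏ q ∈ Q, xval p (inc p H q) = Polynomial.C (∏ q ∈ Q, MvPolynomial.X q) := by
  classical
  rw [map_prod]
  exact Finset.prod_congr rfl fun q hq => by rw [xval_inc, if_neg (hQ q hq), sub_zero]

theorem prod_xval_of_le (Q : Finset H) (hQ : ∀ q ∈ Q, (q : α) ≤ p) :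
    ∏ q ∈ Q, xval p (inc p H q) =
      ∏ q ∈ Q, (Polynomial.C (MvPolynomial.X q) - Polynomial.X) := by
  classical
  exact Finset.prod_congr rfl fun q hq => by rw [xval_inc, if_pos (hQ q hq)]

theorem coeff_zero_prod_xval (Q : Finset H) :
    (∏ q ∈ Q, xval p (inc p H q)).coeff 0 = ∏ q ∈ Q, MvPolynomial.X q := by
  rw [Polynomial.coeff_zero_prod]
  exact Finset.prod_congr rfl fun q _ => coeff_zero_xval_inc p q

theorem xval_pt (hp : p ∉ H) : xval p (pt p H) = Polynomial.X := dif_neg hp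

/-- A functional kills `val` as soon as it does so in the two cases where it is not zero. -/
theorem wordFunctional_smul_eq_zero {b : H} {l : List ↥(insert p H)}
    {f : Polynomial (MvPolynomial H ℚ)}
    (h0 : l.count (pt p H) = 0 → (lowPart p l).length < rk p →
      (f.coeff 0) • val p b l + ((∏ h ∈ complement p H ((supp (lowPart p l)).sup id),
        MvPolynomial.X h) * residue (abovePoly H p) (rk p - (lowPart p l).length) f) •
        val p b l = 0)
    (h1 : l.count (pt p H) = 1 → (lowPart p l).length + 1 = rk p →
      f.eval (-abovePoly H p) • val p b l = 0) :
    wordFunctional p l f • val p b l = 0 := by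
  unfold wordFunctional functional
  split_ifs with e0 e1 e2
  · have := h0 e0 e1
    rw [← add_smul] at this
    exact this
  · rw [LinearMap.zero_apply, zero_smul]
  · exact h1 e2.1 e2.2
  · rw [LinearMap.zero_apply, zero_smul]

open Classical in
/-- The elements of `H` which lie in `W` and in `T`. -/
noncomputable def commonPart (H W : Finset α) (T : Finset ↥(insert p H)) : Finset H :=
  Finset.univ.filter fun h => (h : α) ∈ W ∧ inc p H h ∈ T

theorem mem_commonPart {W : Finset α} {T : Finset ↥(insert p H)} {h : H} :
    h ∈ commonPart H W T ↔ (h : α) ∈ W ∧ inc p H h ∈ T := by simp [commonPart]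

theorem commonPart_dvd (W : Finset α) (T : Finset ↥(insert p H)) :
    ∏ q ∈ commonPart H W T, xval p (inc p H q) ∣ coordPoly p H (∏ g ∈ T, MvPolynomial.X g) :=
  prod_xval_dvd p T _ fun _ hq => (mem_commonPart.1 hq).2

theorem mem_supp_or_commonPart {b : H} {l : List ↥(insert p H)} {T : Finset ↥(insert p H)}
    {W V : Finset α} (hWT : ∀ w ∈ W, w ∈ supp l ∨ ∃ h : w ∈ insert p H, (⟨w, h⟩ : ↥(insert p H)) ∈ T)
    (hVW : V ⊆ W) (hpV : p ∉ V) (v : α) (hv : v ∈ V) :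
    v ∈ supp (l.map (toH p b)) ∨ ∃ h : v ∈ H, (⟨v, h⟩ : H) ∈ commonPart H V T := by
  have hvp : v ≠ p := fun e => hpV (e ▸ hv)
  rcases hWT v (hVW hv) with h | ⟨h, hT⟩
  · exact Or.inl (mem_supp_map_toH b h hvp)
  · have hvH := (Finset.mem_insert.1 h).resolve_left hvp
    exact Or.inr ⟨hvH, mem_commonPart.2 ⟨hv, hT⟩⟩

variable (hp : p ∉ H) (hH : IsPartialBuildingSet G H) (hH' : IsPartialBuildingSet G (insert p H))

include hp hH hH'

/-- `S` and `T` together reach `p`, and `V` goes from `p` on to `p ⊔ y`; hence `S ∪ T ∪ V` is a bad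
set in `H`. -/
theorem spanning_bad {k : List H} {S : Finset α} (hSk : S ⊆ supp k) (hS : ∀ s ∈ S, s ≤ p)
    {T : Finset H} (hT : ∀ t ∈ T, (t : α) ≤ p) (hsp : p ≤ S.sup id ⊔ T.sup (fun t => (t : α)))
    {V : Finset α} {y : α} (hy : p ⊔ y ∈ H) (hV : p ⊔ V.sup id = p ⊔ y)
    (hne : ∀ v ∈ V, v ≠ p ⊔ y) {Q : Finset H}
    (hVk : ∀ v ∈ V, v ∈ supp k ∨ ∃ h : v ∈ H, (⟨v, h⟩ : H) ∈ Q) (hQ : ∀ q ∈ Q, ¬ (q : α) ≤ p)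
    {f : MvPolynomial H ℚ}
    (hf : (∏ q ∈ Q, MvPolynomial.X q) * (∏ t ∈ T, MvPolynomial.X t) ∣ f) :
    f • (k.map (bE H)).prod = 0 := by
  have hmem : ∀ w ∈ S ∪ T.map (Function.Embedding.subtype _) ∪ V,
      w ∈ supp k ∨ ∃ h : w ∈ H, (⟨w, h⟩ : H) ∈ Q ∪ T := by
    intro w hw
    simp only [Finset.mem_union, Finset.mem_map] at hw ⊢
    rcases hw with (hw | ⟨q, hq, rfl⟩) | hw
    · exact Or.inl (hSk hw)
    · exact Or.inr ⟨q.2, Or.inr hq⟩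
    · exact (hVk w hw).imp_right fun ⟨h, h'⟩ => ⟨h, Or.inl h'⟩
  refine hH.monomial_eq_zero (W := S ∪ T.map (Function.Embedding.subtype _) ∪ V)
    (bad_join hp hH hH' (y := y) ?_ hy ?_ ?_) k (Q ∪ T) ?_ hmem
  · intro w hw
    rcases hmem w hw with h | ⟨h, _⟩
    · exact (mem_supp.1 h).1
    · exact h
  · rw [Finset.sup_union, Finset.sup_union, Finset.sup_map, ← hV]
    exact congrArg (· ⊔ _) (le_antisymm (sup_le (Finset.sup_le hS) (Finset.sup_le hT)) hsp)
  · intro w hw hwp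
    simp only [Finset.mem_union, Finset.mem_map] at hw
    rcases hw with (hw | ⟨q, hq, rfl⟩) | hw
    · exact absurd (hS w hw) hwp
    · exact absurd (hT q hq) hwp
    · exact hne w hw
  · rwa [Finset.prod_union (Finset.disjoint_left.2 fun q h1 h2 => hQ q h1 (hT q h2))]

theorem lowPart_le {l : List ↥(insert p H)} {s : α} (hs : s ∈ supp (lowPart p l)) : s ≤ p :=
  (Finset.le_sup (f := id) hs).trans (supp_lowPart_le p l)

theorem complement_span [IsAtomistic α] [IsUpperModularLattice α] (l : List ↥(insert p H)) :
    p ≤ (supp (lowPart p l)).sup id ⊔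
      (complement p H ((supp (lowPart p l)).sup id)).sup (fun t => (t : α)) :=
  (isComplement_complement hp hH hH' (supp_lowPart_le p l)).sup_eq.ge

/-- When `e_p` occurs once and `s + 1 = rk p`, the letters below `p` and `b` are `rk p` independent
atoms, so they span `p`. -/
theorem insert_span [IsUpperModularLattice α] {b : H} (hb : (b : α) ≤ p) {l : List ↥(insert p H)}
    (h1 : l.count (pt p H) = 1) (hs : (lowPart p l).length + 1 = rk p) (hv : val p b l ≠ 0) :
    (∀ s ∈ insert (b : α) (supp (lowPart p l)), s ≤ p) ∧
    insert (b : α) (supp (lowPart p l)) ⊆ supp (l.map (toH p b)) ∧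
    (insert (b : α) (supp (lowPart p l))).sup id = p := by
  have hpl : pt p H ∈ l := List.count_pos_iff.1 (by omega)
  have hle : ∀ s ∈ insert (b : α) (supp (lowPart p l)), s ≤ p := fun s hs => by
    rcases Finset.mem_insert.1 hs with rfl | hs
    · exact hb
    · exact lowPart_le hp hH hH' hs
  refine ⟨hle, fun s hs => ?_, eq_of_le_of_rk_le (Finset.sup_le hle) ?_⟩
  · rcases Finset.mem_insert.1 hs with rfl | hs
    · exact mem_supp_map_toH_pt hp b hpl
    · exact supp_lowPart_subset b l hs
  · rw [lowPart_indep_pt hp hH hH' hb hpl hv, hs]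

/-- None of the factors belonging to `W` involves `t`, so they come out as scalars, and `W` is
already bad in `H`. -/
theorem wordFunctional_bad_above {b : H} {l : List ↥(insert p H)} {T : Finset ↥(insert p H)}
    {W : Finset α} (hW : Bad (insert p H) W)
    (hWT : ∀ w ∈ W, w ∈ supp l ∨ ∃ h : w ∈ insert p H, (⟨w, h⟩ : ↥(insert p H)) ∈ T)
    (hWp : ∀ w ∈ W, ¬ w ≤ p) (f : Polynomial (MvPolynomial H ℚ)) :
    wordFunctional p l (coordPoly p H (∏ g ∈ T, MvPolynomial.X g) * f) • val p b l = 0 := by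
  have hWH : ∀ w ∈ W, w ∈ insert p H := fun w hw => by
    rcases hWT w hw with h | ⟨h, _⟩
    · exact (mem_supp.1 h).1
    · exact h
  have hsup : W.sup id ≠ p := by
    intro e
    rcases W.eq_empty_or_nonempty with rfl | ⟨w, hw⟩
    · exact hH'.ne_bot (Finset.mem_insert_self p H) e.symm
    · exact hWp w hw (e ▸ Finset.le_sup (f := id) hw)
  obtain ⟨F, hF⟩ := commonPart_dvd (p := p) (H := H) W T
  rw [hF, prod_xval_of_not_le _ fun q hq => hWp q (mem_commonPart.1 hq).1, mul_assoc,
    wordFunctional_C_mul]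
  exact hH.monomial_eq_zero (W := W) ⟨(Finset.mem_insert.1 hW.1).resolve_left hsup, hW.2⟩ _ _
    (dvd_mul_right _ _) (mem_supp_or_commonPart hWT subset_rfl fun h => hWp p h le_rfl)

/-- The elements of `W` not below `p` give scalar factors. In the residue and evaluation terms `p`
is spanned, by the complement or by `b` respectively, and `spanning_bad` applies. Only the term
`f(0)` needs `W` itself. -/
theorem wordFunctional_bad_meets [IsAtomistic α] [IsUpperModularLattice α] {b : H}
    (hb : (b : α) ≤ p) {l : List ↥(insert p H)}
    {T : Finset ↥(insert p H)} {W : Finset α} (hW : Bad (insert p H) W)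
    (hWT : ∀ w ∈ W, w ∈ supp l ∨ ∃ h : w ∈ insert p H, (⟨w, h⟩ : ↥(insert p H)) ∈ T)
    (hsup : W.sup id ≠ p) {w : α} (hw : w ∈ W) (hwp : w ≤ p) (hv : val p b l ≠ 0)
    (f : Polynomial (MvPolynomial H ℚ)) :
    wordFunctional p l (coordPoly p H (∏ g ∈ T, MvPolynomial.X g) * f) • val p b l = 0 := by
  classical
  have hWH : W ⊆ insert p H := fun w hw => by
    rcases hWT w hw with h | ⟨h, _⟩
    · exact (mem_supp.1 h).1
    · exact h
  obtain ⟨h1, h2, h3⟩ := bad_meets_new hp hH hH' hW hWH hsup hw hwp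
  set V := W.filter fun v => ¬ v ≤ p with hV
  have hVW : V ⊆ W := Finset.filter_subset _ _
  have hVp : ∀ v ∈ V, ¬ v ≤ p := fun v hv => (Finset.mem_filter.1 hv).2
  have hVs : p ⊔ V.sup id = p ⊔ W.sup id := by convert sup_filter_not_le p W
  have hVne : ∀ v ∈ V, v ≠ p ⊔ W.sup id := fun v hv e => h3 (e ▸ hVW hv)
  have hVk := mem_supp_or_commonPart (b := b) hWT hVW fun h => hVp p h le_rfl
  have hQp : ∀ q ∈ commonPart H V T, ¬ (q : α) ≤ p := fun q hq => hVp q (mem_commonPart.1 hq).1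
  obtain ⟨F, hF⟩ := commonPart_dvd (p := p) (H := H) V T
  rw [prod_xval_of_not_le _ hQp] at hF
  refine wordFunctional_smul_eq_zero (fun e0 hs => ?_) fun e1 hs => ?_
  · have hz : ((∏ h ∈ complement p H ((supp (lowPart p l)).sup id), MvPolynomial.X h) *
        residue (abovePoly H p) (rk p - (lowPart p l).length)
          (coordPoly p H (∏ g ∈ T, MvPolynomial.X g) * f)) • val p b l = 0 := by
      rw [hF, mul_assoc, ← Polynomial.smul_eq_C_mul, map_smul, smul_eq_mul, ← mul_assoc,
        mul_comm (∏ h ∈ complement p H _, _)]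
      exact spanning_bad hp hH hH' (supp_lowPart_subset b l) (fun s => lowPart_le hp hH hH')
        (isComplement_complement hp hH hH' (supp_lowPart_le p l)).le (complement_span hp hH hH' l)
        h2 hVs hVne hVk hQp (dvd_mul_right _ _)
    rw [hz, add_zero]
    -- A factor `x_p = t` kills the value at `t = 0`. Without it `p ∉ W`, since `e_p` does not occur
    -- either, and `W` is bad in `H`.
    by_cases hpT : pt p H ∈ T
    · have : coordPoly p H (∏ g ∈ T, MvPolynomial.X g) =
          Polynomial.X * coordPoly p H (∏ g ∈ T.erase (pt p H), MvPolynomial.X g) := by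
        rw [← Finset.mul_prod_erase _ _ hpT, map_mul, coordPoly, MvPolynomial.aeval_X, xval_pt hp]
      rw [this, mul_assoc, Polynomial.coeff_X_mul_zero, zero_smul]
    · have hpW : p ∉ W := fun h => by
        rcases hWT p h with h' | ⟨_, h'⟩
        · obtain ⟨_, h'⟩ := mem_supp.1 h'
          exact List.count_eq_zero.1 e0 h'
        · exact hpT h'
      obtain ⟨F, hF⟩ := commonPart_dvd (p := p) (H := H) W T
      rw [hF, mul_assoc, Polynomial.mul_coeff_zero, coeff_zero_prod_xval]
      exact hH.monomial_eq_zero (W := W) ⟨(Finset.mem_insert.1 hW.1).resolve_left hsup, hW.2⟩ _ _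
        (dvd_mul_right _ _) (mem_supp_or_commonPart hWT subset_rfl hpW)
  · obtain ⟨i1, i2, i3⟩ := insert_span hp hH hH' hb e1 hs hv
    rw [hF, mul_assoc, Polynomial.eval_mul, Polynomial.eval_C]
    refine spanning_bad hp hH hH' i2 i1 (T := ∅) (by simp) ?_ h2 hVs hVne hVk hQp ?_
    · rw [i3]; exact le_sup_left
    · rw [Finset.prod_empty, mul_one]; exact dvd_mul_right _ _

/-- Below a spanning set of letters, the factors `x_a - t` act as `-c - t`. -/
theorem residue_prod_smul {k : List H} {S : Finset α} (hSk : S ⊆ supp k) (hS : ∀ s ∈ S, s ≤ p)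
    {T : Finset H} (hT : ∀ t ∈ T, (t : α) ≤ p) (hsp : p ≤ S.sup id ⊔ T.sup (fun t => (t : α)))
    (Q : Finset H) (hQ : ∀ q ∈ Q, (q : α) ≤ p)
    (Φ : Polynomial (MvPolynomial H ℚ) →ₗ[MvPolynomial H ℚ] MvPolynomial H ℚ)
    (f : Polynomial (MvPolynomial H ℚ)) :
    ((∏ t ∈ T, MvPolynomial.X t) *
      Φ ((∏ q ∈ Q, (Polynomial.C (MvPolynomial.X q) - Polynomial.X)) * f)) • (k.map (bE H)).prod =
    ((∏ t ∈ T, MvPolynomial.X t) *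
      Φ ((-Polynomial.C (abovePoly H p) - Polynomial.X) ^ Q.card * f)) • (k.map (bE H)).prod := by
  classical
  induction Q using Finset.induction_on generalizing f with
  | empty => simp
  | insert a Q ha ih =>
    have h1 : (∏ q ∈ insert a Q, (Polynomial.C (MvPolynomial.X q) - Polynomial.X)) * f =
        (MvPolynomial.X a + abovePoly H p) •
          ((∏ q ∈ Q, (Polynomial.C (MvPolynomial.X q) - Polynomial.X)) * f) +
        (∏ q ∈ Q, (Polynomial.C (MvPolynomial.X q) - Polynomial.X)) *
          ((-Polynomial.C (abovePoly H p) - Polynomial.X) * f) := by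
      rw [Finset.prod_insert ha, Polynomial.smul_eq_C_mul, Polynomial.C_add]
      ring
    rw [h1, map_add, map_smul, mul_add, add_smul, ih (fun q hq => hQ q (Finset.mem_insert_of_mem hq)),
      smul_eq_mul, ← mul_assoc, mul_comm _ (Φ _), mul_smul,
      spanning_smul hp hH hH' hSk hS hT (hQ a (Finset.mem_insert_self _ _))
        (hsp.trans le_sup_left), smul_zero, zero_add, Finset.card_insert_of_notMem ha, pow_succ,
      mul_assoc]

/-- This is the relation that dictates the form of `functional`: the value at `t = 0` and the
residue term cancel. -/
theorem wordFunctional_bad_new [IsAtomistic α] [IsUpperModularLattice α] {b : H}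
    (hb : (b : α) ≤ p) {l : List ↥(insert p H)}
    {T : Finset ↥(insert p H)} {W : Finset α} (hW : Bad (insert p H) W)
    (hWT : ∀ w ∈ W, w ∈ supp l ∨ ∃ h : w ∈ insert p H, (⟨w, h⟩ : ↥(insert p H)) ∈ T)
    (hsup : W.sup id = p) (hv : val p b l ≠ 0) (f : Polynomial (MvPolynomial H ℚ)) :
    wordFunctional p l (coordPoly p H (∏ g ∈ T, MvPolynomial.X g) * f) • val p b l = 0 := by
  classical
  have hpW : p ∉ W := hsup ▸ hW.2
  have hWle : ∀ w ∈ W, w ≤ p := fun w hw => hsup ▸ Finset.le_sup (f := id) hw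
  have hsl : ∀ w ∈ W, w ∈ supp l → w ∈ supp (lowPart p l) := fun w hw h => by
    obtain ⟨h1, h2⟩ := mem_supp.1 h
    exact mem_supp.2 ⟨h1, List.mem_filter.2 ⟨h2, by
      simpa using lt_of_le_of_ne (hWle w hw) fun e => hpW (e ▸ hw)⟩⟩
  obtain ⟨hind, hrk⟩ := lowPart_indep hp hH hH' hv
  set S := supp (lowPart p l) with hSdef
  have hSk : S ⊆ supp (l.map (toH p b)) := supp_lowPart_subset b l
  have hS : ∀ s ∈ S, s ≤ p := fun s => lowPart_le hp hH hH'
  have hWS : ∀ w ∈ W, w ∈ S ∨ ∃ h : w ∈ H, (⟨w, h⟩ : H) ∈ commonPart H W T := fun w hw => by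
    rcases hWT w hw with h | ⟨h, hT⟩
    · exact Or.inl (hsl w hw h)
    · have hwH := (Finset.mem_insert.1 h).resolve_left fun e => hpW (e ▸ hw)
      exact Or.inr ⟨hwH, mem_commonPart.2 ⟨hw, hT⟩⟩
  have hQle : ∀ q ∈ commonPart H W T, (q : α) ≤ p := fun q hq => hWle q (mem_commonPart.1 hq).1
  refine wordFunctional_smul_eq_zero (fun e0 hs => ?_) fun e1 hs => ?_
  -- The even letters of `W` span `p` over the odd ones, so they contain a complement `T₀` of size
  -- `rk p - s`.
  · obtain ⟨B, hB, hB1, hB2⟩ := exists_complement (u := S.sup id) (p := p)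
      ((commonPart H W T).map (Function.Embedding.subtype _)) (fun a ha => by
        obtain ⟨q, hq, rfl⟩ := Finset.mem_map.1 ha
        exact isAtom_of_le_new hp hH hH' q.2 (hQle q hq)) (by
      refine le_antisymm (sup_le (Finset.sup_le hS) (Finset.sup_le fun a ha => ?_)) ?_
      · obtain ⟨q, hq, rfl⟩ := Finset.mem_map.1 ha
        exact hQle q hq
      · refine hsup.ge.trans (Finset.sup_le fun w hw => ?_)
        rcases hWS w hw with h | ⟨h, h'⟩
        · exact le_sup_of_le_left (Finset.le_sup (f := id) h)
        · exact le_sup_of_le_right (Finset.le_sup (f := id) (Finset.mem_map_of_mem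
            (Function.Embedding.subtype _) h')))
    have hBH : ∀ a ∈ B, a ∈ H := fun a ha => by
      obtain ⟨q, hq, rfl⟩ := Finset.mem_map.1 (hB ha)
      exact q.2
    have hmap : (B.subtype (· ∈ H)).map (Function.Embedding.subtype _) = B :=
      Finset.subtype_map_of_mem hBH
    have hBQ : B.subtype (· ∈ H) ⊆ commonPart H W T := fun q hq => by
      obtain ⟨q', hq', e⟩ := Finset.mem_map.1 (hB (Finset.mem_subtype.1 hq))
      rwa [← Subtype.ext e]
    have hT₀ : IsComplement p (S.sup id) (B.subtype (· ∈ H)) := by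
      refine ⟨fun t ht => hQle t (hBQ ht), ?_, ?_⟩
      · rw [← hB1]; conv_rhs => rw [← hmap, Finset.sup_map]
        rfl
      · rw [← hB2]; conv_rhs => rw [← hmap, Finset.card_map]
    generalize B.subtype (· ∈ H) = T₀ at hBQ hT₀
    have hC := isComplement_complement hp hH hH' (u := S.sup id) (Finset.sup_le hS)
    obtain ⟨F, hF⟩ := (Finset.prod_dvd_prod_of_subset _ _ (fun q => xval p (inc p H q)) hBQ).trans
      (commonPart_dvd (p := p) (H := H) W T)
    have hm : rk p - (lowPart p l).length = T₀.card := by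
      have := hT₀.card_eq; omega
    have hT := complement_smul hp hH hH' hSk hS hC hT₀
    -- The constant term is `x_{T₀} F(0)`. The residue term is `-x_T F(0)` for the chosen complement
    -- `T`, because the factors `x_a - t` act as `(-c - t)^m` with `m = |T₀|`; `x_T` and `x_{T₀}`
    -- act alike.
    rw [hF, mul_assoc, Polynomial.mul_coeff_zero, coeff_zero_prod_xval, prod_xval_of_le _ hT₀.le,
      val, residue_prod_smul hp hH hH' hSk hS hC.le hC.sup_eq.ge _ hT₀.le, hm, residue_pow_mul,
      mul_comm, mul_smul, mul_comm _ (-_), mul_smul, hT, ← add_smul, add_neg_cancel, zero_smul]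
  · obtain ⟨i1, i2, i3⟩ := insert_span hp hH hH' hb e1 hs hv
    -- The odd letters of `W` have rank at most `rk p - 1`, so some `a ∈ W` occurs as `x_a`. Its
    -- factor `x_a - t` at `t = -c` is `x_a + c`, which acts as zero.
    obtain ⟨a, ha⟩ : (commonPart H W T).Nonempty := by
      by_contra hemp
      rw [Finset.not_nonempty_iff_eq_empty] at hemp
      have : p ≤ S.sup id := by
        refine hsup.ge.trans (Finset.sup_le fun w hw => ?_)
        rcases hWS w hw with h | ⟨h, h'⟩
        · exact Finset.le_sup (f := id) h
        · rw [hemp] at h'; simp at h'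
      have := rk_mono this
      omega
    obtain ⟨F, hF⟩ := (Finset.dvd_prod_of_mem (fun q => xval p (inc p H q)) ha).trans
      (commonPart_dvd (p := p) (H := H) W T)
    have h0 := spanning_smul hp hH hH' i2 i1 (Q := ∅) (by simp) (hQle a ha)
      (by rw [i3]; exact le_sup_of_le_left le_sup_left)
    rw [Finset.prod_empty, one_mul] at h0
    rw [hF, xval_inc, if_pos (hQle a ha), mul_assoc, Polynomial.eval_mul, Polynomial.eval_sub,
      Polynomial.eval_C, Polynomial.eval_X, sub_neg_eq_add, mul_comm, mul_smul, val, h0, smul_zero]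

theorem wordFunctional_bad [IsAtomistic α] [IsUpperModularLattice α] {b : H}
    (hb : (b : α) ≤ p) {l : List ↥(insert p H)}
    {T : Finset ↥(insert p H)} {W : Finset α} (hW : Bad (insert p H) W)
    (hWT : ∀ w ∈ W, w ∈ supp l ∨ ∃ h : w ∈ insert p H, (⟨w, h⟩ : ↥(insert p H)) ∈ T)
    (f : Polynomial (MvPolynomial H ℚ)) :
    wordFunctional p l (coordPoly p H (∏ g ∈ T, MvPolynomial.X g) * f) • val p b l = 0 := by
  by_cases hv : val p b l = 0
  · rw [hv, smul_zero]
  by_cases hsup : W.sup id = p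
  · exact wordFunctional_bad_new hp hH hH' hb hW hWT hsup hv f
  by_cases hw : ∃ w ∈ W, w ≤ p
  · obtain ⟨w, hw, hwp⟩ := hw
    exact wordFunctional_bad_meets hp hH hH' hb hW hWT hsup hw hwp hv f
  · push Not at hw
    exact wordFunctional_bad_above hp hH hH' hW hWT hw f

end Monomials

end Leray
namespace Leray

universe u v

variable {α : Type u} [Lattice α] [BoundedOrder α] [Fintype α] [DecidableEq α] {G H : Finset α}

/-! ### The retraction kills all relations and is a left inverse. -/

section Retract

variable {p : α}

theorem val_append (b : H) (l l' : List ↥(insert p H)) :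
    val p b (l ++ l') = val p b l * val p b l' := by simp [val]

theorem val_map_inc (b : H) (l : List H) : val p b (l.map (inc p H)) = (l.map (bE H)).prod := by
  rw [val, List.map_map (l := l), show (toH p b ∘ inc p H : H → H) = id from funext (toH_inc p b),
    List.map_id]

/-- The homomorphism with `e_g ↦ val p b [g]` and `x_g ↦ 0`. -/
noncomputable def valHom (p : α) (b : H) : FreeAlg (insert p H) →ₐ[ℚ] BHat H :=
  FreeAlg.lift _ (fun g => bE H (toH p b g)) (fun _ => 0)
    (fun g h => bE_anticomm H (toH p b g) (toH p b h)) (by simp)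

theorem valHom_genE (b : H) (g : ↥(insert p H)) : valHom p b (genE _ g) = bE H (toH p b g) :=
  FreeAlg.lift_genE ..

theorem valHom_monE (b : H) (l : List ↥(insert p H)) : valHom p b (monE _ l) = val p b l := by
  rw [map_monE, val, List.map_map]
  exact congrArg List.prod (List.map_congr_left fun g _ => valHom_genE b g)

/-- If the functional acts as one scalar `k` on the values of all words with a letter of `l`
deleted, the signed sum reassembles to `k` times a boundary in `BHat H`. Only the action on these
values has to agree, not the functionals themselves. -/
theorem retr_wdel (b : H) (F : MvPolynomial ↥(insert p H) ℚ) (k : MvPolynomial H ℚ)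
    (l₀ l l' : List ↥(insert p H))
    (h : ∀ l₁ g l₂, l = l₁ ++ g :: l₂ →
      wordFunctional p (l₀ ++ l₁ ++ l₂ ++ l') (coordPoly p H F) • val p b (l₀ ++ l₁ ++ l₂ ++ l') =
        k • val p b (l₀ ++ l₁ ++ l₂ ++ l')) :
    retr p b (algebraMap _ _ F * (monE _ l₀ * wdel (fun _ => 1) (genE _) l * monE _ l')) =
      k • (val p b l₀ * wdel (fun _ => 1) (bE H) (l.map (toH p b)) * val p b l') := by
  let D : FreeAlg (insert p H) →+ BHat H := AddMonoidHom.mk'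
    (fun a => retr p b (algebraMap _ _ F * (a * monE _ l')) - k • (valHom p b a * val p b l'))
    fun a a' => by
      rw [add_mul, mul_add, map_add, map_add, add_mul, smul_add, add_sub_add_comm]
  have hmem := wdel_mem (w := fun _ => (1 : FreeAlg (insert p H))) (E := genE (insert p H))
    (by simp) (AddMonoidHom.ker D) l₀ l fun l₁ g l₂ hl => by
      rw [one_mul, AddMonoidHom.mem_ker]
      change retr p b (algebraMap _ _ F * (monE _ (l₀ ++ l₁ ++ l₂) * monE _ l')) -
        k • (valHom p b (monE _ (l₀ ++ l₁ ++ l₂)) * val p b l') = 0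
      rw [← monE_append, retr_apply, valHom_monE, ← val_append, h l₁ g l₂ hl, sub_self]
  rw [AddMonoidHom.mem_ker] at hmem
  have h2 := sub_eq_zero.1 hmem
  refine h2.trans ?_
  change k • (valHom p b (monE _ l₀ * wdel (fun _ => 1) (genE _) l) * val p b l') = _
  rw [map_mul, valHom_monE, map_wdel, wdel_map]
  simp only [map_one, valHom_genE]

theorem lowPart_append (l l' : List ↥(insert p H)) :
    lowPart p (l ++ l') = lowPart p l ++ lowPart p l' := List.filter_append ..

theorem lowPart_eq_self {l : List ↥(insert p H)} (h : ∀ g ∈ l, (g : α) < p) : lowPart p l = l :=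
  List.filter_eq_self.2 fun g hg => by simpa using h g hg

theorem lowPart_eq_nil {l : List ↥(insert p H)} (h : ∀ g ∈ l, ¬ (g : α) < p) : lowPart p l = [] :=
  List.filter_eq_nil_iff.2 fun g hg => by simpa using h g hg

variable (hp : p ∉ H) (hH : IsPartialBuildingSet G H) (hH' : IsPartialBuildingSet G (insert p H))

include hp hH hH'

theorem new_ne_of_isAtom {a : α} (ha : IsAtom a) : a ≠ p := fun e =>
  not_isAtom_new hp hH hH' (e ▸ ha)

theorem retr_mul_circuit [IsAtomistic α] [IsUpperModularLattice α] {b : H} (hb : (b : α) ≤ p)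
    (F : MvPolynomial ↥(insert p H) ℚ) (l lc : List ↥(insert p H)) (hlc : lc.Nodup)
    (hC : Circuit (supp lc)) (ha : Avoids (insert p H) ((supp lc).sup id)) :
    retr p b (algebraMap _ _ F * monE _ l * boundary _ (monE _ lc)) = 0 := by
  classical
  have hat : ∀ g ∈ lc, IsAtom (g : α) := fun g hg => hC.atom _ (coe_mem_supp.2 hg)
  have hne : ∀ g ∈ lc, (g : α) ≠ p := fun g hg => new_ne_of_isAtom hp hH hH' (hat g hg)
  have hsupp : supp (lc.map (toH p b)) = supp lc := by
    ext w
    constructor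
    · intro hw
      obtain ⟨h, hw⟩ := mem_supp.1 hw
      obtain ⟨g, hg, e⟩ := List.mem_map.1 hw
      have := coe_toH b (hne g hg)
      rw [e] at this
      rw [show w = g from this, coe_mem_supp]; exact hg
    · intro hw
      obtain ⟨h, hw'⟩ := mem_supp.1 hw
      exact mem_supp_map_toH b hw (hne _ hw')
  have hnd : (lc.map (toH p b)).Nodup := hlc.map_on fun g hg g' hg' e => by
    have := coe_toH b (hne g hg)
    rw [e, coe_toH b (hne g' hg')] at this
    exact Subtype.ext this.symm
  have h0 : wdel (fun _ => 1) (bE H) (lc.map (toH p b)) = 0 :=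
    hH.circuit_eq_zero hnd (hsupp ▸ hC) fun h hh => by
      rw [hsupp]; exact ha h (Finset.mem_insert_of_mem hh)
  have main : ∀ k : MvPolynomial H ℚ, (∀ l₁ g l₂, lc = l₁ ++ g :: l₂ →
      wordFunctional p (l ++ l₁ ++ l₂) (coordPoly p H F) • val p b (l ++ l₁ ++ l₂) =
        k • val p b (l ++ l₁ ++ l₂)) →
      retr p b (algebraMap _ _ F * monE _ l * boundary _ (monE _ lc)) = 0 := fun k hk => by
    have := retr_wdel b F k l lc [] fun l₁ g l₂ hl => by
      rw [List.append_nil]; exact hk l₁ g l₂ hl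
    rw [h0, mul_zero, zero_mul, smul_zero, monE_nil, mul_one, ← boundary_monE, ← mul_assoc] at this
    exact this
  have hcount : ∀ l₁ g l₂, lc = l₁ ++ g :: l₂ →
      (l ++ l₁ ++ l₂).count (pt p H) = l.count (pt p H) := fun l₁ g l₂ hl => by
    rw [List.append_assoc, List.count_append, add_eq_left, List.count_eq_zero]
    intro hmem
    refine hne (pt p H) ?_ rfl
    rw [hl]
    rcases List.mem_append.1 hmem with h | h <;> simp [h]
  have hsub : ∀ l₁ g l₂, lc = l₁ ++ g :: l₂ → ∀ x ∈ l₁ ++ l₂, x ∈ lc := fun l₁ g l₂ hl x hx => by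
    rw [hl]
    rcases List.mem_append.1 hx with h | h <;> simp [h]
  have hers : ∀ l₁ g l₂, lc = l₁ ++ g :: l₂ → (supp (l₁ ++ l₂)).sup id = (supp lc).sup id :=
    fun l₁ g l₂ hl => by
      rw [supp_erase_of_nodup (hl ▸ hlc), ← hl, hC.sup_erase]
  -- Circuit below `p`: the number of low letters is always `s + |C| - 1`, and their join does not
  -- depend on the deleted letter, so the functional is constant.
  by_cases hlow : ∀ g ∈ lc, (g : α) ≤ p
  · have hlt : ∀ g ∈ lc, (g : α) < p := fun g hg => lt_of_le_of_ne (hlow g hg) (hne g hg)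
    refine main (functional p H ((lowPart p l).length + (lc.length - 1))
      ((supp (lowPart p l)).sup id ⊔ (supp lc).sup id) (l.count (pt p H)) (coordPoly p H F))
      fun l₁ g l₂ hl => ?_
    rw [wordFunctional, hcount l₁ g l₂ hl, List.append_assoc, lowPart_append,
      lowPart_eq_self fun x hx => hlt x (hsub l₁ g l₂ hl x hx), List.length_append, supp_append,
      Finset.sup_union, hers l₁ g l₂ hl]
    congr 4
    simp only [hl, List.length_append, List.length_cons]
    omega
  -- No letter of the circuit below `p`: the functional depends on `l` alone.
  by_cases hhigh : ∀ g ∈ lc, ¬ (g : α) ≤ p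
  · refine main (wordFunctional p l (coordPoly p H F)) fun l₁ g l₂ hl => ?_
    rw [wordFunctional, wordFunctional, hcount l₁ g l₂ hl, List.append_assoc, lowPart_append,
      lowPart_eq_nil fun x hx h => hhigh x (hsub l₁ g l₂ hl x hx) h.le, List.append_nil]
  push Not at hlow hhigh
  obtain ⟨c, hc, hcp⟩ := hhigh
  obtain ⟨v, hv, hvp⟩ := hlow
  have hcs : (c : α) ≤ (supp lc).sup id := Finset.le_sup (f := id) (coe_mem_supp.2 hc)
  have hy : p ⊔ (supp lc).sup id ∈ H := sup_new_mem hp hH hH' (hH.circuit_sup_mem hC)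
    (fun e => (hat c hc).1 (le_bot_iff.1 (e ▸ le_inf hcp hcs)))
    fun h => hvp ((Finset.le_sup (f := id) (coe_mem_supp.2 hv)).trans h)
  -- Mixed circuit: once `p` is spanned by other factors, the letters of `C` that remain complete a
  -- bad set with join `p ⊔ ⋁ C`. So only the value at `t = 0` survives.
  have key : ∀ l₁ g l₂, lc = l₁ ++ g :: l₂ → ∀ (S : Finset α) (T : Finset H),
      S ⊆ supp ((l ++ l₁ ++ l₂).map (toH p b)) → (∀ s ∈ S, s ≤ p) → (∀ t ∈ T, (t : α) ≤ p) →
      p ≤ S.sup id ⊔ T.sup (fun t => (t : α)) → ∀ f, ∏ t ∈ T, MvPolynomial.X t ∣ f →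
      f • val p b (l ++ l₁ ++ l₂) = 0 := fun l₁ g l₂ hl S T hSk hS hT hsp f hf => by
    refine spanning_bad hp hH hH' hSk hS hT hsp hy
      (V := (supp (l₁ ++ l₂)).filter fun v => ¬ v ≤ p) (Q := ∅) ?_ ?_ ?_ (by simp) ?_
    · rw [← hers l₁ g l₂ hl]; convert sup_filter_not_le p (supp (l₁ ++ l₂))
    · intro w hw e
      obtain ⟨h, hw⟩ := mem_supp.1 (Finset.mem_of_mem_filter _ hw)
      have hwa : IsAtom w := hat _ (hsub l₁ g l₂ hl _ hw)
      rcases hwa.le_iff.1 (e ▸ le_sup_left : p ≤ w) with h | h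
      · exact hH'.ne_bot (Finset.mem_insert_self p H) h
      · exact new_ne_of_isAtom hp hH hH' hwa h.symm
    · intro w hw
      have hw := Finset.mem_of_mem_filter _ hw
      refine Or.inl (mem_supp_map_toH b ?_ ?_)
      · rw [List.append_assoc, supp_append]; exact Finset.mem_union_right _ hw
      · obtain ⟨h, hw⟩ := mem_supp.1 hw
        exact hne _ (hsub l₁ g l₂ hl _ hw)
    · rw [Finset.prod_empty, one_mul]; exact hf
  refine main (if l.count (pt p H) = 0 then (coordPoly p H F).coeff 0 else 0)
    fun l₁ g l₂ hl => ?_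
  by_cases hval : val p b (l ++ l₁ ++ l₂) = 0
  · rw [hval, smul_zero, smul_zero]
  set k := l ++ l₁ ++ l₂ with hk
  have hlowS : ∀ s ∈ supp (lowPart p k), s ≤ p := fun s => lowPart_le hp hH hH'
  rw [← hcount l₁ g l₂ hl]
  unfold wordFunctional functional
  split_ifs with e0 e1 e2
  · rw [LinearMap.add_apply, add_smul, LinearMap.smul_apply, smul_eq_mul,
      key l₁ g l₂ hl _ _ (supp_lowPart_subset b k) hlowS
        (isComplement_complement hp hH hH' (supp_lowPart_le p k)).le (complement_span hp hH hH' k) _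
        (dvd_mul_right _ _), add_zero]
    rfl
  -- With `s ≥ rk p` the functional is zero although `k` need not be; but then the odd letters
  -- already span `p` and the value of the word is zero.
  · exfalso
    refine hval ?_
    have hs : (supp (lowPart p k)).sup id = p :=
      eq_of_le_of_rk_le (Finset.sup_le hlowS) (by
        rw [(lowPart_indep hp hH hH' hval).2]; exact not_lt.1 e1)
    have := key l₁ g l₂ hl _ ∅ (supp_lowPart_subset b k) hlowS (by simp)
      (by rw [hs]; exact le_sup_left) 1 (by simp)
    rwa [one_smul] at this
  · obtain ⟨i1, i2, i3⟩ := insert_span hp hH hH' hb e2.1 e2.2 hval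
    rw [zero_smul]
    exact key l₁ g l₂ hl _ ∅ i2 i1 (by simp) (by rw [i3]; exact le_sup_left) _ (by simp)
  · rw [LinearMap.zero_apply]

/-- The action of `extend` on polynomials. -/
theorem extend_algebraMap (f : MvPolynomial H ℚ) :
    ∃ F, extend p H (algebraMap _ _ f) = algebraMap _ _ F ∧ coordPoly p H F = Polynomial.C f := by
  classical
  refine ⟨MvPolynomial.aeval (fun g : H => MvPolynomial.X (inc p H g) +
    if (g : α) ≤ p then MvPolynomial.X (pt p H) else 0) f, ?_, ?_⟩
  · induction f using MvPolynomial.induction_on with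
    | C c =>
      simp only [MvPolynomial.aeval_C]
      rw [← IsScalarTower.algebraMap_apply, ← MvPolynomial.algebraMap_eq,
        ← IsScalarTower.algebraMap_apply, AlgHom.commutes]
    | add f g hf hg => simp only [map_add, hf, hg]
    | mul_X f g hf =>
      rw [map_mul, map_mul, map_mul, map_mul, hf, MvPolynomial.aeval_X]
      congr 1
      refine (extend_genX p g).trans ?_
      split_ifs <;> simp [genX]
  · rw [← AlgHom.comp_apply]
    have : (coordPoly p H).comp (MvPolynomial.aeval (fun g : H => MvPolynomial.X (inc p H g) +
        if (g : α) ≤ p then MvPolynomial.X (pt p H) else 0)) =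
        (Algebra.ofId (MvPolynomial H ℚ) (Polynomial (MvPolynomial H ℚ))).restrictScalars ℚ := by
      ext1 g
      rw [AlgHom.comp_apply, MvPolynomial.aeval_X, map_add, coordPoly, MvPolynomial.aeval_X,
        xval_inc]
      have : (Algebra.ofId (MvPolynomial H ℚ) (Polynomial (MvPolynomial H ℚ))).restrictScalars ℚ
        (MvPolynomial.X g) = Polynomial.C (MvPolynomial.X g) := rfl
      rw [this]
      split_ifs
      · rw [MvPolynomial.aeval_X, xval_pt hp, sub_add_cancel]
      · rw [map_zero, sub_zero, add_zero]
    rw [this]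
    rfl

/-- `extend` carries the linear relation of `g` to that of `H ∪ {p}`, and images of polynomials
under `extend` are free of `t`. -/
theorem coordPoly_abovePoly {g : α} (hg : IsAtom g) :
    coordPoly p H (abovePoly (insert p H) g) = Polynomial.C (abovePoly H g) := by
  obtain ⟨F, h1, h2⟩ := extend_algebraMap hp hH hH' (abovePoly H g)
  rw [algebraMap_abovePoly, extend_linear hp hH hH' g hg, ← algebraMap_abovePoly] at h1
  rw [ExteriorAlgebra.algebraMap_leftInverse _ |>.injective h1, h2]

theorem retr_relIdeal [IsAtomistic α] [IsUpperModularLattice α] {b : H} (hb : (b : α) ≤ p)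
    (a : FreeAlg (insert p H)) (ha : a ∈ relIdeal (insert p H)) : retr p b a = 0 := by
  classical
  have key : ∀ r, Relation (insert p H) r → ∀ (F : MvPolynomial ↥(insert p H) ℚ) l,
      retr p b (algebraMap _ _ F * monE _ l * r) = 0 := by
    intro r hr F l
    cases hr with
    | monomial l' T hl h =>
      obtain ⟨W, hW, hs, hn⟩ := (not_isNested_iff hH'.bot_notMem _).1 h
      have : algebraMap _ _ F * monE _ l * (monE _ l' * monX _ T) =
          algebraMap _ _ ((∏ g ∈ T, MvPolynomial.X g) * F) * monE (insert p H) (l ++ l') := by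
        rw [monE_append, map_mul, monX, ← mul_assoc, ← Algebra.commutes]
        simp only [mul_assoc]
      rw [this, retr_apply, map_mul]
      refine wordFunctional_bad hp hH hH' hb ⟨hs, hn⟩ (fun w hw => ?_) _
      obtain ⟨h, h'⟩ := hW w hw
      rcases Finset.mem_union.1 h' with h' | h'
      · exact Or.inl (mem_supp.2 ⟨h, List.mem_append_right _ (List.mem_toFinset.1 h')⟩)
      · exact Or.inr ⟨h, h'⟩
    | circuit l' hl hn hc =>
      obtain ⟨hC, ha⟩ := (isBlowupCircuit_iff _).1 hc
      exact retr_mul_circuit hp hH hH' hb F l l' hl hC ha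
    | linear g hg =>
      rw [← algebraMap_abovePoly, mul_assoc, ← Algebra.commutes, ← mul_assoc, ← map_mul, retr_apply,
        map_mul, coordPoly_abovePoly hp hH hH' hg, mul_comm, wordFunctional_C_mul, mul_smul,
        hH.linear_eq_zero hg]
  have key' : ∀ r, Relation (insert p H) r → ∀ c, retr p b (c * r) = 0 := fun r hr c => by
    have : retr p b ∘ₗ LinearMap.mulRight ℚ r = 0 :=
      FreeAlg.linearMap_ext fun F l => key r hr F l
    exact LinearMap.congr_fun this c
  rw [relIdeal_eq] at ha
  suffices ∀ c, retr p b (c * a) = 0 by simpa using this 1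
  induction ha using Submodule.span_induction with
  | mem r hr => exact key' r hr
  | zero => simp
  | add x y _ _ hx hy => intro c; rw [mul_add, map_add, hx, hy, add_zero]
  | smul d x _ hx => intro c; rw [smul_eq_mul, ← mul_assoc, hx]

/-- `retr` is a left inverse of `extend`. -/
theorem retr_extend [IsAtomistic α] [IsUpperModularLattice α] {b : H} (hb : (b : α) ≤ p)
    (a : FreeAlg H) : retr p b (extend p H a) = toBHat H a := by
  classical
  suffices retr p b ∘ₗ (extend p H).toLinearMap = (toBHat H).toLinearMap from
    LinearMap.congr_fun this a
  refine FreeAlg.linearMap_ext fun f l => ?_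
  simp only [LinearMap.comp_apply, AlgHom.toLinearMap_apply]
  let P : H → Prop := fun g => (g : α) ≤ p
  have hperm : l.Perm (l.filter P ++ l.filter fun g => ¬ P g) := by
    have := (List.filter_append_perm (fun g : H => decide (P g)) l).symm
    simpa using this
  set lp := l.filter P with hlp
  set lv := l.filter (fun g => ¬ P g) with hlv
  suffices retr p b (extend p H (algebraMap _ _ f * monE H (lp ++ lv))) =
      toBHat H (algebraMap _ _ f * monE H (lp ++ lv)) by
    rcases (genE_anticomm H).prod_perm hperm with h | h
    · rw [monE, h]; exact this
    · rw [monE, h, mul_neg, map_neg, map_neg, map_neg]; exact congrArg Neg.neg this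
  have hP : ∀ g ∈ lp, (g : α) ≤ p := fun g hg => by simpa [P] using (List.mem_filter.1 hg).2
  have hV : ∀ g ∈ lv, ¬ (g : α) ≤ p := fun g hg => by simpa [P] using (List.mem_filter.1 hg).2
  have hlow : ∀ g ∈ lp.map (inc p H), (g : α) < p := fun g hg => by
    obtain ⟨g', hg', rfl⟩ := List.mem_map.1 hg
    exact lt_of_le_of_ne (hP g' hg') fun e => hp (e ▸ g'.2)
  have hhigh : ∀ g ∈ lv.map (inc p H), ¬ (g : α) < p := fun g hg => by
    obtain ⟨g', hg', rfl⟩ := List.mem_map.1 hg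
    exact fun h => hV g' hg' h.le
  have hpt : ∀ k : List H, pt p H ∉ k.map (inc p H) := fun k h => by
    obtain ⟨g', _, e⟩ := List.mem_map.1 h
    have e : (g' : α) = p := congrArg (fun x : ↥(insert p H) => (x : α)) e
    exact hp (e ▸ g'.2)
  obtain ⟨F, hF, hFc⟩ := extend_algebraMap hp hH hH' f
  have hE := genE_anticomm (insert p H)
  have hadd := prod_wdel_add (E := fun g : H => genE (insert p H) (inc p H g))
    (ε := genE _ (pt p H)) (hE.sq_eq_zero _) (fun g => hE _ _) lp
  -- The substitution formula `prod_wdel_add` with `ε = e_p` on the letters below `p`; the other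
  -- letters are unchanged.
  have h1 : extend p H (monE H (lp ++ lv)) = monE _ ((lp ++ lv).map (inc p H)) +
      monE _ [pt p H] * wdel (fun _ => 1) (genE _) (lp.map (inc p H)) *
        monE _ (lv.map (inc p H)) := by
    rw [map_monE, List.map_append, List.prod_append, wdel_map, List.map_append, monE_append, monE,
      monE, monE, List.map_map, List.map_map, List.map_singleton, List.prod_singleton, ← add_mul]
    congr 1
    · refine Eq.trans (congrArg List.prod (List.map_congr_left fun g hg => ?_)) hadd.1
      rw [extend_genE, if_pos (hP g hg)]
    · refine congrArg List.prod (List.map_congr_left fun g hg => ?_)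
      rw [extend_genE, if_neg (hV g hg), add_zero]; rfl
  have hcount : ((lp ++ lv).map (inc p H)).count (pt p H) = 0 := List.count_eq_zero.2 (hpt _)
  have hlow1 : lowPart p ((lp ++ lv).map (inc p H)) = lp.map (inc p H) := by
    rw [List.map_append, lowPart_append, lowPart_eq_self hlow, lowPart_eq_nil hhigh,
      List.append_nil]
  -- Deleting one letter leaves `lp.length - 1` low letters, so the condition `s + 1 = rk p` reads
  -- `lp.length = rk p`.
  have h2 := retr_wdel b F (if lp.length = rk p then f else 0) [pt p H] (lp.map (inc p H))
    (lv.map (inc p H)) fun l₁ g l₂ hl => by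
      have hsub : ∀ x ∈ l₁ ++ l₂, x ∈ lp.map (inc p H) := fun x hx => by
        rw [hl]
        rcases List.mem_append.1 hx with h | h <;> simp [h]
      have hc : ([pt p H] ++ l₁ ++ l₂ ++ lv.map (inc p H)).count (pt p H) = 1 := by
        rw [List.count_append, List.append_assoc, List.count_append,
          List.count_eq_zero.2 (hpt lv), List.count_eq_zero.2 fun h => hpt lp (hsub _ h),
          List.count_singleton_self]
      have hlo : lowPart p ([pt p H] ++ l₁ ++ l₂ ++ lv.map (inc p H)) = l₁ ++ l₂ := by
        rw [lowPart_append, List.append_assoc, lowPart_append, lowPart_eq_nil hhigh,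
          lowPart_eq_self fun x hx => hlow x (hsub x hx), lowPart_eq_nil, List.append_nil,
          List.nil_append]
        intro x hx; rw [List.mem_singleton.1 hx]; exact lt_irrefl p
      have hlen : lp.length = (l₁ ++ l₂).length + 1 := by
        rw [← List.length_map (f := inc p H), hl]
        simp only [List.length_append, List.length_cons]; omega
      congr 1
      rw [wordFunctional, hc, hlo, hFc, functional, if_neg one_ne_zero, hlen]
      simp only [true_and]
      split_ifs
      · exact Polynomial.eval_C
      · rfl
  have hpb : ([pt p H] : List ↥(insert p H)).map (toH p b) = [b] := by
    rw [List.map_singleton, toH_pt hp]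
  have hmap : (lp.map (inc p H)).map (toH p b) = lp := by
    rw [List.map_map, show (toH p b ∘ inc p H : H → H) = id from funext (toH_inc p b), List.map_id]
  have hatoms : ∀ g ∈ lp, IsAtom (g : α) := fun g hg => isAtom_of_le_new hp hH hH' g.2 (hP g hg)
  have hle : ∀ k : List H, (∀ g ∈ k, (g : α) ≤ p) → (supp k).sup id ≤ p := fun k hk =>
    Finset.sup_le fun a ha => by
      obtain ⟨_, h⟩ := mem_supp.1 ha
      exact hk _ h
  have hdep : ∀ k : List H, (∀ g ∈ k, (g : α) ≤ p) → rk p < k.length →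
      wdel (fun _ => 1) (bE H) k = 0 ∧ (k.map (bE H)).prod = 0 := fun k hk hlt =>
    hH.dependent_eq_zero (fun g hg => isAtom_of_le_new hp hH hH' g.2 (hk g hg))
      (avoids_of_le_new hp hH hH' (hle k hk)) fun h => by
        have h3 := rk_mono (hle k hk)
        rw [h.2.2, card_supp h.1] at h3
        omega
  rw [map_mul, hF, h1, mul_add, map_add, retr_apply, h2, val_map_inc, val_map_inc, val, hpb, hmap,
    toBHat_algebraMap_mul, toBHat_monE, hFc, wordFunctional, hcount, hlow1, List.length_map,
    functional, if_pos rfl, List.map_append, List.prod_append]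
  -- For fewer than `rk p` low letters the term without `e_p` contributes, for exactly `rk p` the
  -- term with `e_p`, and beyond that the monomial is already zero in `BHat H`.
  rcases lt_trichotomy lp.length (rk p) with h | h | h
  · rw [if_pos h, if_neg h.ne, zero_smul, add_zero, LinearMap.add_apply, LinearMap.smul_apply,
      residue_C _ (by omega), smul_zero, add_zero, Polynomial.lcoeff_apply, Polynomial.coeff_C_zero]
  -- `b` together with `rk p` further letters below `p` is dependent, so `∂ (e_b e_L) = e_L - e_b ∂
  -- e_L` vanishes.
  · have h3 := (hdep (b :: lp) (fun g hg => by
      rcases List.mem_cons.1 hg with rfl | hg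
      · exact hb
      · exact hP g hg) (by simp [h])).1
    rw [wdel_cons, one_mul, sub_eq_zero] at h3
    rw [if_neg (by omega), if_pos h, LinearMap.zero_apply, zero_smul, zero_add, List.map_singleton,
      List.prod_singleton, h3]
  · rw [if_neg (by omega), if_neg (by omega), LinearMap.zero_apply, zero_smul, zero_smul, zero_add,
      (hdep lp hP h).2, zero_mul, smul_zero]

-- The letter `e_⊤` is kept by `toH` because `⊤ ∈ H`, so it remains a factor of `val`.
omit hp hH hH' in
theorem retr_mul_top {b : H} (h : ⊤ ∈ H)
    (a : FreeAlg (insert p H)) :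
    retr p b (a * genE _ ⟨⊤, Finset.mem_insert_of_mem h⟩) ∈ topIdeal H h := by
  have h1 : bE H ⟨⊤, h⟩ ∈ topIdeal H h := TwoSidedIdeal.subset_span rfl
  have : ((topIdeal H h).restrictScalars ℚ).mkQ ∘ₗ retr p b ∘ₗ
      LinearMap.mulRight ℚ (genE _ ⟨⊤, Finset.mem_insert_of_mem h⟩) = 0 := by
    refine FreeAlg.linearMap_ext fun F l => ?_
    simp only [LinearMap.comp_apply, LinearMap.mulRight_apply, LinearMap.zero_apply,
      Submodule.mkQ_apply, Submodule.Quotient.mk_eq_zero]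
    have h2 : algebraMap _ _ F * monE (insert p H) l *
        genE _ (⟨⊤, Finset.mem_insert_of_mem h⟩ : ↥(insert p H)) =
        algebraMap _ _ F * monE _ (l ++ [inc p H ⟨⊤, h⟩]) := by
      rw [monE_append, mul_assoc, monE_cons, monE_nil, mul_one]; rfl
    rw [h2, retr_apply, val_append, Submodule.restrictScalars_mem, ← mul_smul_comm]
    have h3 : val p b [inc p H ⟨⊤, h⟩] = bE H ⟨⊤, h⟩ := by
      simp [val, toH_inc]
    rw [h3, Algebra.smul_def, ← mul_assoc]
    exact Ideal.mul_mem_left _ _ h1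
  have := LinearMap.congr_fun this a
  simpa only [LinearMap.comp_apply, LinearMap.mulRight_apply, LinearMap.zero_apply,
      Submodule.mkQ_apply, Submodule.Quotient.mk_eq_zero, Submodule.restrictScalars_mem] using this

end Retract

end Leray
namespace Leray

universe u v

section Linear

theorem exists_linearMap_of_surjective {R A B N : Type*} [Ring R] [AddCommGroup A] [Module R A]
    [AddCommGroup B] [Module R B] [AddCommGroup N] [Module R N] {q : A →ₗ[R] B}
    (hq : Function.Surjective q) (f : A →ₗ[R] N) (h : ∀ a, q a = 0 → f a = 0) :
    ∃ g : B →ₗ[R] N, ∀ a, g (q a) = f a := by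
  refine ⟨(LinearMap.ker q).liftQ f (fun a ha => h a (LinearMap.mem_ker.1 ha)) ∘ₗ
    (q.quotKerEquivOfSurjective hq).symm.toLinearMap, fun a => ?_⟩
  have : (q.quotKerEquivOfSurjective hq).symm (q a) = (LinearMap.ker q).mkQ a := by
    rw [LinearEquiv.symm_apply_eq]; rfl
  rw [LinearMap.comp_apply, LinearEquiv.coe_coe, this]
  rfl

end Linear

/-! ### The bigrading. -/

section Bidegree

variable {α : Type u} {H : Finset α}

theorem mem_bidegree {i j : ℕ} {f : MvPolynomial H ℚ} {l : List H}
    (hf : MvPolynomial.IsWeightedHomogeneous (fun _ => 2) f i) (hl : l.length = j) :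
    algebraMap _ _ f * monE H l ∈ bidegree H i j := Submodule.subset_span ⟨f, l, hf, hl, rfl⟩

theorem mul_mem_bidegree {i j i' j' : ℕ} {a a' : FreeAlg H} (ha : a ∈ bidegree H i j)
    (ha' : a' ∈ bidegree H i' j') : a * a' ∈ bidegree H (i + i') (j + j') := by
  have : bidegree H i j * bidegree H i' j' ≤ bidegree H (i + i') (j + j') := by
    rw [bidegree, bidegree, Submodule.span_mul_span, Submodule.span_le]
    rintro _ ⟨_, ⟨f, l, hf, hl, rfl⟩, _, ⟨f', l', hf', hl', rfl⟩, rfl⟩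
    have : algebraMap _ _ f * monE H l * (algebraMap _ _ f' * monE H l') =
        algebraMap _ _ (f * f') * monE H (l ++ l') := by
      rw [monE_append, map_mul, mul_assoc, mul_assoc, ← mul_assoc (monE H l), ← Algebra.commutes,
        mul_assoc]
    change algebraMap _ _ f * monE H l * (algebraMap _ _ f' * monE H l') ∈ _
    rw [this]
    exact mem_bidegree (hf.mul hf') (by rw [List.length_append, hl, hl'])
  exact this (Submodule.mul_mem_mul ha ha')

theorem one_mem_bidegree : (1 : FreeAlg H) ∈ bidegree H 0 0 := by
  have := mem_bidegree (H := H) (l := []) (MvPolynomial.isWeightedHomogeneous_one ℚ _) rfl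
  simpa using this

theorem genE_mem_bidegree (g : H) : genE H g ∈ bidegree H 0 1 := by
  have := mem_bidegree (H := H) (l := [g]) (MvPolynomial.isWeightedHomogeneous_one ℚ _) rfl
  simpa using this

theorem genX_mem_bidegree (g : H) : genX H g ∈ bidegree H 2 0 := by
  have := mem_bidegree (H := H) (l := []) (MvPolynomial.isWeightedHomogeneous_X ℚ _ g) rfl
  simpa [genX] using this

theorem map_bidegree_le {β : Type v} {H' : Finset β} (F : FreeAlg H →ₐ[ℚ] FreeAlg H')
    (hE : ∀ g, F (genE H g) ∈ bidegree H' 0 1) (hX : ∀ g, F (genX H g) ∈ bidegree H' 2 0)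
    (i j : ℕ) : (bidegree H i j).map F.toLinearMap ≤ bidegree H' i j := by
  have hE' : ∀ l : List H, F (monE H l) ∈ bidegree H' 0 l.length := fun l => by
    induction l with
    | nil => rw [monE_nil, map_one]; exact one_mem_bidegree
    | cons g l ih =>
      rw [monE_cons, map_mul, List.length_cons]
      have := mul_mem_bidegree (hE g) ih
      rwa [zero_add, add_comm] at this
  have hX' : ∀ d : H →₀ ℕ, F (algebraMap _ _ (MvPolynomial.monomial d (1 : ℚ))) ∈
      bidegree H' (Finsupp.weight (fun _ => 2) d) 0 := fun d => by
    induction d using Finsupp.induction_linear with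
    | zero =>
      rw [show MvPolynomial.monomial (0 : H →₀ ℕ) (1 : ℚ) = 1 from rfl, map_one, map_one,
        map_zero]
      exact one_mem_bidegree
    | add d d' hd hd' =>
      have : MvPolynomial.monomial (d + d') (1 : ℚ) =
          MvPolynomial.monomial d 1 * MvPolynomial.monomial d' 1 := by
        rw [MvPolynomial.monomial_mul, one_mul]
      rw [this, map_mul, map_mul, map_add]
      have := mul_mem_bidegree hd hd'
      rwa [add_zero] at this
    | single g n =>
      rw [← MvPolynomial.X_pow_eq_monomial, Finsupp.weight_single, map_pow, map_pow]
      induction n with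
      | zero => rw [pow_zero, zero_smul]; exact one_mem_bidegree
      | succ n ih =>
        rw [pow_succ, add_smul, one_smul]
        have := mul_mem_bidegree ih (hX g)
        rwa [add_zero] at this
  rw [Submodule.map_le_iff_le_comap, bidegree, Submodule.span_le]
  rintro _ ⟨f, l, hf, rfl, rfl⟩
  change F _ ∈ bidegree H' i l.length
  rw [map_mul, ← zero_add l.length, ← add_zero i]
  refine mul_mem_bidegree ?_ (hE' l)
  rw [f.as_sum, map_sum, map_sum]
  refine sum_mem fun d hd => ?_
  have h1 : MvPolynomial.monomial d (f.coeff d) =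
      (f.coeff d) • MvPolynomial.monomial d (1 : ℚ) := by
    rw [MvPolynomial.smul_monomial, smul_eq_mul, mul_one]
  have h2 : algebraMap _ (FreeAlg H) ((f.coeff d) • MvPolynomial.monomial d (1 : ℚ)) =
      (f.coeff d) • algebraMap _ _ (MvPolynomial.monomial d (1 : ℚ)) := by
    rw [Algebra.smul_def, map_mul, Algebra.smul_def]; rfl
  rw [h1, h2, map_smul, ← hf (MvPolynomial.mem_support_iff.1 hd)]
  exact Submodule.smul_mem _ _ (hX' d)

end Bidegree

/-! ### Compatibility of the substitution with bigrading and differential. -/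

section ExtendDifferential

variable {α : Type u} [Lattice α] [BoundedOrder α] [Fintype α] [DecidableEq α] {H : Finset α} (p : α)

theorem map_extend_bidegree (i j : ℕ) :
    (bidegree H i j).map (extend p H).toLinearMap ≤ bidegree (insert p H) i j := by
  classical
  refine map_bidegree_le _ (fun g => ?_) (fun g => ?_) i j
  · rw [extend_genE]
    refine add_mem (genE_mem_bidegree _) ?_
    split_ifs
    · exact genE_mem_bidegree _
    · exact zero_mem _
  · rw [extend_genX]
    refine add_mem (genX_mem_bidegree _) ?_
    split_ifs
    · exact genX_mem_bidegree _
    · exact zero_mem _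

theorem differential_genE_mul (H : Finset α) (g : H) (a : FreeAlg H) :
    differential H (genE H g * a) = genX H g * a - genE H g * differential H a := by
  rw [differential, antiderivation_genE_mul, Algebra.smul_def]; rfl

theorem extend_differential {G : Finset α} (hp : p ∉ H) (hH : IsPartialBuildingSet G H)
    (hH' : IsPartialBuildingSet G (insert p H)) (a : FreeAlg H) :
    extend p H (differential H a) = differential (insert p H) (extend p H a) := by
  classical
  suffices (extend p H).toLinearMap ∘ₗ (differential H).restrictScalars ℚ =
      (differential (insert p H)).restrictScalars ℚ ∘ₗ (extend p H).toLinearMap from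
    LinearMap.congr_fun this a
  refine FreeAlg.linearMap_ext fun f l => ?_
  simp only [LinearMap.comp_apply, AlgHom.toLinearMap_apply, LinearMap.restrictScalars_apply]
  obtain ⟨F, hF, -⟩ := extend_algebraMap hp hH hH' f
  have h1 := antiderivation_algebraMap_mul H MvPolynomial.X f (monE H l)
  have h2 := antiderivation_algebraMap_mul (insert p H) MvPolynomial.X F (extend p H (monE H l))
  rw [← differential] at h1 h2
  rw [h1, map_mul, map_mul, hF, h2]
  congr 1
  induction l with
  | nil =>
    have h0 : ∀ H : Finset α, differential H (1 : FreeAlg H) = 0 := fun H =>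
      CliffordAlgebra.contractLeft_one (Q := (0 : QuadraticForm (MvPolynomial H ℚ)
        (H →₀ MvPolynomial H ℚ))) _
    rw [monE_nil, map_one (extend p H), h0, h0, map_zero]
  | cons g l ih =>
    rw [monE_cons, differential_genE_mul, map_sub, map_mul, map_mul, map_mul, ih (by
      rw [differential, antiderivation_algebraMap_mul]) (by
      rw [differential, antiderivation_algebraMap_mul]), extend_genX, extend_genE]
    split_ifs
    · rw [add_mul, add_mul, add_mul, map_add, differential_genE_mul, differential_genE_mul]
      abel
    · rw [add_zero, add_zero, differential_genE_mul]

end ExtendDifferential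

/-! ### The quotient by `e_⊤` and its differential. -/

section Top

variable {α : Type u} [Lattice α] [BoundedOrder α] [Fintype α] [DecidableEq α] {G H : Finset α}

open Classical in
/-- The endomorphism of `R(H)` with `e_⊤ ↦ 0` which fixes all other generators. -/
noncomputable def killTop (H : Finset α) : FreeAlg H →ₐ[ℚ] FreeAlg H :=
  FreeAlg.lift H (fun g => if (g : α) = ⊤ then 0 else genE H g) (genX H)
    (fun g h => by
      dsimp only
      split_ifs <;> simp [genE_anticomm H g h]) (genX_comm H)

theorem killTop_genX (g : H) : killTop H (genX H g) = genX H g := FreeAlg.lift_genX ..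

open Classical in
theorem killTop_genE (g : H) : killTop H (genE H g) = if (g : α) = ⊤ then 0 else genE H g :=
  FreeAlg.lift_genE ..

theorem killTop_algebraMap (f : MvPolynomial H ℚ) :
    killTop H (algebraMap _ _ f) = algebraMap _ _ f := by
  induction f using MvPolynomial.induction_on with
  | C c =>
    rw [← MvPolynomial.algebraMap_eq, ← IsScalarTower.algebraMap_apply, AlgHom.commutes]
  | add f g hf hg => rw [map_add, map_add, hf, hg]
  | mul_X f g hf =>
    rw [map_mul, map_mul, hf]
    exact congrArg _ (killTop_genX g)

theorem killTop_of_mem {a : FreeAlg H} (ha : a ∈ reducedSubalgebra H) : killTop H a = a := by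
  have : reducedSubalgebra H ≤ AlgHom.equalizer (killTop H) (AlgHom.id ℚ _) := by
    rw [reducedSubalgebra, Algebra.adjoin_le_iff]
    rintro _ (⟨g, rfl⟩ | ⟨g, hg, rfl⟩)
    · exact killTop_genX g
    · exact (killTop_genE g).trans (if_neg hg)
  exact this ha

theorem killTop_monE_of_mem {l : List H} (h : ∃ g ∈ l, (g : α) = ⊤) : killTop H (monE H l) = 0 := by
  obtain ⟨g, hg, hgt⟩ := h
  rw [map_monE]
  refine List.prod_eq_zero (List.mem_map.2 ⟨g, hg, ?_⟩)
  rw [killTop_genE, if_pos hgt]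

theorem monE_mem_reducedSubalgebra {l : List H} (h : ∀ g ∈ l, (g : α) ≠ ⊤) :
    monE H l ∈ reducedSubalgebra H := by
  refine Subalgebra.list_prod_mem _ fun x hx => ?_
  obtain ⟨g, hg, rfl⟩ := List.mem_map.1 hx
  exact Algebra.subset_adjoin (Or.inr ⟨g, h g hg, rfl⟩)

/-- Monomials are killed or fixed. Circuits consist of atoms, so when `⊤` is not an atom their
boundaries do not involve `e_⊤`. -/
theorem toBHat_killTop (hT : ¬ IsAtom (⊤ : α)) {a : FreeAlg H} (ha : a ∈ relIdeal H) :
    toBHat H (killTop H a) = 0 := by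
  refine relIdeal_le_ker H ((toBHat H).comp (killTop H)) (fun r hr => ?_) a ha
  rw [AlgHom.comp_apply]
  cases hr with
  | monomial l T hl h =>
    rw [map_mul, monX, killTop_algebraMap]
    by_cases ht : ∃ g ∈ l, (g : α) = ⊤
    · rw [killTop_monE_of_mem ht, zero_mul, map_zero]
    · push Not at ht
      rw [killTop_of_mem (monE_mem_reducedSubalgebra ht)]
      exact (Relation.monomial l T hl h).toBHat_eq_zero
  | circuit l hl hn hc =>
    have hC := ((isBlowupCircuit_iff _).1 hc).1
    have ht : ∀ g ∈ l, (g : α) ≠ ⊤ := fun g hg e =>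
      hT (e ▸ hC.atom _ (coe_mem_supp.2 hg))
    have : killTop H (boundary H (monE H l)) = boundary H (monE H l) := by
      rw [boundary_monE, map_wdel]
      refine wdel_congr (fun _ _ => map_one _) fun g hg => ?_
      rw [killTop_genE, if_neg (ht g hg)]
    rw [this]
    exact (Relation.circuit l hl hn hc).toBHat_eq_zero
  | linear g hg =>
    rw [← algebraMap_abovePoly, killTop_algebraMap, algebraMap_abovePoly]
    exact (Relation.linear g hg).toBHat_eq_zero

theorem mem_topIdeal {h : ⊤ ∈ H} {x : BHat H} :
    x ∈ topIdeal H h ↔ ∃ a, x = toBHat H (a * genE H ⟨⊤, h⟩) := by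
  have : topIdeal H h = Ideal.span {toBHat H (genE H ⟨⊤, h⟩)} := by
    refine TwoSidedIdeal.span_asIdeal_eq fun r hr a => ?_
    obtain rfl := hr
    obtain ⟨a, rfl⟩ := toBHat_surjective H a
    refine FreeAlg.exists_mul_eq (toBHat H) (fun g a => ?_) _
      (fun g => Or.inr (bE_anticomm H ⟨⊤, h⟩ g)) a
    obtain ⟨a, rfl⟩ := toBHat_surjective H a
    rw [← map_mul, genX_comm, map_mul]
  rw [this, Ideal.mem_span_singleton']
  constructor
  · rintro ⟨a, rfl⟩
    obtain ⟨a, rfl⟩ := toBHat_surjective H a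
    exact ⟨a, (map_mul _ _ _).symm⟩
  · rintro ⟨a, rfl⟩
    exact ⟨toBHat H a, (map_mul _ _ _).symm⟩

theorem toBAlg_eq_zero_iff {h : ⊤ ∈ H} {a : FreeAlg H} :
    toBAlg H h a = 0 ↔ ∃ u, a - u * genE H ⟨⊤, h⟩ ∈ relIdeal H := by
  refine (Ideal.Quotient.eq_zero_iff_mem (I := topIdeal H h)).trans ?_
  refine mem_topIdeal.trans (exists_congr fun u => ?_)
  rw [← toBHat_eq_zero_iff, map_sub, sub_eq_zero]; rfl

theorem toBAlg_surjective (h : ⊤ ∈ H) : Function.Surjective (toBAlg H h) :=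
  Ideal.Quotient.mk_surjective.comp (toBHat_surjective H)

theorem toBAlg_eq_zero {h : ⊤ ∈ H} {a : FreeAlg H} (ha : toBHat H a = 0) : toBAlg H h a = 0 := by
  rw [toBAlg, AlgHom.comp_apply, ha, map_zero]

theorem killTop_mem_relIdeal (hT : ¬ IsAtom (⊤ : α)) {h : ⊤ ∈ H} {a : FreeAlg H}
    (ha : toBAlg H h a = 0) : killTop H a ∈ relIdeal H := by
  obtain ⟨u, hu⟩ := toBAlg_eq_zero_iff.1 ha
  have := toBHat_killTop hT hu
  rw [map_sub, map_mul, killTop_genE, if_pos rfl, mul_zero, sub_zero] at this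
  exact toBHat_eq_zero_iff.1 this

/-- The differential of `B(α, H)`. -/
theorem exists_differential_BAlg [IsUpperModularLattice α] (hH : IsPartialBuildingSet G H)
    (hT : ¬ IsAtom (⊤ : α)) (h : ⊤ ∈ H) : ∃ d : BAlg H h →ₗ[ℚ] BAlg H h, ∀ a,
      d (toBAlg H h a) = toBAlg H h (differential H (killTop H a)) :=
  exists_linearMap_of_surjective (q := (toBAlg H h).toLinearMap) (toBAlg_surjective h)
    ((toBAlg H h).toLinearMap ∘ₗ (differential H).restrictScalars ℚ ∘ₗ (killTop H).toLinearMap)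
    fun _ ha => toBAlg_eq_zero (hH.toBHat_differential (killTop_mem_relIdeal hT ha))

/-- The differential of `B̂(α, H)`. -/
theorem exists_differential_BHat [IsUpperModularLattice α] (hH : IsPartialBuildingSet G H) :
    ∃ d : BHat H →ₗ[ℚ] BHat H, IsDifferentialBHat H d :=
  exists_linearMap_of_surjective (q := (toBHat H).toLinearMap) (toBHat_surjective H)
    ((toBHat H).toLinearMap ∘ₗ (differential H).restrictScalars ℚ)
    fun _ ha => hH.toBHat_differential (toBHat_eq_zero_iff.1 ha)

/-- For `p ≠ ⊤` the substitution fixes `e_⊤` and never introduces it elsewhere, so it commutes with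
`e_⊤ ↦ 0`. -/
theorem extend_killTop {p : α} (hpt : p ≠ ⊤) (a : FreeAlg H) :
    extend p H (killTop H a) = killTop (insert p H) (extend p H a) := by
  classical
  suffices (extend p H).comp (killTop H) = (killTop (insert p H)).comp (extend p H) from
    DFunLike.congr_fun this a
  have h1 : killTop (insert p H) (genE _ (pt p H)) = genE _ (pt p H) :=
    (killTop_genE _).trans (if_neg hpt)
  refine FreeAlg.algHom_ext (fun g => ?_) fun g => ?_
  · rw [AlgHom.comp_apply, AlgHom.comp_apply, killTop_genE, extend_genE, map_add, killTop_genE]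
    have h2 : ((inc p H g : ↥(insert p H)) : α) = g := rfl
    rw [h2]
    by_cases hg : (g : α) = ⊤
    · rw [if_pos hg, if_pos hg, if_neg fun hle => hpt (top_le_iff.1 (hg ▸ hle)), map_zero, map_zero,
        add_zero]
    · rw [if_neg hg, if_neg hg, extend_genE]
      split_ifs
      · rw [h1]
      · rw [map_zero]
  · rw [AlgHom.comp_apply, AlgHom.comp_apply, killTop_genX, extend_genX, map_add, killTop_genX]
    split_ifs
    · rw [killTop_genX]
    · rw [map_zero]

end Top

end Leray
-- Injectivity and the main theorem.
namespace Leray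

universe u v

variable {α : Type u} [Lattice α] [BoundedOrder α] [Fintype α] [DecidableEq α] {G H : Finset α}
  {p : α} (hp : p ∉ H) (hH : IsPartialBuildingSet G H) (hH' : IsPartialBuildingSet G (insert p H))

include hp hH hH'

theorem exists_atom_le_new : ∃ b : H, (b : α) ≤ p := by
  obtain ⟨b, hb, hbp⟩ := (eq_bot_or_exists_atom_le p).resolve_left
    (hH'.ne_bot (Finset.mem_insert_self p H))
  exact ⟨⟨b, hH.atom_mem b hb⟩, hbp⟩

theorem not_isAtom_top : ¬ IsAtom (⊤ : α) := fun h => by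
  rcases h.le_iff.1 (le_top (a := p)) with e | e
  · exact hH'.ne_bot (Finset.mem_insert_self p H) e
  · exact not_isAtom_new hp hH hH' (e ▸ h)

theorem toBHat_eq_zero_of_extend [IsAtomistic α] [IsUpperModularLattice α] {a : FreeAlg H}
    (h : toBHat (insert p H) (extend p H a) = 0) : toBHat H a = 0 := by
  obtain ⟨b, hb⟩ := exists_atom_le_new hp hH hH'
  rw [← retr_extend hp hH hH' hb]
  exact retr_relIdeal hp hH hH' hb _ (toBHat_eq_zero_iff.1 h)

/-- If `extend a` equals a multiple of `e_⊤` modulo relations, applying `retr` shows that the class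
of `a` is in the ideal of `e_⊤`. -/
theorem toBAlg_eq_zero_of_extend [IsAtomistic α] [IsUpperModularLattice α] {a : FreeAlg H}
    (ht : ⊤ ∈ H) (h : toBAlg (insert p H) (Finset.mem_insert_of_mem ht) (extend p H a) = 0) :
    toBAlg H ht a = 0 := by
  obtain ⟨b, hb⟩ := exists_atom_le_new hp hH hH'
  obtain ⟨u, hu⟩ := toBAlg_eq_zero_iff.1 h
  have h1 := retr_relIdeal hp hH hH' hb _ hu
  rw [map_sub, retr_extend hp hH hH' hb, sub_eq_zero] at h1
  exact Ideal.Quotient.eq_zero_iff_mem.2 (h1 ▸ retr_mul_top ht u)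

theorem toBAlg_extend_eq_zero [IsUpperModularLattice α] {a : FreeAlg H} (ht : ⊤ ∈ H)
    (h : toBAlg H ht a = 0) :
    toBAlg (insert p H) (Finset.mem_insert_of_mem ht) (extend p H a) = 0 := by
  obtain ⟨u, hu⟩ := toBAlg_eq_zero_iff.1 h
  have hpt : ¬ ⊤ ≤ p := fun h => hp (top_le_iff.1 h ▸ ht)
  have h1 := toBAlg_eq_zero (h := Finset.mem_insert_of_mem ht) (extend_relIdeal hp hH hH' _ hu)
  have h2 : toBAlg (insert p H) (Finset.mem_insert_of_mem ht) (genE _ (inc p H ⟨⊤, ht⟩)) = 0 :=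
    toBAlg_eq_zero_iff.2 ⟨1, by rw [one_mul]; exact (sub_self (genE _ (inc p H ⟨⊤, ht⟩))) ▸ zero_mem _⟩
  rwa [map_sub, map_sub, map_mul, map_mul, extend_genE, if_neg hpt, add_zero, h2, mul_zero,
    sub_zero] at h1

end Leray

open Classical in
theorem mainTheorem3 {α : Type*} [Lattice α] [BoundedOrder α] [Fintype α] [DecidableEq α]
    [IsAtomistic α] [IsUpperModularLattice α]
    (G H : Finset α) (p : α) (hp : p ∉ H) (hG : ⊤ ∈ G)
    (hH : Leray.IsPartialBuildingSet G H) (hH' : Leray.IsPartialBuildingSet G (insert p H)) :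
    (∃ (d : Leray.BHat H →ₗ[ℚ] Leray.BHat H)
        (d' : Leray.BHat (insert p H) →ₗ[ℚ] Leray.BHat (insert p H))
        (φ : Leray.BHat H →ₐ[ℚ] Leray.BHat (insert p H)),
      Leray.IsDifferentialBHat H d ∧ Leray.IsDifferentialBHat (insert p H) d' ∧
      (∀ g : H, φ (Leray.toBHat H (Leray.genE H g)) =
        Leray.toBHat (insert p H)
          (Leray.genE (insert p H) ⟨g, Finset.mem_insert_of_mem g.2⟩ +
            if (g : α) ≤ p then Leray.genE (insert p H) ⟨p, Finset.mem_insert_self p H⟩ else 0)) ∧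
      (∀ g : H, φ (Leray.toBHat H (Leray.genX H g)) =
        Leray.toBHat (insert p H)
          (Leray.genX (insert p H) ⟨g, Finset.mem_insert_of_mem g.2⟩ +
            if (g : α) ≤ p then Leray.genX (insert p H) ⟨p, Finset.mem_insert_self p H⟩ else 0)) ∧
      (∀ i j : ℕ, ((Leray.bidegree H i j).map (Leray.toBHat H).toLinearMap).map φ.toLinearMap ≤
        (Leray.bidegree (insert p H) i j).map (Leray.toBHat (insert p H)).toLinearMap) ∧
      (∀ b, φ (d b) = d' (φ b)) ∧
      Function.Injective φ) ∧
    (∀ ht : ⊤ ∈ H,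
      ∃ (d : Leray.BAlg H ht →ₗ[ℚ] Leray.BAlg H ht)
        (d' : Leray.BAlg (insert p H) (Finset.mem_insert_of_mem ht) →ₗ[ℚ]
          Leray.BAlg (insert p H) (Finset.mem_insert_of_mem ht))
        (φ : Leray.BAlg H ht →ₐ[ℚ] Leray.BAlg (insert p H) (Finset.mem_insert_of_mem ht)),
      Leray.IsDifferentialBAlg H ht d ∧
      Leray.IsDifferentialBAlg (insert p H) (Finset.mem_insert_of_mem ht) d' ∧
      (∀ g : H, φ (Leray.toBAlg H ht (Leray.genE H g)) =
        Leray.toBAlg (insert p H) (Finset.mem_insert_of_mem ht)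
          (Leray.genE (insert p H) ⟨g, Finset.mem_insert_of_mem g.2⟩ +
            if (g : α) ≤ p then Leray.genE (insert p H) ⟨p, Finset.mem_insert_self p H⟩ else 0)) ∧
      (∀ g : H, φ (Leray.toBAlg H ht (Leray.genX H g)) =
        Leray.toBAlg (insert p H) (Finset.mem_insert_of_mem ht)
          (Leray.genX (insert p H) ⟨g, Finset.mem_insert_of_mem g.2⟩ +
            if (g : α) ≤ p then Leray.genX (insert p H) ⟨p, Finset.mem_insert_self p H⟩ else 0)) ∧
      (∀ i j : ℕ,
        ((Leray.bidegree H i j).map (Leray.toBAlg H ht).toLinearMap).map φ.toLinearMap ≤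
          (Leray.bidegree (insert p H) i j).map
            (Leray.toBAlg (insert p H) (Finset.mem_insert_of_mem ht)).toLinearMap) ∧
      (∀ b, φ (d b) = d' (φ b)) ∧
      Function.Injective φ) := by
  have hbi := Leray.map_extend_bidegree (H := H) p
  have hmem : ∀ (i j : ℕ) {B B' : Type _} [Ring B] [Algebra ℚ B] [Ring B'] [Algebra ℚ B']
      (q : Leray.FreeAlg H →ₐ[ℚ] B) (q' : Leray.FreeAlg (insert p H) →ₐ[ℚ] B') (φ : B →ₐ[ℚ] B'),
      (∀ a, φ (q a) = q' (Leray.extend p H a)) →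
      ((Leray.bidegree H i j).map q.toLinearMap).map φ.toLinearMap ≤
        (Leray.bidegree (insert p H) i j).map q'.toLinearMap := by
    rintro i j B B' _ _ _ _ q q' φ hφ _ ⟨_, ⟨a, ha, rfl⟩, rfl⟩
    exact ⟨_, hbi i j ⟨a, ha, rfl⟩, (hφ a).symm⟩
  refine ⟨?_, fun ht => ?_⟩
  · obtain ⟨d, hd⟩ := Leray.exists_differential_BHat hH
    obtain ⟨d', hd'⟩ := Leray.exists_differential_BHat hH'
    let φ : Leray.BHat H →ₐ[ℚ] Leray.BHat (insert p H) := Ideal.Quotient.liftₐ (Leray.relIdeal H)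
      ((Leray.toBHat (insert p H)).comp (Leray.extend p H))
      (fun a ha => Leray.extend_relIdeal hp hH hH' a ha)
    have hφ : ∀ a, φ (Leray.toBHat H a) = Leray.toBHat (insert p H) (Leray.extend p H a) :=
      fun _ => rfl
    refine ⟨d, d', φ, hd, hd', fun g => ?_, fun g => ?_, fun i j => hmem i j _ _ φ hφ,
      fun b => ?_, ?_⟩
    · rw [hφ, Leray.extend_genE]; rfl
    · rw [hφ, Leray.extend_genX]; rfl
    · obtain ⟨a, rfl⟩ := Leray.toBHat_surjective H b
      rw [hd, hφ, hφ, hd', Leray.extend_differential p hp hH hH']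
    · rw [injective_iff_map_eq_zero]
      intro b hb
      obtain ⟨a, rfl⟩ := Leray.toBHat_surjective H b
      exact Leray.toBHat_eq_zero_of_extend hp hH hH' hb
  · have hT := Leray.not_isAtom_top hp hH hH'
    obtain ⟨d, hd⟩ := Leray.exists_differential_BAlg hH hT ht
    obtain ⟨d', hd'⟩ := Leray.exists_differential_BAlg hH' hT (Finset.mem_insert_of_mem ht)
    have hker : ∀ b ∈ Leray.topIdeal H ht, (Ideal.Quotient.liftₐ (Leray.relIdeal H)
        ((Leray.toBAlg (insert p H) (Finset.mem_insert_of_mem ht)).comp (Leray.extend p H))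
        (fun a ha => Leray.toBAlg_eq_zero (Leray.extend_relIdeal hp hH hH' a ha))) b = 0 := by
      intro b hb
      obtain ⟨a, rfl⟩ := Leray.toBHat_surjective H b
      exact Leray.toBAlg_extend_eq_zero hp hH hH' ht (Ideal.Quotient.eq_zero_iff_mem.2 hb)
    let φ : Leray.BAlg H ht →ₐ[ℚ] Leray.BAlg (insert p H) (Finset.mem_insert_of_mem ht) :=
      Ideal.Quotient.liftₐ (Leray.topIdeal H ht) _ hker
    have hφ : ∀ a, φ (Leray.toBAlg H ht a) =
        Leray.toBAlg (insert p H) (Finset.mem_insert_of_mem ht) (Leray.extend p H a) :=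
      fun _ => rfl
    refine ⟨d, d', φ, fun a ha => ?_, fun a ha => ?_, fun g => ?_, fun g => ?_,
      fun i j => hmem i j _ _ φ hφ, fun b => ?_, ?_⟩
    -- The differential was built as `d` after `e_⊤ ↦ 0`, and that substitution is the identity on
    -- the reduced subalgebra.
    · rw [hd, Leray.killTop_of_mem ha]
    · rw [hd', Leray.killTop_of_mem ha]
    · rw [hφ, Leray.extend_genE]; rfl
    · rw [hφ, Leray.extend_genX]; rfl
    · obtain ⟨a, rfl⟩ := Leray.toBAlg_surjective ht b
      rw [hd, hφ, hφ, hd', Leray.extend_differential p hp hH hH',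
        Leray.extend_killTop (show p ≠ ⊤ from fun e => hp (e ▸ ht))]
    · rw [injective_iff_map_eq_zero]
      intro b hb
      obtain ⟨a, rfl⟩ := Leray.toBAlg_surjective ht b
      exact Leray.toBAlg_eq_zero_of_extend hp hH hH' ht hb
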